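/- Let $\mathbb I=(0,1)$. Let $\varphi:\mathbb R\to(0,\infty)$ be a bounded probability density with $\varphi(x)=\varphi(-x)$ and distribution function $\Phi(x)=\int_{-\infty}^x\varphi(y)\,dy$, such that for every $\varepsilon'>0$ there is $c_{\varepsilon'}>0$ with $\varphi(x)\ge c_{\varepsilon'}\Phi(x)^{1+\varepsilon'}$ for all $x\le 0$. Let $\Phi^{-1}:\mathbb I\to\mathbb R$ be the inverse of $\Phi$. Fix $p\ge 1$ and put $\eta(0)=0$ and $\eta(u)=2^{-p-2}u^{-p-1}\exp(2^p-u^{-p})$ for $u\in(0,1/2]$. For $\theta\in(0,1/2]$ let $$w_\theta(u)=\begin{cases}(1-\theta)^{-1}\eta(u/\theta),&u\in(0,\theta/2],\\(1-\theta)^{-1}\bigl(1-\eta(1-u/\theta)\bigr),&u\in(\theta/2,\theta),\\(1-\theta)^{-1},&u\in[\theta,1/2],\\ w_\theta(1-u),&u\in(1/2,1),\end{cases}\qquad T_\theta(u)=\Phi^{-1}\Bigl(\int_0^u w_\theta(t)\,dt\Bigr).$$ For $f:\mathbb R^s\to\mathbb R$ and $\theta_1,\dots,\theta_s\in(0,1/2]$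 put $$f^w(\boldsymbol u)=\Bigl(\prod_{j=1}^s w_{\theta_j}(u_j)\Bigr)\,f\bigl(T_{\theta_1}(u_1),\dots,T_{\theta_s}(u_s)\bigr),\qquad \boldsymbol u\in\mathbb I^s .$$ For $v\subseteq\{1,\dots,s\}$ let $\partial^v=\prod_{j\in v}\partial/\partial x_j$ denote the weak mixed derivative ($\partial^\emptyset f=f$), and let $$\|f\|_{W^{1,q}_{\mathrm{mix}}(\mathbb R^s,\varphi)}=\Bigl(\sum_{v\subseteq\{1,\dots,s\}}\int_{\mathbb R^s}|\partial^v f(\boldsymbol x)|^q\prod_{j=1}^s\varphi(x_j)\,d\boldsymbol x\Bigr)^{1/q},\qquad \|g\|_{W^{1,1}_{\mathrm{mix}}(\mathbb I^s)}=\sum_{v\subseteq\{1,\dots,s\}}\int_{\mathbb I^s}|\partial^v g(\boldsymbol u)|\,d\boldsymbol u ,$$ the corresponding spaces consisting of the functions all of whose weak derivatives $\partial^v$ exist and for which the norm is finite. Then for every $q>1$ and $\varepsilon>0$ there is a constant $C_{\varepsilon,p,q}>0$, depending only on $\varphi,\varepsilon,p,q$, such that for every $s$, every $f\in W^{1,q}_{\mathrm{mix}}(\mathbb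 R^s,\varphi)$ and all $\theta_1,\dots,\theta_s\in(0,1/2]$, the function $f^w$ belongs to $W^{1,1}_{\mathrm{mix}}(\mathbb I^s)$ and $$\|f^w\|_{W^{1,1}_{\mathrm{mix}}(\mathbb I^s)}\le\|f\|_{W^{1,q}_{\mathrm{mix}}(\mathbb R^s,\varphi)}\prod_{j=1}^s C_{\varepsilon,p,q}\,\theta_j^{-1/q-\varepsilon}.$$ -/

import Mathlib

open MeasureTheory Set
open scoped ContDiff

noncomputable section

namespace BDIS

/-! ### The density and its distribution function -/

/-- The cumulative distribution function `Φ(x) = ∫_{-∞}^x φ(y) dy`. -/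
def cdf (φ : ℝ → ℝ) (x : ℝ) : ℝ := ∫ y in Iic x, φ y

/-- The quantile function `Φ⁻¹`, used on `(0,1)` only. -/
def quantile (φ : ℝ → ℝ) (u : ℝ) : ℝ := sInf {x : ℝ | u ≤ cdf φ x}

/-- `φ` is a strictly positive, symmetric, bounded, light-tailed probability density on `ℝ`. -/
structure IsLightTailedDensity (φ : ℝ → ℝ) : Prop where
  measurable : Measurable φ
  integrable : Integrable φ
  integral_eq_one : ∫ x, φ x = 1
  pos : ∀ x, 0 < φ x
  symm : ∀ x, φ x = φ (-x)
  bounded : ∃ M : ℝ, ∀ x, φ x ≤ M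
  tail : ∀ ε : ℝ, 0 < ε → ∃ c : ℝ, 0 < c ∧ ∀ x : ℝ, x ≤ 0 → c * cdf φ x ^ (1 + ε) ≤ φ x

/-! ### Boundary-damping weights and transport maps -/

/-- `η_p(u) = 2^{-p-2} u^{-p-1} exp(2^p - u^{-p})` for `u ∈ (0,1/2]` and `η_p(0) = 0`; it is
evaluated on `[0,1/2]` only. -/
def eta (p u : ℝ) : ℝ :=
  if 0 < u then
    (2 : ℝ) ^ (-p - 2) * u ^ (-p - 1) * Real.exp ((2 : ℝ) ^ p - u ^ (-p))
  else 0

/-- The weight `w_θ` on `(0,1/2]`. -/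
def weightHalf (p θ u : ℝ) : ℝ :=
  if u ≤ θ / 2 then (1 - θ)⁻¹ * eta p (u / θ)
  else if u < θ then (1 - θ)⁻¹ * (1 - eta p (1 - u / θ))
  else (1 - θ)⁻¹

/-- The weight `w_θ` on `(0,1)`, with `w_θ(u) = w_θ(1-u)` for `u ∈ (1/2,1)`. -/
def weight (p θ u : ℝ) : ℝ :=
  if u ≤ 1 / 2 then weightHalf p θ u else weightHalf p θ (1 - u)

/-- The transport map `T_θ(u) = Φ⁻¹(∫_0^u w_θ(t) dt)`. -/
def transport (φ : ℝ → ℝ) (p θ u : ℝ) : ℝ :=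
  quantile φ (∫ t in (0 : ℝ)..u, weight p θ t)

/-- The transformed integrand `f^w(u) = (∏ⱼ w_{θⱼ}(uⱼ)) f(T_{θ₁}(u₁), …, T_{θₛ}(uₛ))`. -/
def transformed {s : ℕ} (φ : ℝ → ℝ) (p : ℝ) (θ : Fin s → ℝ) (f : (Fin s → ℝ) → ℝ)
    (u : Fin s → ℝ) : ℝ :=
  (∏ j, weight p (θ j) (u j)) * f (fun j => transport φ p (θ j) (u j))

/-! ### Weak mixed derivatives and the spaces `W^{1,q}_mix` -/

/-- The classical mixed derivative `(∏_{j ∈ v} ∂/∂xⱼ) ψ` (used for smooth `ψ` only, so that the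
order of differentiation is immaterial). -/
def mixedPartial {s : ℕ} (v : Finset (Fin s)) (ψ : (Fin s → ℝ) → ℝ) : (Fin s → ℝ) → ℝ :=
  (v.sort (· ≤ ·)).foldr (fun j g x => fderiv ℝ g x (Pi.single j 1)) ψ

/-- `g` is a weak mixed derivative `∂^v f` on the open set `Ω`. -/
structure IsWeakMixedDeriv {s : ℕ} (Ω : Set (Fin s → ℝ)) (v : Finset (Fin s))
    (f g : (Fin s → ℝ) → ℝ) : Prop where
  locallyIntegrableOn_fun : LocallyIntegrableOn f Ω
  locallyIntegrableOn_deriv : LocallyIntegrableOn g Ω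
  integral_eq : ∀ ψ : (Fin s → ℝ) → ℝ, ContDiff ℝ ∞ ψ → HasCompactSupport ψ → tsupport ψ ⊆ Ω →
    ∫ x in Ω, f x * mixedPartial v ψ x = (-1 : ℝ) ^ v.card * ∫ x in Ω, g x * ψ x

/-- A weak mixed derivative is unique up to a null set. -/
theorem IsWeakMixedDeriv.ae_eq {s : ℕ} {Ω : Set (Fin s → ℝ)} (hΩ : IsOpen Ω)
    {v : Finset (Fin s)} {f g h : (Fin s → ℝ) → ℝ} (hg : IsWeakMixedDeriv Ω v f g)
    (hh : IsWeakMixedDeriv Ω v f h) : g =ᵐ[volume.restrict Ω] h := by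
  have key : ∀ k : (Fin s → ℝ) → ℝ, LocallyIntegrableOn k Ω → ∀ ψ : (Fin s → ℝ) → ℝ,
      ContDiff ℝ ∞ ψ → HasCompactSupport ψ → tsupport ψ ⊆ Ω →
      IntegrableOn (fun x => k x * ψ x) Ω ∧
        ∫ x, k x * ψ x = ∫ x in Ω, k x * ψ x := by
    intro k hk ψ hψ hc hs
    have hi : IntegrableOn (fun x => k x * ψ x) (tsupport ψ) :=
      (hk.integrableOn_compact_subset hs hc).mul_continuousOn hψ.continuous.continuousOn hc
    have hi' : Integrable (fun x => k x * ψ x) := by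
      refine (integrableOn_iff_integrable_of_support_subset ?_).mp hi
      intro x hx
      exact subset_tsupport ψ (right_ne_zero_of_mul hx)
    refine ⟨hi'.integrableOn, (setIntegral_eq_integral_of_forall_compl_eq_zero ?_).symm⟩
    intro x hx
    rw [image_eq_zero_of_notMem_tsupport (fun hx' => hx (hs hx')), mul_zero]
  rw [Filter.EventuallyEq, ae_restrict_iff' hΩ.measurableSet]
  have hz : ∀ᵐ x, x ∈ Ω → (g - h) x = 0 := by
    refine hΩ.ae_eq_zero_of_integral_contDiff_smul_eq_zero
      (hg.locallyIntegrableOn_deriv.sub hh.locallyIntegrableOn_deriv) ?_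
    intro ψ hψ hc hs
    obtain ⟨ig, eg⟩ := key g hg.locallyIntegrableOn_deriv ψ hψ hc hs
    obtain ⟨ih, eh⟩ := key h hh.locallyIntegrableOn_deriv ψ hψ hc hs
    have e := (hg.integral_eq ψ hψ hc hs).symm.trans (hh.integral_eq ψ hψ hc hs)
    have e' : ∫ x in Ω, g x * ψ x = ∫ x in Ω, h x * ψ x :=
      mul_left_cancel₀ (pow_ne_zero _ (by norm_num)) e
    have e2 := (key (g - h)
      (hg.locallyIntegrableOn_deriv.sub hh.locallyIntegrableOn_deriv) ψ hψ hc hs).2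
    have e3 : ∫ x in Ω, (g - h) x * ψ x = 0 := by
      simp only [Pi.sub_apply, sub_mul]
      rw [integral_sub ig ih, e', sub_self]
    rw [← e3, ← e2]
    simp only [smul_eq_mul, mul_comm]
  filter_upwards [hz] with x hx hxΩ
  exact sub_eq_zero.mp (hx hxΩ)

open Classical in
/-- The weak mixed derivative `∂^v f` on `Ω` (a representative; `0` if there is none). -/
def weakMixedDeriv {s : ℕ} (Ω : Set (Fin s → ℝ)) (v : Finset (Fin s)) (f : (Fin s → ℝ) → ℝ) :
    (Fin s → ℝ) → ℝ :=
  if h : ∃ g, IsWeakMixedDeriv Ω v f g then h.choose else 0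

/-- `(∫ |g|^q dμ)^{1/q}`. -/
def lqNorm {s : ℕ} (q : ℝ) (μ : Measure (Fin s → ℝ)) (g : (Fin s → ℝ) → ℝ) : ℝ :=
  (∫ x, |g x| ^ q ∂μ) ^ (1 / q)

/-- All weak mixed derivatives `∂^v f`, `v ⊆ 1:s`, exist on `Ω` and lie in `L^q(μ)`. -/
def MemWMix {s : ℕ} (Ω : Set (Fin s → ℝ)) (q : ℝ) (μ : Measure (Fin s → ℝ))
    (f : (Fin s → ℝ) → ℝ) : Prop :=
  ∀ v : Finset (Fin s), (∃ g, IsWeakMixedDeriv Ω v f g) ∧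
    MemLp (weakMixedDeriv Ω v f) (ENNReal.ofReal q) μ

/-- `(∑_{v ⊆ 1:s} ‖∂^v f‖_{L^q(μ)}^q)^{1/q}`. -/
def wMixNorm {s : ℕ} (Ω : Set (Fin s → ℝ)) (q : ℝ) (μ : Measure (Fin s → ℝ))
    (f : (Fin s → ℝ) → ℝ) : ℝ :=
  (∑ v : Finset (Fin s), lqNorm q μ (weakMixedDeriv Ω v f) ^ q) ^ (1 / q)

/-- The open unit cube `𝕀^s = (0,1)^s`. -/
def cube (s : ℕ) : Set (Fin s → ℝ) := Set.pi univ (fun _ => Ioo (0 : ℝ) 1)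

/-- The measure `∏ⱼ φ(xⱼ) dx` on `ℝ^s`. -/
def densityMeasure (s : ℕ) (φ : ℝ → ℝ) : Measure (Fin s → ℝ) :=
  volume.withDensity (fun x => ENNReal.ofReal (∏ j, φ (x j)))

/-- `f ∈ W^{1,q}_mix(ℝ^s, φ)`. -/
def MemWMixDensity {s : ℕ} (q : ℝ) (φ : ℝ → ℝ) (f : (Fin s → ℝ) → ℝ) : Prop :=
  MemWMix univ q (densityMeasure s φ) f

/-- The norm of `W^{1,q}_mix(ℝ^s, φ)`. -/
def wMixNormDensity {s : ℕ} (q : ℝ) (φ : ℝ → ℝ) (f : (Fin s → ℝ) → ℝ) : ℝ :=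
  wMixNorm univ q (densityMeasure s φ) f

/-- `g ∈ W^{1,q}_mix(𝕀^s)`. -/
def MemWMixCube {s : ℕ} (q : ℝ) (g : (Fin s → ℝ) → ℝ) : Prop :=
  MemWMix (cube s) q (volume.restrict (cube s)) g

/-- The norm of `W^{1,q}_mix(𝕀^s)`. -/
def wMixNormCube {s : ℕ} (q : ℝ) (g : (Fin s → ℝ) → ℝ) : ℝ :=
  wMixNorm (cube s) q (volume.restrict (cube s)) g

end BDIS

end

/-! By the product and chain rules, `∂^v f^w` is a sum over `t ⊆ v` of terms in which the
derivatives in `t` fall on `f` and those in `v \ t` on the weights. Since `T' = w / φ(T)`, a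
coordinate contributes `w · w / φ(T)`, `w'` or `w`. Let `S` be the inverse of `T`. The substitution
`u = S(x)` turns `∏ w du` into `∏ φ dx`, so the `L¹` norm of a term is the integral of `|∂^t f| ∏
ρ_j(x_j)` against the product density, where each `ρ_j` is, up to sign, `w(S)/φ`, `w'(S)/w(S)` or
`1`. Hölder with exponents `q` and `b = q/(q-1)` separates `∂^t f` from the `ρ_j`, and the product
measure factorises the rest (`lintegral_expansionTerm_le`).

What remains is one-dimensional: `‖ρ‖_{L^b(φ)} = O(θ^{-1/q-ε})` (`exists_lintegral_factor_le`). Back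
on `(0,1)`, write `W` for the antiderivative of `w`. The tail condition bounds `φ(T(u))` below by a
multiple of `(W(1-W))^{1+δ}`. With `t = u/θ` and `H` the antiderivative of `η` at `t`, one has `w ≈
t^{-p-1} H` and `W ≈ θ H` for `u ≤ θ/2`, so the integrand `w (w W^{-1-δ})^b` is a negative power of
`t` times `H^{1-δb} θ^{-(1+δ)b}`. As `H` decays like `exp(-t^{-p})`, the remaining positive power of
`H` absorbs every power of `t`. The integrand is therefore `O(max(θ,u)^{-(1+δ)b})` on the left half;
its integral is `O(θ^{1-(1+δ)b})`, whose `1/b`-th power is `O(θ^{-1/q-δ})`. There are at most `2^s`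
sets `v` and `2^s` sets `t`, which costs a factor `4` per coordinate.

The product rule has to be proved in weak form, since `f` is only weakly differentiable and `φ` only
bounded and measurable. The test function is moved to `ℝ^s` instead: there it is multiplied by
factors which in the other coordinates are merely measurable, but it is Lipschitz in the direction
being differentiated, and mollification shows that this suffices for integration by parts
(`integral_mul_eq_neg_of_lipschitz`). One coordinate is treated in
`integral_expansionTerm_mul_partialDeriv`; induction over `v` does the rest. -/

namespace BDIS

noncomputable section

open Filter Topology
open scoped Convolution Pointwise

/-! ### Mixed partial derivatives of smooth functions -/

/-- The partial derivative `∂ψ/∂x_k`. -/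
def partialDeriv {s : ℕ} (k : Fin s) (ψ : (Fin s → ℝ) → ℝ) : (Fin s → ℝ) → ℝ :=
  fun x => fderiv ℝ ψ x (Pi.single k 1)

section MixedPartial

variable {s : ℕ} {ψ : (Fin s → ℝ) → ℝ}

theorem contDiff_partialDeriv (k : Fin s) (hψ : ContDiff ℝ ∞ ψ) :
    ContDiff ℝ ∞ (partialDeriv k ψ) :=
  (hψ.fderiv_right (m := ∞) (by simp)).clm_apply contDiff_const

theorem tsupport_partialDeriv_subset (k : Fin s) : tsupport (partialDeriv k ψ) ⊆ tsupport ψ := by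
  refine closure_minimal (fun x hx => ?_) (isClosed_tsupport ψ)
  refine support_fderiv_subset ℝ (fun h => hx ?_)
  simp only [partialDeriv, h, zero_apply]

theorem hasCompactSupport_partialDeriv (k : Fin s) (hψ : HasCompactSupport ψ) :
    HasCompactSupport (partialDeriv k ψ) :=
  hψ.of_isClosed_subset (isClosed_tsupport _) (tsupport_partialDeriv_subset k)

theorem partialDeriv_comm (j k : Fin s) (hψ : ContDiff ℝ ∞ ψ) :
    partialDeriv j (partialDeriv k ψ) = partialDeriv k (partialDeriv j ψ) := by
  have hd : Differentiable ℝ (fderiv ℝ ψ) :=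
    (hψ.fderiv_right (m := ∞) (by simp)).differentiable (by simp)
  have key : ∀ (a b : Fin s) (x : Fin s → ℝ), partialDeriv a (partialDeriv b ψ) x =
      fderiv ℝ (fderiv ℝ ψ) x (Pi.single a 1) (Pi.single b 1) := by
    intro a b x
    have h := ((hd x).hasFDerivAt.clm_apply
      (hasFDerivAt_const (Pi.single b (1 : ℝ) : Fin s → ℝ) x)).fderiv
    change fderiv ℝ (fun y => (fderiv ℝ ψ y) (Pi.single b 1)) x (Pi.single a 1) = _
    rw [h]
    simp
  ext x
  rw [key, key]
  exact second_derivative_symmetric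
    (fun y => (hψ.differentiable (by simp) y).hasFDerivAt) (hd x).hasFDerivAt _ _

theorem contDiff_foldr_partialDeriv (l : List (Fin s)) (hψ : ContDiff ℝ ∞ ψ) :
    ContDiff ℝ ∞ (l.foldr partialDeriv ψ) := by
  induction l with
  | nil => exact hψ
  | cons a l ih => exact contDiff_partialDeriv a ih

/-- Symmetry of second derivatives makes the sorted order in `mixedPartial` irrelevant. A new index
can then be differentiated last (`mixedPartial_insert`) or first (`mixedPartial_insert'`); the
induction over `v` needs both. -/
theorem foldr_partialDeriv_perm {l₁ l₂ : List (Fin s)} (h : l₁.Perm l₂) (hψ : ContDiff ℝ ∞ ψ) :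
    l₁.foldr partialDeriv ψ = l₂.foldr partialDeriv ψ := by
  induction h with
  | nil => rfl
  | cons a _ ih => simp only [List.foldr_cons, ih]
  | swap a b l => exact partialDeriv_comm _ _ (contDiff_foldr_partialDeriv l hψ)
  | trans _ _ ih₁ ih₂ => exact ih₁.trans ih₂

theorem mixedPartial_eq_foldr (v : Finset (Fin s)) (ψ : (Fin s → ℝ) → ℝ) :
    mixedPartial v ψ = (v.sort (· ≤ ·)).foldr partialDeriv ψ := rfl

theorem mixedPartial_empty (ψ : (Fin s → ℝ) → ℝ) : mixedPartial ∅ ψ = ψ := by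
  simp [mixedPartial_eq_foldr]

theorem contDiff_mixedPartial (v : Finset (Fin s)) (hψ : ContDiff ℝ ∞ ψ) :
    ContDiff ℝ ∞ (mixedPartial v ψ) :=
  contDiff_foldr_partialDeriv _ hψ

theorem tsupport_mixedPartial_subset (v : Finset (Fin s)) (ψ : (Fin s → ℝ) → ℝ) :
    tsupport (mixedPartial v ψ) ⊆ tsupport ψ := by
  rw [mixedPartial_eq_foldr]
  induction v.sort (· ≤ ·) with
  | nil => exact subset_rfl
  | cons a l ih => exact (tsupport_partialDeriv_subset a).trans ih

theorem hasCompactSupport_mixedPartial (v : Finset (Fin s)) (hψ : HasCompactSupport ψ) :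
    HasCompactSupport (mixedPartial v ψ) :=
  hψ.of_isClosed_subset (isClosed_tsupport _) (tsupport_mixedPartial_subset v ψ)

theorem sort_insert_perm {v : Finset (Fin s)} {k : Fin s} (hk : k ∉ v) :
    ((insert k v).sort (· ≤ ·)).Perm (k :: v.sort (· ≤ ·)) := by
  rw [← Multiset.coe_eq_coe, Finset.sort_eq, ← Multiset.cons_coe, Finset.sort_eq,
    Finset.insert_val_of_notMem hk]

theorem mixedPartial_insert {v : Finset (Fin s)} {k : Fin s} (hk : k ∉ v)
    (hψ : ContDiff ℝ ∞ ψ) :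
    mixedPartial (insert k v) ψ = partialDeriv k (mixedPartial v ψ) := by
  rw [mixedPartial_eq_foldr, foldr_partialDeriv_perm (sort_insert_perm hk) hψ]
  rfl

theorem mixedPartial_insert' {v : Finset (Fin s)} {k : Fin s} (hk : k ∉ v)
    (hψ : ContDiff ℝ ∞ ψ) :
    mixedPartial (insert k v) ψ = mixedPartial v (partialDeriv k ψ) := by
  have h : (k :: v.sort (· ≤ ·)).Perm (v.sort (· ≤ ·) ++ [k]) :=
    (List.perm_append_singleton _ _).symm
  rw [mixedPartial_eq_foldr, foldr_partialDeriv_perm ((sort_insert_perm hk).trans h) hψ,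
    List.foldr_append]
  rfl

end MixedPartial

/-! ### Integration by parts against functions that are Lipschitz in one direction -/

section Mollify

variable {s : ℕ}

/-- A sequence of bump functions at the origin whose supports shrink to a point. -/
def shrinkingBump (s n : ℕ) : ContDiffBump (0 : Fin s → ℝ) where
  rIn := 1 / (2 * ((n : ℝ) + 1))
  rOut := 1 / ((n : ℝ) + 1)
  rIn_pos := by positivity
  rIn_lt_rOut := by
    apply one_div_lt_one_div_of_lt <;> nlinarith [(n.cast_nonneg : (0 : ℝ) ≤ n)]

theorem tendsto_rOut_shrinkingBump (s : ℕ) :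
    Tendsto (fun n => (shrinkingBump s n).rOut) atTop (𝓝 0) :=
  tendsto_one_div_add_atTop_nhds_zero_nat

/-- Mollification with the `n`-th shrinking bump function. -/
def mollify (n : ℕ) (h : (Fin s → ℝ) → ℝ) : (Fin s → ℝ) → ℝ :=
  ((shrinkingBump s n).normed volume) ⋆[ContinuousLinearMap.lsmul ℝ ℝ, volume] h

theorem mollify_apply (n : ℕ) (h : (Fin s → ℝ) → ℝ) (x : Fin s → ℝ) :
    mollify n h x = ∫ t, (shrinkingBump s n).normed volume t * h (x - t) := rfl

theorem contDiff_mollify (n : ℕ) {h : (Fin s → ℝ) → ℝ} (hh : LocallyIntegrable h) :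
    ContDiff ℝ ∞ (mollify n h) :=
  (shrinkingBump s n).hasCompactSupport_normed.contDiff_convolution_left _
    (shrinkingBump s n).contDiff_normed hh

theorem hasCompactSupport_mollify (n : ℕ) {h : (Fin s → ℝ) → ℝ} (hh : HasCompactSupport h) :
    HasCompactSupport (mollify n h) :=
  HasCompactSupport.convolution _ (shrinkingBump s n).hasCompactSupport_normed hh

/-- All radii are at most `1`, so one set serves for every `n`; dominated convergence takes place on
it. -/
theorem support_mollify_subset (n : ℕ) (h : (Fin s → ℝ) → ℝ) :
    Function.support (mollify n h) ⊆ Metric.closedBall (0 : Fin s → ℝ) 1 + tsupport h := by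
  refine (support_convolution_subset _).trans (Set.add_subset_add ?_ (subset_tsupport h))
  rw [(shrinkingBump s n).support_normed_eq]
  refine Metric.ball_subset_closedBall.trans (Metric.closedBall_subset_closedBall ?_)
  change 1 / ((n : ℝ) + 1) ≤ 1
  rw [div_le_one (by positivity)]
  linarith [(n.cast_nonneg : (0 : ℝ) ≤ n)]

theorem abs_mollify_le (n : ℕ) {h : (Fin s → ℝ) → ℝ} {B : ℝ}
    (hB : ∀ x, |h x| ≤ B) (x : Fin s → ℝ) : |mollify n h x| ≤ B := by
  rw [mollify_apply]
  have hi : Integrable (fun t => (shrinkingBump s n).normed volume t * B) :=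
    ((shrinkingBump s n).integrable_normed).mul_const B
  calc |∫ t, (shrinkingBump s n).normed volume t * h (x - t)|
      ≤ ∫ t, (shrinkingBump s n).normed volume t * B := by
        refine norm_integral_le_of_norm_le (f := fun t =>
          (shrinkingBump s n).normed volume t * h (x - t)) hi (Eventually.of_forall fun t => ?_)
        rw [Real.norm_eq_abs, abs_mul, abs_of_nonneg ((shrinkingBump s n).nonneg_normed t)]
        exact mul_le_mul_of_nonneg_left (hB _) ((shrinkingBump s n).nonneg_normed t)
    _ = B := by rw [integral_mul_const, (shrinkingBump s n).integral_normed, one_mul]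

theorem locallyIntegrable_of_bounded {h : (Fin s → ℝ) → ℝ} (hm : Measurable h) {B : ℝ}
    (hB : ∀ x, |h x| ≤ B) : LocallyIntegrable h := by
  have : LocallyIntegrable (fun _ : Fin s → ℝ => B) := locallyIntegrable_const B
  refine this.mono hm.aestronglyMeasurable (Eventually.of_forall fun x => ?_)
  exact (hB x).trans (le_abs_self B)

/-- Continuity of `h` is not needed: the mollifications converge almost everywhere by Lebesgue
differentiation, and `|f| B` on a fixed compact set dominates. -/
theorem tendsto_integral_mul_mollify {f h : (Fin s → ℝ) → ℝ} (hf : LocallyIntegrable f)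
    (hm : Measurable h) {B : ℝ} (hB : ∀ x, |h x| ≤ B) (hc : HasCompactSupport h) :
    Tendsto (fun n => ∫ x, f x * mollify n h x) atTop (𝓝 (∫ x, f x * h x)) := by
  have hh := locallyIntegrable_of_bounded hm hB
  set K : Set (Fin s → ℝ) := Metric.closedBall (0 : Fin s → ℝ) 1 + tsupport h
  have hK : IsCompact K := (isCompact_closedBall _ _).add hc
  refine tendsto_integral_of_dominated_convergence
    (K.indicator fun x => |f x| * B) (fun n => ?_) ?_ (fun n => ?_) ?_
  · exact hf.aestronglyMeasurable.mul (contDiff_mollify n hh).continuous.aestronglyMeasurable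
  · rw [integrable_indicator_iff hK.measurableSet]
    exact ((hf.integrableOn_isCompact hK).abs).mul_const B
  · refine Eventually.of_forall fun x => ?_
    by_cases hx : x ∈ K
    · rw [indicator_of_mem hx, Real.norm_eq_abs, abs_mul]
      exact mul_le_mul_of_nonneg_left (abs_mollify_le n hB x) (abs_nonneg _)
    · have : mollify n h x = 0 := by
        by_contra h0
        exact hx (support_mollify_subset n h h0)
      rw [indicator_of_notMem hx, this, mul_zero, norm_zero]
  -- Almost everywhere convergence needs a bounded ratio of outer to inner radius; here it is always
  -- `2`.
  · have := ContDiffBump.ae_convolution_tendsto_right_of_locallyIntegrable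
      (φ := fun n => shrinkingBump s n) (K := 2) (tendsto_rOut_shrinkingBump s)
      (Eventually.of_forall fun n => by
        change 1 / ((n : ℝ) + 1) ≤ 2 * (1 / (2 * ((n : ℝ) + 1)))
        apply le_of_eq
        field_simp) hh
    filter_upwards [this] with x hx
    exact hx.const_mul (f x)

/-- Differentiation under the integral sign with the derivative placed on `Ψ`. The Lipschitz bound
along the lines in direction `k` dominates the difference quotients, so no regularity in the other
directions enters. -/
theorem partialDeriv_mollify {Ψ D : (Fin s → ℝ) → ℝ} {k : Fin s} (n : ℕ)
    (hΨ : Measurable Ψ) {B : ℝ} (hB : ∀ x, |Ψ x| ≤ B) {L : ℝ}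
    (hL : ∀ x (t t' : ℝ), |Ψ (x + t • Pi.single k 1) - Ψ (x + t' • Pi.single k 1)| ≤ L * |t - t'|)
    (hD : Measurable D)
    (hderiv : ∀ᵐ x, HasDerivAt (fun t : ℝ => Ψ (x + t • Pi.single k 1)) (D x) 0) :
    partialDeriv k (mollify n Ψ) = mollify n D := by
  have hΨi := locallyIntegrable_of_bounded hΨ hB
  set ρ : (Fin s → ℝ) → ℝ := (shrinkingBump s n).normed volume with hρ
  have hρc : Continuous ρ := (shrinkingBump s n).continuous_normed
  have hρi : Integrable ρ := (shrinkingBump s n).integrable_normed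
  have hρ0 : ∀ x, 0 ≤ ρ x := (shrinkingBump s n).nonneg_normed
  ext x
  have h1 : HasDerivAt (fun τ : ℝ => mollify n Ψ (x + τ • Pi.single k 1))
      (partialDeriv k (mollify n Ψ) x) 0 := by
    have hd := ((contDiff_mollify n hΨi).differentiable (by simp) x).hasFDerivAt
    exact hd.hasLineDerivAt _
  refine h1.unique ?_
  simp only [mollify_apply]
  have hm : ∀ y : Fin s → ℝ, Measurable fun t : Fin s → ℝ => y - t := fun y => by fun_prop
  refine (hasDerivAt_integral_of_dominated_loc_of_lip (s := univ) (bound := fun t => ρ t * |L|)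
    (F := fun (τ : ℝ) t => ρ t * Ψ (x + τ • Pi.single k 1 - t))
    (F' := fun t => ρ t * D (x - t)) univ_mem ?_ ?_ ?_ ?_ ?_ ?_).2
  · refine Eventually.of_forall fun τ => ?_
    exact (hρc.measurable.mul (hΨ.comp (hm _))).aestronglyMeasurable
  · refine (hρi.mul_const B).mono (hρc.measurable.mul (hΨ.comp (hm _))).aestronglyMeasurable
      (Eventually.of_forall fun t => ?_)
    rw [norm_mul, norm_mul]
    refine mul_le_mul_of_nonneg_left ?_ (norm_nonneg _)
    exact (hB _).trans (le_abs_self B)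
  · exact (hρc.measurable.mul (hD.comp (hm _))).aestronglyMeasurable
  · refine Eventually.of_forall fun t => ?_
    refine LipschitzOnWith.of_dist_le_mul fun a _ b _ => ?_
    rw [Real.dist_eq, Real.dist_eq, ← mul_sub, abs_mul, Real.coe_nnabs, abs_mul, abs_abs]
    rw [mul_assoc]
    refine mul_le_mul_of_nonneg_left ?_ (abs_nonneg _)
    have := hL (x - t) a b
    rw [sub_add_eq_add_sub, sub_add_eq_add_sub] at this
    exact this.trans (mul_le_mul_of_nonneg_right (le_abs_self L) (abs_nonneg _))
  · exact hρi.mul_const _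
  -- The exceptional null set of `hderiv` stays null under the reflection `t ↦ x - t`.
  · have hq : Measure.QuasiMeasurePreserving (fun t : Fin s → ℝ => x - t) volume volume :=
      (Measure.measurePreserving_sub_left volume x).quasiMeasurePreserving
    filter_upwards [hq.ae hderiv] with t ht
    have := ht.const_mul (ρ t)
    simpa only [sub_add_eq_add_sub] using this

/-- Integration by parts for a weak partial derivative against a compactly supported function which
is merely Lipschitz in the direction of differentiation. -/
theorem integral_mul_eq_neg_of_lipschitz {f g : (Fin s → ℝ) → ℝ} {k : Fin s}
    (hf : LocallyIntegrable f) (hg : LocallyIntegrable g)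
    (hfg : ∀ ψ : (Fin s → ℝ) → ℝ, ContDiff ℝ ∞ ψ → HasCompactSupport ψ →
      ∫ x, f x * partialDeriv k ψ x = -∫ x, g x * ψ x)
    {Ψ D : (Fin s → ℝ) → ℝ} (hΨ : Measurable Ψ) {B : ℝ} (hB : ∀ x, |Ψ x| ≤ B)
    (hΨc : HasCompactSupport Ψ) {L : ℝ}
    (hL : ∀ x (t t' : ℝ), |Ψ (x + t • Pi.single k 1) - Ψ (x + t' • Pi.single k 1)| ≤ L * |t - t'|)
    (hD : Measurable D) {B' : ℝ} (hB' : ∀ x, |D x| ≤ B') (hDc : HasCompactSupport D)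
    (hderiv : ∀ᵐ x, HasDerivAt (fun t : ℝ => Ψ (x + t • Pi.single k 1)) (D x) 0) :
    ∫ x, f x * D x = -∫ x, g x * Ψ x := by
  have h1 := tendsto_integral_mul_mollify hf hD hB' hDc
  have h2 := (tendsto_integral_mul_mollify hg hΨ hB hΨc).neg
  refine tendsto_nhds_unique h1 (h2.congr fun n => ?_)
  rw [← partialDeriv_mollify n hΨ hB hL hD hderiv]
  exact (hfg _ (contDiff_mollify n (locallyIntegrable_of_bounded hΨ hB))
    (hasCompactSupport_mollify n hΨc)).symm

end Mollify

/-- Testing `∂^A f` with `∂_k ψ` and `∂^{A ∪ {k}} f` with `ψ` gives the same integral of `f`; the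
signs differ by one factor `-1`. Thus the second derivative is the weak `∂_k` of the first. -/
theorem IsWeakMixedDeriv.integral_mul_partialDeriv {s : ℕ} {A : Finset (Fin s)} {k : Fin s}
    (hk : k ∉ A) {f g h : (Fin s → ℝ) → ℝ} (hg : IsWeakMixedDeriv univ A f g)
    (hh : IsWeakMixedDeriv univ (insert k A) f h) {ψ : (Fin s → ℝ) → ℝ}
    (hψ : ContDiff ℝ ∞ ψ) (hc : HasCompactSupport ψ) :
    ∫ x, g x * partialDeriv k ψ x = -∫ x, h x * ψ x := by
  have e1 := hg.integral_eq _ (contDiff_partialDeriv k hψ) (hasCompactSupport_partialDeriv k hc)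
    (subset_univ _)
  have e2 := hh.integral_eq ψ hψ hc (subset_univ _)
  rw [mixedPartial_insert' hk hψ, e1, Finset.card_insert_of_notMem hk, pow_succ] at e2
  simp only [Measure.restrict_univ] at e2
  have h0 : ((-1 : ℝ)) ^ A.card ≠ 0 := pow_ne_zero _ (by norm_num)
  apply mul_left_cancel₀ h0
  rw [e2]
  ring

end

end BDIS

namespace BDIS

noncomputable section

open Filter Topology
open scoped ENNReal

/-! ### Product measures -/

theorem lintegral_pi_prod {s : ℕ} (μ : Fin s → Measure ℝ) [∀ i, SigmaFinite (μ i)]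
    (f : Fin s → ℝ → ℝ≥0∞) (hf : ∀ i, Measurable (f i)) :
    ∫⁻ x, ∏ i, f i (x i) ∂Measure.pi μ = ∏ i, ∫⁻ x, f i x ∂μ i := by
  induction s with
  | zero => simp
  | succ n ih =>
    have hmp := (measurePreserving_piFinSuccAbove μ 0).symm
    rw [← hmp.lintegral_comp_emb (MeasurableEquiv.measurableEmbedding _)]
    simp_rw [MeasurableEquiv.piFinSuccAbove_symm_apply, Fin.insertNthEquiv,
      Fin.prod_univ_succ, Fin.insertNth_zero]
    simp only [Fin.zero_succAbove, Equiv.coe_fn_mk, Fin.cons_zero, Fin.cons_succ]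
    rw [← ih (fun i => μ i.succ) (fun i => f i.succ) (fun i => hf _)]
    refine lintegral_prod_mul (μ := μ 0) (ν := Measure.pi fun i : Fin n => μ i.succ)
      (f := f 0) (g := fun y : Fin n → ℝ => ∏ j, f j.succ (y j)) (hf 0).aemeasurable ?_
    exact (Finset.measurable_prod _
      fun j _ => (hf _).comp (measurable_pi_apply j)).aemeasurable

theorem pi_withDensity {s : ℕ} (μ : Fin s → Measure ℝ) [∀ i, SigmaFinite (μ i)]
    (f : Fin s → ℝ → ℝ) (hf : ∀ i, Measurable (f i)) :
    Measure.pi (fun i => (μ i).withDensity fun x => ENNReal.ofReal (f i x)) =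
      (Measure.pi μ).withDensity fun x => ∏ i, ENNReal.ofReal (f i (x i)) := by
  refine Measure.pi_eq fun t ht => ?_
  rw [withDensity_apply _ (MeasurableSet.univ_pi ht), Measure.restrict_pi_pi,
    lintegral_pi_prod _ (fun i x => ENNReal.ofReal (f i x)) fun i => (hf i).ennreal_ofReal]
  exact Finset.prod_congr rfl fun i _ => (withDensity_apply _ (ht i)).symm

theorem densityMeasure_eq_withDensity_prod (s : ℕ) {φ : ℝ → ℝ} (hφ : ∀ x, 0 < φ x) :
    densityMeasure s φ = volume.withDensity fun x => ∏ j, ENNReal.ofReal (φ (x j)) := by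
  unfold densityMeasure
  congr 1
  ext x
  exact ENNReal.ofReal_prod_of_nonneg fun j _ => (hφ _).le

theorem densityMeasure_eq_pi (s : ℕ) {φ : ℝ → ℝ} (hφ : ∀ x, 0 < φ x) (hm : Measurable φ) :
    densityMeasure s φ =
      Measure.pi fun _ => volume.withDensity fun x => ENNReal.ofReal (φ x) := by
  rw [pi_withDensity _ _ fun _ => hm, densityMeasure_eq_withDensity_prod s hφ]
  rfl

theorem measurableSet_cube (s : ℕ) : MeasurableSet (cube s) :=
  MeasurableSet.univ_pi fun _ => measurableSet_Ioo

theorem isOpen_cube (s : ℕ) : IsOpen (cube s) :=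
  isOpen_set_pi finite_univ fun _ _ => isOpen_Ioo

/-! ### One-dimensional transport maps -/

/-- `S` transports the density `φ` on `ℝ` to the continuously differentiable weight `w` on `(0,1)`,
and `T` is its inverse. -/
structure IsTransport (φ w dw S T : ℝ → ℝ) : Prop where
  hasDerivAt_weight : ∀ u, HasDerivAt w (dw u) u
  continuous_deriv : Continuous dw
  weight_pos : ∀ u ∈ Ioo (0 : ℝ) 1, 0 < w u
  strictMono : StrictMono S
  continuous : Continuous S
  range_eq : range S = Ioo 0 1
  left_inv : ∀ x, T (S x) = x
  measurePreserving : MeasurePreserving S (volume.withDensity fun x => ENNReal.ofReal (φ x))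
    ((volume.restrict (Ioo 0 1)).withDensity fun u => ENNReal.ofReal (w u))
  -- `S` itself need not be Lipschitz, because `w` may vanish at `0` and `1`; only the `w`-mass
  -- between two image points is controlled.
  lipschitz : ∃ M : ℝ, ∀ x y, |∫ t in S x..S y, w t| ≤ M * |x - y|
  hasDerivAt : ∀ᵐ x, HasDerivAt S (φ x / w (S x)) x

theorem IsTransport.continuous_weight {φ w dw S T : ℝ → ℝ} (h : IsTransport φ w dw S T) :
    Continuous w :=
  continuous_iff_continuousAt.2 fun u => (h.hasDerivAt_weight u).continuousAt

theorem IsTransport.mem_Ioo {φ w dw S T : ℝ → ℝ} (h : IsTransport φ w dw S T) (x : ℝ) :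
    S x ∈ Ioo (0 : ℝ) 1 := h.range_eq ▸ mem_range_self x

/-! ### Change of variables between the cube and `ℝ^s`, and the terms of the product rule -/

section ChangeOfVariables

variable {s : ℕ} {φ : ℝ → ℝ} {w dw S T : Fin s → ℝ → ℝ}

/-- The coordinatewise map `x ↦ (S₁(x₁), …, Sₛ(xₛ))`. -/
def coordMap (S : Fin s → ℝ → ℝ) (x : Fin s → ℝ) : Fin s → ℝ := fun j => S j (x j)

theorem continuous_coordMap (h : ∀ j, IsTransport φ (w j) (dw j) (S j) (T j)) :
    Continuous (coordMap S) :=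
  continuous_pi fun j => (h j).continuous.comp (continuous_apply j)

theorem measurableEmbedding_coordMap (h : ∀ j, IsTransport φ (w j) (dw j) (S j) (T j)) :
    MeasurableEmbedding (coordMap S) :=
  (continuous_coordMap h).measurableEmbedding fun _ _ hxy =>
    funext fun j => (h j).strictMono.injective (congrFun hxy j)

theorem measurePreserving_coordMap (hφ : ∀ x, 0 < φ x) (hm : Measurable φ)
    (h : ∀ j, IsTransport φ (w j) (dw j) (S j) (T j)) :
    MeasurePreserving (coordMap S) (densityMeasure s φ)
      ((volume.restrict (cube s)).withDensity fun u => ∏ j, ENNReal.ofReal (w j (u j))) := by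
  have := measurePreserving_pi _ _ fun j => (h j).measurePreserving
  rw [pi_withDensity _ _ fun j => (h j).continuous_weight.measurable] at this
  rw [densityMeasure_eq_pi s hφ hm]
  have e : volume.restrict (cube s) = Measure.pi fun _ : Fin s => volume.restrict (Ioo (0 : ℝ) 1) :=
    Measure.restrict_pi_pi _ _
  rw [e]
  exact this

/-- `coordMap S` is a measurable embedding, so `F` may be arbitrary; no measurability of `T` has to
be established. -/
theorem lintegral_cube_eq (hφ : ∀ x, 0 < φ x) (hm : Measurable φ)
    (h : ∀ j, IsTransport φ (w j) (dw j) (S j) (T j)) (F : (Fin s → ℝ) → ℝ≥0∞) :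
    ∫⁻ u in cube s, (∏ j, ENNReal.ofReal (w j (u j))) * F u =
      ∫⁻ x, F (coordMap S x) ∂densityMeasure s φ := by
  rw [(measurePreserving_coordMap hφ hm h).lintegral_comp_emb (measurableEmbedding_coordMap h),
    lintegral_withDensity_eq_lintegral_mul_non_measurable]
  · rfl
  · exact Finset.measurable_prod _ fun j _ =>
      ((h j).continuous_weight.measurable.comp (measurable_pi_apply j)).ennreal_ofReal
  · exact Eventually.of_forall fun u => ENNReal.prod_lt_top fun j _ => ENNReal.ofReal_lt_top

theorem integral_cube_eq (hφ : ∀ x, 0 < φ x) (hm : Measurable φ)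
    (h : ∀ j, IsTransport φ (w j) (dw j) (S j) (T j)) (F : (Fin s → ℝ) → ℝ) :
    ∫ u in cube s, (∏ j, w j (u j)) * F u =
      ∫ x, (∏ j, φ (x j)) * F (coordMap S x) := by
  have h1 := (measurePreserving_coordMap hφ hm h).integral_comp
    (measurableEmbedding_coordMap h) F
  rw [integral_withDensity_eq_integral_toReal_smul, densityMeasure_eq_withDensity_prod s hφ,
    integral_withDensity_eq_integral_toReal_smul] at h1
  · simp only [ENNReal.toReal_prod, smul_eq_mul] at h1
    calc _ = ∫ u in cube s, (∏ j, (ENNReal.ofReal (w j (u j))).toReal) * F u := by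
          refine setIntegral_congr_fun (measurableSet_cube s) fun u hu => ?_
          congr 1
          exact Finset.prod_congr rfl fun j _ =>
            (ENNReal.toReal_ofReal ((h j).weight_pos _ (hu j trivial)).le).symm
      _ = _ := by
          rw [← h1]
          congr 1
          ext x
          congr 1
          exact Finset.prod_congr rfl fun j _ => ENNReal.toReal_ofReal (hφ _).le
  · exact Finset.measurable_prod _ fun j _ => (hm.comp (measurable_pi_apply j)).ennreal_ofReal
  · exact Eventually.of_forall fun u => ENNReal.prod_lt_top fun j _ => ENNReal.ofReal_lt_top
  · exact Finset.measurable_prod _ fun j _ =>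
      ((h j).continuous_weight.measurable.comp (measurable_pi_apply j)).ennreal_ofReal
  · exact Eventually.of_forall fun u => ENNReal.prod_lt_top fun j _ => ENNReal.ofReal_lt_top

/-- The factor belonging to one coordinate in the product-rule expansion of `∂^v f^w`: the
derivative falls on `f` for `j ∈ A`, on the weight for `j ∈ B`, and nowhere otherwise. -/
def expansionFactor (φ : ℝ → ℝ) (w dw T : Fin s → ℝ → ℝ) (A B : Finset (Fin s)) (j : Fin s)
    (u : ℝ) : ℝ :=
  if j ∈ A then w j u * (w j u / φ (T j u)) else if j ∈ B then dw j u else w j u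

/-- A term of the product-rule expansion of `∂^v f^w`; `g A` stands for `∂^A f`. -/
def expansionTerm (φ : ℝ → ℝ) (w dw T : Fin s → ℝ → ℝ) (g : Finset (Fin s) → (Fin s → ℝ) → ℝ)
    (A B : Finset (Fin s)) (u : Fin s → ℝ) : ℝ :=
  (∏ j, expansionFactor φ w dw T A B j (u j)) * g A (fun j => T j (u j))

/-- `expansionFactor` transported to `ℝ`, multiplied by the Jacobian. -/
def pulledFactor (φ : ℝ → ℝ) (w dw S : Fin s → ℝ → ℝ) (A B : Finset (Fin s)) (j : Fin s)
    (x : ℝ) : ℝ :=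
  if j ∈ A then w j (S j x) else
    if j ∈ B then φ x * (dw j (S j x) / w j (S j x)) else φ x

/-- The Jacobian is `φ / w(S)` per coordinate. For `j ∈ A` it cancels the `w / φ(T)` coming from
`T'`, so that `w(S)` without any `φ` is left. This is what makes the integrand Lipschitz in a
coordinate once `f` has been differentiated there. -/
theorem integral_expansionTerm_mul (hφ : ∀ x, 0 < φ x) (hm : Measurable φ)
    (h : ∀ j, IsTransport φ (w j) (dw j) (S j) (T j))
    (g : Finset (Fin s) → (Fin s → ℝ) → ℝ) (A B : Finset (Fin s)) (η : (Fin s → ℝ) → ℝ) :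
    ∫ u in cube s, expansionTerm φ w dw T g A B u * η u =
      ∫ x, g A x * ((∏ j, pulledFactor φ w dw S A B j (x j)) * η (coordMap S x)) := by
  have e1 : ∀ u ∈ cube s, expansionTerm φ w dw T g A B u * η u =
      (∏ j, w j (u j)) * ((∏ j, expansionFactor φ w dw T A B j (u j) / w j (u j)) *
        g A (fun j => T j (u j)) * η u) := by
    intro u hu
    rw [Finset.prod_div_distrib]
    have : ∏ j, w j (u j) ≠ 0 :=
      Finset.prod_ne_zero_iff.2 fun j _ => ((h j).weight_pos _ (hu j trivial)).ne'
    unfold expansionTerm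
    field_simp
  rw [setIntegral_congr_fun (measurableSet_cube s) e1, integral_cube_eq hφ hm h]
  congr 1
  ext x
  have e2 : ∀ j, pulledFactor φ w dw S A B j (x j) =
      φ (x j) * (expansionFactor φ w dw T A B j (coordMap S x j) / w j (coordMap S x j)) := by
    intro j
    have hw := ((h j).weight_pos _ ((h j).mem_Ioo (x j))).ne'
    have hx := (hφ (x j)).ne'
    simp only [pulledFactor, expansionFactor, coordMap, (h j).left_inv]
    split_ifs <;> field_simp
  simp only [e2, Finset.prod_mul_distrib]
  have e3 : (fun j => T j (coordMap S x j)) = x := funext fun j => (h j).left_inv _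
  rw [e3]
  ring

end ChangeOfVariables

end

end BDIS

namespace BDIS

noncomputable section

open Filter Topology
open scoped ENNReal

/-! ### The product and chain rule in one coordinate -/

/-- A closed thickening of `K` still lies in the cube, and it contains the points obtained by moving
a single coordinate by `±δ`. -/
theorem exists_margin_of_isCompact {s : ℕ} {K : Set (Fin s → ℝ)} (hK : IsCompact K)
    (hKs : K ⊆ cube s) : ∃ δ : ℝ, 0 < δ ∧ ∀ u ∈ K, ∀ j, u j ∈ Icc δ (1 - δ) := by
  obtain ⟨δ, hδ, hsub⟩ := hK.exists_cthickening_subset_open (isOpen_cube s) hKs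
  refine ⟨δ, hδ, fun u hu j => ?_⟩
  have key : ∀ t : ℝ, |t| ≤ δ → u j + t ∈ Ioo (0 : ℝ) 1 := by
    intro t ht
    have hmem : Function.update u j (u j + t) ∈ cube s := by
      apply hsub
      refine Metric.mem_cthickening_of_dist_le _ u _ _ hu ?_
      refine (dist_pi_le_iff hδ.le).2 fun i => ?_
      by_cases hi : i = j
      · subst hi; simpa [Real.dist_eq] using ht
      · simp [hi, hδ.le]
    simpa using hmem j trivial
  have h1 := key (-δ) (by rw [abs_neg, abs_of_pos hδ])
  have h2 := key δ (abs_of_pos hδ).le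
  exact ⟨by linarith [h1.1], by linarith [h2.2]⟩

/-- Measuring `ζ'` against `w` rather than `1` matches the field `lipschitz` of `IsTransport`:
together they make `ζ ∘ S` Lipschitz although `S` need not be. -/
theorem abs_sub_le_of_abs_deriv_le {w ζ dζ : ℝ → ℝ} (hw : Continuous w)
    (hζ : ∀ u, HasDerivAt ζ (dζ u) u) (hdζ : Continuous dζ) {L : ℝ}
    (hL : ∀ u ∈ Ioo (0 : ℝ) 1, |dζ u| ≤ L * w u) {a b : ℝ} (ha : a ∈ Ioo (0 : ℝ) 1)
    (hb : b ∈ Ioo (0 : ℝ) 1) : |ζ b - ζ a| ≤ |L| * |∫ t in a..b, w t| := by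
  rw [← intervalIntegral.integral_eq_sub_of_hasDerivAt (fun u _ => hζ u)
    (hdζ.intervalIntegrable _ _), ← abs_mul, ← intervalIntegral.integral_const_mul]
  refine intervalIntegral.norm_integral_le_abs_of_norm_le (f := dζ) (μ := volume) ?_
    ((continuous_const.mul hw).intervalIntegrable _ _)
  refine (ae_restrict_iff' measurableSet_uIoc).2 (Eventually.of_forall fun t ht => hL t ?_)
  rcases le_total a b with hab | hab
  · rw [uIoc_of_le hab] at ht
    exact ⟨ha.1.trans ht.1, ht.2.trans_lt hb.2⟩
  · rw [uIoc_of_ge hab] at ht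
    exact ⟨hb.1.trans ht.1, ht.2.trans_lt ha.2⟩

section SingleCoordinate

variable {s : ℕ} {φ : ℝ → ℝ} {w dw S T : Fin s → ℝ → ℝ}

theorem measurable_pulledFactor (hm : Measurable φ)
    (h : ∀ j, IsTransport φ (w j) (dw j) (S j) (T j)) (A B : Finset (Fin s)) (j : Fin s) :
    Measurable (pulledFactor φ w dw S A B j) := by
  have h1 : Measurable fun x => w j (S j x) :=
    (h j).continuous_weight.measurable.comp (h j).continuous.measurable
  have h2 : Measurable fun x => dw j (S j x) :=
    (h j).continuous_deriv.measurable.comp (h j).continuous.measurable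
  unfold pulledFactor
  split_ifs
  · exact h1
  · exact hm.mul (h2.div h1)
  · exact hm

theorem IsTransport.exists_bound_deriv_div {φ w dw S T : ℝ → ℝ} (h : IsTransport φ w dw S T)
    {δ : ℝ} (hδ : 0 < δ) : ∃ R : ℝ, 0 ≤ R ∧ ∀ u ∈ Icc δ (1 - δ), |dw u| ≤ R * w u := by
  have hpos : ∀ u ∈ Icc δ (1 - δ), 0 < w u := fun u hu =>
    h.weight_pos u ⟨hδ.trans_le hu.1, by linarith [hu.2]⟩
  have hc : ContinuousOn (fun u => dw u / w u) (Icc δ (1 - δ)) :=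
    h.continuous_deriv.continuousOn.div h.continuous_weight.continuousOn
      fun u hu => (hpos u hu).ne'
  obtain ⟨R, hR⟩ := isCompact_Icc.exists_bound_of_continuousOn hc
  refine ⟨max R 0, le_max_right _ _, fun u hu => ?_⟩
  have := (hR u hu).trans (le_max_left R 0)
  rwa [Real.norm_eq_abs, abs_div, abs_of_pos (hpos u hu), div_le_iff₀ (hpos u hu)] at this

theorem exists_bound_pulledFactor (hφ : ∀ x, 0 < φ x) (hb : ∃ M : ℝ, ∀ x, φ x ≤ M)
    (h : ∀ j, IsTransport φ (w j) (dw j) (S j) (T j)) (A B : Finset (Fin s)) (j : Fin s)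
    {δ : ℝ} (hδ : 0 < δ) :
    ∃ R : ℝ, 0 ≤ R ∧ ∀ x, S j x ∈ Icc δ (1 - δ) → |pulledFactor φ w dw S A B j x| ≤ R := by
  obtain ⟨M, hM⟩ := hb
  obtain ⟨R, hR0, hR⟩ := (h j).exists_bound_deriv_div hδ
  obtain ⟨Q, hQ⟩ := isCompact_Icc.exists_bound_of_continuousOn
    ((h j).continuous_weight.continuousOn (s := Icc δ (1 - δ)))
  have hM0 : 0 ≤ M := (hφ 0).le.trans (hM 0)
  refine ⟨max (|Q|) (max (M * R) M), le_max_of_le_left (abs_nonneg _), fun x hx => ?_⟩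
  have hw := (h j).weight_pos _ ((h j).mem_Ioo x)
  unfold pulledFactor
  split_ifs
  · exact le_max_of_le_left ((hQ _ hx).trans (le_abs_self Q))
  · refine le_max_of_le_right (le_max_of_le_left ?_)
    rw [abs_mul, abs_of_pos (hφ x), abs_div, abs_of_pos hw]
    exact mul_le_mul (hM x) ((div_le_iff₀ hw).2 (hR _ hx)) (by positivity) hM0
  · rw [abs_of_pos (hφ x)]
    exact le_max_of_le_right (le_max_of_le_right (hM x))

theorem coordMap_add_single (S : Fin s → ℝ → ℝ) (x : Fin s → ℝ) (k : Fin s) (t : ℝ) :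
    coordMap S (x + t • Pi.single k 1) =
      Function.update (coordMap S x) k (S k (x k + t)) := by
  ext j
  by_cases hj : j = k
  · subst hj; simp [coordMap]
  · simp [coordMap, hj]

theorem hasDerivAt_comp_update {ψ : (Fin s → ℝ) → ℝ} (hψ : ContDiff ℝ ∞ ψ) (u : Fin s → ℝ)
    (k : Fin s) (τ : ℝ) : HasDerivAt (fun τ => ψ (Function.update u k τ))
      (partialDeriv k ψ (Function.update u k τ)) τ :=
  (hψ.differentiable (by simp) _).hasFDerivAt.comp_hasDerivAt τ (hasDerivAt_update u k τ)

theorem isCompact_preimage_coordMap (h : ∀ j, IsTransport φ (w j) (dw j) (S j) (T j))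
    {K : Set (Fin s → ℝ)} (hK : IsCompact K) (hKs : K ⊆ cube s) :
    IsCompact (coordMap S ⁻¹' K) := by
  obtain ⟨δ, hδ, hmargin⟩ := exists_margin_of_isCompact hK hKs
  by_cases hd : δ ≤ 1 - δ
  · have hex : ∀ j, ∃ a b, S j a = δ ∧ S j b = 1 - δ := by
      intro j
      have h1 : δ ∈ range (S j) := by
        rw [(h j).range_eq]; constructor <;> linarith
      have h2 : 1 - δ ∈ range (S j) := by
        rw [(h j).range_eq]; constructor <;> linarith
      exact ⟨h1.choose, h2.choose, h1.choose_spec, h2.choose_spec⟩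
    choose a b ha hb using hex
    refine (isCompact_Icc (a := a) (b := b)).of_isClosed_subset
      (hK.isClosed.preimage (continuous_coordMap h)) fun x hx => ⟨fun j => ?_, fun j => ?_⟩
    · have := (hmargin _ hx j).1
      rw [← ha j] at this
      exact (h j).strictMono.le_iff_le.1 this
    · have := (hmargin _ hx j).2
      rw [← hb j] at this
      exact (h j).strictMono.le_iff_le.1 this
  -- With `δ > 1 - δ` no coordinate can satisfy the margin, so `K` has no preimage, except in
  -- dimension `0`, where the whole space is a point.
  · rcases isEmpty_or_nonempty (Fin s) with hs | ⟨⟨k⟩⟩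
    · exact (Set.subsingleton_of_subsingleton).isCompact
    · have : coordMap S ⁻¹' K = ∅ := by
        refine eq_empty_of_forall_notMem fun x hx => hd ?_
        have := hmargin _ hx k
        exact this.1.trans this.2
      rw [this]; exact isCompact_empty

/-- After the change of variables, coordinate `k` carries `φ(x_k) (∂_k ψ)(S(x))`. Since `w_k(S_k)
S_k' = φ`, this is the `x_k`-derivative of `w_k(S_k) ψ(S)` minus `φ (w_k'/w_k)(S_k) ψ(S)`.
Integration by parts moves the derivative onto `g A`, which gives the term with `k` in `A`; the
correction is the term with `k` in `B`. -/
theorem integral_expansionTerm_mul_partialDeriv (hφ : ∀ x, 0 < φ x) (hm : Measurable φ)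
    (hb : ∃ M : ℝ, ∀ x, φ x ≤ M)
    (h : ∀ j, IsTransport φ (w j) (dw j) (S j) (T j))
    {g : Finset (Fin s) → (Fin s → ℝ) → ℝ} {A B : Finset (Fin s)} {k : Fin s}
    (hA : k ∉ A) (hB : k ∉ B)
    (hgA : LocallyIntegrable (g A)) (hgk : LocallyIntegrable (g (insert k A)))
    (hg : ∀ ψ : (Fin s → ℝ) → ℝ, ContDiff ℝ ∞ ψ → HasCompactSupport ψ →
      ∫ x, g A x * partialDeriv k ψ x = -∫ x, g (insert k A) x * ψ x)
    {ψ : (Fin s → ℝ) → ℝ} (hψ : ContDiff ℝ ∞ ψ) (hc : HasCompactSupport ψ)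
    (hs : tsupport ψ ⊆ cube s) :
    ∫ u in cube s, expansionTerm φ w dw T g A B u * partialDeriv k ψ u =
      -((∫ u in cube s, expansionTerm φ w dw T g (insert k A) B u * ψ u) +
        ∫ u in cube s, expansionTerm φ w dw T g A (insert k B) u * ψ u) := by
  simp only [integral_expansionTerm_mul hφ hm h]
  set K := tsupport ψ with hKdef
  obtain ⟨δ, hδ, hmargin⟩ := exists_margin_of_isCompact (K := K) hc hs
  -- The factors of the other coordinates are common to all three integrals and constant in
  -- direction `k`; they may contain the merely measurable `φ`.
  set P : (Fin s → ℝ) → ℝ := fun x => ∏ j ∈ Finset.univ.erase k, pulledFactor φ w dw S A B j (x j)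
    with hP
  have hprod : ∀ (A' B' : Finset (Fin s)), (∀ j, j ≠ k → (j ∈ A' ↔ j ∈ A)) →
      (∀ j, j ≠ k → (j ∈ B' ↔ j ∈ B)) → ∀ x : Fin s → ℝ,
      ∏ j, pulledFactor φ w dw S A' B' j (x j) = pulledFactor φ w dw S A' B' k (x k) * P x := by
    intro A' B' hA' hB' x
    rw [← Finset.mul_prod_erase _ _ (Finset.mem_univ k)]
    congr 1
    refine Finset.prod_congr rfl fun j hj => ?_
    have hjk := Finset.ne_of_mem_erase hj
    simp only [pulledFactor, hA' j hjk, hB' j hjk]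
  have hins : ∀ (A : Finset (Fin s)) j, j ≠ k → (j ∈ insert k A ↔ j ∈ A) := fun A j hj => by
    simp [hj]
  simp only [hprod A B (fun _ _ => Iff.rfl) (fun _ _ => Iff.rfl),
    hprod (insert k A) B (hins A) (fun _ _ => Iff.rfl),
    hprod A (insert k B) (fun _ _ => Iff.rfl) (hins B)]
  simp only [pulledFactor, hA, hB, Finset.mem_insert_self, if_true, if_false]
  have hPm : Measurable P := Finset.measurable_prod _ fun j _ =>
    (measurable_pulledFactor hm h A B j).comp (measurable_pi_apply j)
  have hSm : Measurable (coordMap S) := (continuous_coordMap h).measurable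
  have hSk : Measurable fun x : Fin s → ℝ => S k (x k) :=
    (h k).continuous.measurable.comp (measurable_pi_apply k)
  have hwk : Measurable fun x : Fin s → ℝ => w k (S k (x k)) :=
    (h k).continuous_weight.measurable.comp hSk
  have hdwk : Measurable fun x : Fin s → ℝ => dw k (S k (x k)) :=
    (h k).continuous_deriv.measurable.comp hSk
  have hφk : Measurable fun x : Fin s → ℝ => φ (x k) := hm.comp (measurable_pi_apply k)
  have hcp := hasCompactSupport_partialDeriv k hc
  have hpc := contDiff_partialDeriv k hψ
  obtain ⟨Bψ, hBψ⟩ := hc.exists_bound_of_continuous hψ.continuous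
  obtain ⟨Bp, hBp⟩ := hcp.exists_bound_of_continuous hpc.continuous
  have hBψ0 : 0 ≤ Bψ := (norm_nonneg _).trans (hBψ 0)
  have hBp0 : 0 ≤ Bp := (norm_nonneg _).trans (hBp 0)
  have hψ0 : ∀ u, u ∉ K → ψ u = 0 := fun u hu => image_eq_zero_of_notMem_tsupport hu
  have hp0 : ∀ u, u ∉ K → partialDeriv k ψ u = 0 := fun u hu =>
    image_eq_zero_of_notMem_tsupport fun h' => hu (tsupport_partialDeriv_subset k h')
  have hcompact := isCompact_preimage_coordMap h (K := K) hc hs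
  -- bounds on the support
  obtain ⟨M, hM⟩ := hb
  have hM0 : 0 ≤ M := (hφ 0).le.trans (hM 0)
  obtain ⟨R, hR0, hR⟩ := (h k).exists_bound_deriv_div hδ
  obtain ⟨Q, hQ⟩ := isCompact_Icc.exists_bound_of_continuousOn
    ((h k).continuous_weight.continuousOn (s := Icc δ (1 - δ)))
  choose r hr0 hr using fun j => exists_bound_pulledFactor hφ ⟨M, hM⟩ h A B j hδ
  set BP := ∏ j ∈ Finset.univ.erase k, r j with hBP
  have hBP0 : 0 ≤ BP := Finset.prod_nonneg fun j _ => hr0 j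
  have hPb : ∀ x, coordMap S x ∈ K → |P x| ≤ BP := fun x hx => by
    rw [hP, Finset.abs_prod]
    exact Finset.prod_le_prod (fun j _ => abs_nonneg _) fun j _ => hr j _ (hmargin _ hx j)
  have hPadd : ∀ x (t : ℝ), P (x + t • Pi.single k 1) = P x := fun x t => by
    refine Finset.prod_congr rfl fun j hj => ?_
    simp [Finset.ne_of_mem_erase hj]
  -- the test function and the two parts of its derivative
  set D₁ : (Fin s → ℝ) → ℝ := fun x => φ (x k) * P x * partialDeriv k ψ (coordMap S x) with hD₁
  set D₂ : (Fin s → ℝ) → ℝ := fun x =>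
    φ (x k) * (dw k (S k (x k)) / w k (S k (x k))) * P x * ψ (coordMap S x) with hD₂
  set Ψ : (Fin s → ℝ) → ℝ := fun x => w k (S k (x k)) * P x * ψ (coordMap S x) with hΨ
  have hD₁m : Measurable D₁ := (hφk.mul hPm).mul (hpc.continuous.measurable.comp hSm)
  have hD₂m : Measurable D₂ :=
    ((hφk.mul (hdwk.div hwk)).mul hPm).mul (hψ.continuous.measurable.comp hSm)
  have hΨm : Measurable Ψ := (hwk.mul hPm).mul (hψ.continuous.measurable.comp hSm)
  have hD₁0 : ∀ x, coordMap S x ∉ K → D₁ x = 0 := fun x hx => by simp [hD₁, hp0 _ hx]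
  have hD₂0 : ∀ x, coordMap S x ∉ K → D₂ x = 0 := fun x hx => by simp [hD₂, hψ0 _ hx]
  have hΨ0 : ∀ x, coordMap S x ∉ K → Ψ x = 0 := fun x hx => by simp [hΨ, hψ0 _ hx]
  have hD₁b : ∀ x, |D₁ x| ≤ M * BP * Bp := fun x => by
    by_cases hx : coordMap S x ∈ K
    · simp only [hD₁, abs_mul, abs_of_pos (hφ _)]
      exact mul_le_mul (mul_le_mul (hM _) (hPb x hx) (abs_nonneg _) hM0) (hBp _) (abs_nonneg _)
        (by positivity)
    · rw [hD₁0 x hx, abs_zero]; positivity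
  have hD₂b : ∀ x, |D₂ x| ≤ M * R * BP * Bψ := fun x => by
    by_cases hx : coordMap S x ∈ K
    · have hw := (h k).weight_pos _ ((h k).mem_Ioo (x k))
      simp only [hD₂, abs_mul, abs_of_pos (hφ _), abs_div, abs_of_pos hw]
      exact mul_le_mul (mul_le_mul (mul_le_mul (hM _)
        ((div_le_iff₀ hw).2 (hR _ (hmargin _ hx k))) (by positivity) hM0)
        (hPb x hx) (abs_nonneg _) (by positivity)) (hBψ _) (abs_nonneg _) (by positivity)
    · rw [hD₂0 x hx, abs_zero]; positivity
  have hΨb : ∀ x, |Ψ x| ≤ |Q| * BP * Bψ := fun x => by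
    by_cases hx : coordMap S x ∈ K
    · simp only [hΨ, abs_mul]
      exact mul_le_mul (mul_le_mul ((hQ _ (hmargin _ hx k)).trans (le_abs_self Q)) (hPb x hx)
        (abs_nonneg _) (abs_nonneg _)) (hBψ _) (abs_nonneg _) (by positivity)
    · rw [hΨ0 x hx, abs_zero]; positivity
  have hsupp : ∀ F : (Fin s → ℝ) → ℝ, (∀ x, coordMap S x ∉ K → F x = 0) → HasCompactSupport F :=
    fun F hF => HasCompactSupport.intro hcompact hF
  -- the restriction to a line
  set ζ : (Fin s → ℝ) → ℝ → ℝ := fun u τ => w k τ * ψ (Function.update u k τ) with hζ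
  set dζ : (Fin s → ℝ) → ℝ → ℝ := fun u τ =>
    dw k τ * ψ (Function.update u k τ) + w k τ * partialDeriv k ψ (Function.update u k τ) with hdζ
  have hζd : ∀ u τ, HasDerivAt (ζ u) (dζ u τ) τ := fun u τ =>
    ((h k).hasDerivAt_weight τ).mul (hasDerivAt_comp_update hψ u k τ)
  have hdζc : ∀ u, Continuous (dζ u) := fun u => by
    have hu : Continuous fun τ : ℝ => Function.update u k τ := by fun_prop
    exact ((h k).continuous_deriv.mul (hψ.continuous.comp hu)).add
      ((h k).continuous_weight.mul (hpc.continuous.comp hu))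
  -- Off the support of `ψ` the derivative vanishes; on it `τ` keeps distance `δ` from the ends,
  -- where `|w'| ≤ R w`.
  have hdζb : ∀ u, ∀ τ ∈ Ioo (0 : ℝ) 1, |dζ u τ| ≤ (R * Bψ + Bp) * w k τ := by
    intro u τ hτ
    have hw := (h k).weight_pos τ hτ
    by_cases hK : Function.update u k τ ∈ K
    · have hmem := hmargin _ hK k
      rw [Function.update_self] at hmem
      calc |dζ u τ| ≤ |dw k τ * ψ (Function.update u k τ)| +
            |w k τ * partialDeriv k ψ (Function.update u k τ)| := abs_add_le _ _
        _ ≤ R * w k τ * Bψ + w k τ * Bp := by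
            rw [abs_mul, abs_mul, abs_of_pos hw]
            exact add_le_add (mul_le_mul (hR τ hmem) (hBψ _) (abs_nonneg _) (by positivity))
              (mul_le_mul_of_nonneg_left (hBp _) hw.le)
        _ = _ := by ring
    · simp only [hdζ, hψ0 _ hK, hp0 _ hK, mul_zero, add_zero, abs_zero]
      positivity
  have hline : ∀ x (t : ℝ), Ψ (x + t • Pi.single k 1) =
      P x * ζ (coordMap S x) (S k (x k + t)) := fun x t => by
    simp only [hΨ, hPadd, coordMap_add_single, hζ, Pi.add_apply, Pi.smul_apply, Pi.single_eq_same,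
      smul_eq_mul, mul_one]
    ring
  obtain ⟨N, hN⟩ := (h k).lipschitz
  have hlip : ∀ x (t t' : ℝ), |Ψ (x + t • Pi.single k 1) - Ψ (x + t' • Pi.single k 1)| ≤
      BP * (|R * Bψ + Bp| * |N|) * |t - t'| := by
    intro x t t'
    -- `P` is bounded only over `K`, but it is constant along the line, so one point of the line
    -- over `K` suffices.
    by_cases hx : coordMap S (x + t • Pi.single k 1) ∈ K ∨
        coordMap S (x + t' • Pi.single k 1) ∈ K
    · have hPx : |P x| ≤ BP := by
        rcases hx with hx | hx
        · rw [← hPadd x t]; exact hPb _ hx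
        · rw [← hPadd x t']; exact hPb _ hx
      rw [hline, hline, ← mul_sub, abs_mul, mul_assoc]
      refine mul_le_mul hPx ?_ (abs_nonneg _) hBP0
      refine (abs_sub_le_of_abs_deriv_le (h k).continuous_weight (hζd _) (hdζc _) (hdζb _)
        ((h k).mem_Ioo _) ((h k).mem_Ioo _)).trans ?_
      rw [mul_assoc]
      refine mul_le_mul_of_nonneg_left ?_ (abs_nonneg _)
      refine (hN _ _).trans ?_
      rw [add_sub_add_left_eq_sub, abs_sub_comm t t']
      exact mul_le_mul_of_nonneg_right (le_abs_self N) (abs_nonneg _)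
    · push Not at hx
      rw [hΨ0 _ hx.1, hΨ0 _ hx.2, sub_zero, abs_zero]
      positivity
  have hderiv : ∀ᵐ x, HasDerivAt (fun t : ℝ => Ψ (x + t • Pi.single k 1)) (D₁ x + D₂ x) 0 := by
    have hq := Measure.quasiMeasurePreserving_eval (fun _ : Fin s => (volume : Measure ℝ)) k
    have hae := hq.ae (h k).hasDerivAt
    rw [← volume_pi] at hae
    filter_upwards [hae] with x hx
    have h1 : HasDerivAt (fun t : ℝ => S k (x k + t)) (φ (x k) / w k (S k (x k))) 0 := by
      have : HasDerivAt (S k) (φ (x k) / w k (S k (x k))) (x k + 0) := by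
        rw [add_zero]; exact hx
      exact this.comp_const_add (x k) 0
    have h2 := hζd (coordMap S x) (S k (x k + 0))
    have h3 := ((h2.comp (0 : ℝ) h1).const_mul (P x))
    have hw := ((h k).weight_pos _ ((h k).mem_Ioo (x k))).ne'
    have e1 : Function.update (coordMap S x) k (S k (x k)) = coordMap S x :=
      Function.update_eq_self k (coordMap S x)
    -- Here the factor `w` in `dζ` meets `S' = φ / w(S)`: it leaves `φ ∂_k ψ` in `D₁`, and the `w'`
    -- part becomes `D₂`.
    refine (h3.congr_deriv ?_).congr_of_eventuallyEq (Eventually.of_forall fun t => hline x t)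
    simp only [hdζ, add_zero, e1, hD₁, hD₂]
    field_simp
    ring
  have key := integral_mul_eq_neg_of_lipschitz hgA hgk hg hΨm hΨb (hsupp Ψ hΨ0) hlip
    (D := fun x => D₁ x + D₂ x) (hD₁m.add hD₂m)
    (fun x => (abs_add_le _ _).trans (add_le_add (hD₁b x) (hD₂b x)))
    (hsupp _ fun x hx => by simp only [hD₁0 x hx, hD₂0 x hx, add_zero]) hderiv
  have hint : ∀ F : (Fin s → ℝ) → ℝ, Measurable F → ∀ C : ℝ, (∀ x, |F x| ≤ C) →
      (∀ x, coordMap S x ∉ K → F x = 0) → Integrable fun x => g A x * F x := by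
    intro F hF C hC hF0
    have h1 : IntegrableOn (fun x => g A x * F x) (coordMap S ⁻¹' K) :=
      (hgA.integrableOn_isCompact hcompact).mul_bdd (c := C) hF.aestronglyMeasurable
        (Eventually.of_forall hC)
    refine (integrableOn_iff_integrable_of_support_subset fun x hx => ?_).1 h1
    by_contra hx'
    exact hx (by simp only [hF0 x hx', mul_zero])
  simp only [mul_add] at key
  rw [integral_add (hint D₁ hD₁m _ hD₁b hD₁0) (hint D₂ hD₂m _ hD₂b hD₂0)] at key
  linarith

/-- The product-rule expansion of `∂^v` applied to an expansion term, in weak form. -/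
theorem integral_expansionTerm_mul_mixedPartial (hφ : ∀ x, 0 < φ x) (hm : Measurable φ)
    (hb : ∃ M : ℝ, ∀ x, φ x ≤ M)
    (h : ∀ j, IsTransport φ (w j) (dw j) (S j) (T j)) {f : (Fin s → ℝ) → ℝ}
    {g : Finset (Fin s) → (Fin s → ℝ) → ℝ} (hg : ∀ A, IsWeakMixedDeriv univ A f (g A))
    {ψ : (Fin s → ℝ) → ℝ} (hψ : ContDiff ℝ ∞ ψ) (hc : HasCompactSupport ψ)
    (hs : tsupport ψ ⊆ cube s) (v : Finset (Fin s)) :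
    ∀ A B : Finset (Fin s), Disjoint v A → Disjoint v B →
    ∫ u in cube s, expansionTerm φ w dw T g A B u * mixedPartial v ψ u =
      (-1) ^ v.card * ∑ t ∈ v.powerset,
        ∫ u in cube s, expansionTerm φ w dw T g (A ∪ t) (B ∪ v \ t) u * ψ u := by
  induction v using Finset.induction_on with
  | empty => intro A B _ _; simp [mixedPartial_empty]
  | insert k v hk ih =>
    intro A B hA hB
    have hkA : k ∉ A := Finset.disjoint_left.1 hA (Finset.mem_insert_self k v)
    have hkB : k ∉ B := Finset.disjoint_left.1 hB (Finset.mem_insert_self k v)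
    have hvA : Disjoint v A := hA.mono_left (Finset.subset_insert k v)
    have hvB : Disjoint v B := hB.mono_left (Finset.subset_insert k v)
    have hloc : ∀ A, LocallyIntegrable (g A) := fun A =>
      locallyIntegrableOn_univ.1 (hg A).locallyIntegrableOn_deriv
    rw [mixedPartial_insert hk hψ,
      integral_expansionTerm_mul_partialDeriv hφ hm hb h hkA hkB (hloc _) (hloc _)
        (fun χ hχ hχc => (hg A).integral_mul_partialDeriv hkA (hg (insert k A)) hχ hχc)
        (contDiff_mixedPartial v hψ) (hasCompactSupport_mixedPartial v hc)
        ((tsupport_mixedPartial_subset v ψ).trans hs),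
      ih (insert k A) B (Finset.disjoint_insert_right.2 ⟨hk, hvA⟩) hvB,
      ih A (insert k B) hvA (Finset.disjoint_insert_right.2 ⟨hk, hvB⟩),
      Finset.sum_powerset_insert hk, Finset.card_insert_of_notMem hk]
    -- Subsets of `insert k v` without `k` correspond to `∂_k` falling on the weight, those with `k`
    -- to `∂_k` falling on `f`.
    have e1 : ∀ t ∈ v.powerset, insert k B ∪ v \ t = B ∪ insert k v \ t := fun t ht => by
      have hkt : k ∉ t := fun hkt => hk (Finset.mem_powerset.1 ht hkt)
      rw [Finset.insert_sdiff_of_notMem _ hkt, Finset.insert_union, Finset.union_insert]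
    have e2 : ∀ t ∈ v.powerset, insert k A ∪ t = A ∪ insert k t := fun t _ => by
      rw [Finset.insert_union, Finset.union_insert]
    have e3 : ∀ t ∈ v.powerset, B ∪ v \ t = B ∪ insert k v \ insert k t := fun t _ => by
      rw [Finset.insert_sdiff_insert, Finset.sdiff_insert_of_notMem hk]
    have s1 : ∑ t ∈ v.powerset, ∫ u in cube s,
          expansionTerm φ w dw T g (A ∪ t) (insert k B ∪ v \ t) u * ψ u =
        ∑ t ∈ v.powerset, ∫ u in cube s,
          expansionTerm φ w dw T g (A ∪ t) (B ∪ insert k v \ t) u * ψ u :=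
      Finset.sum_congr rfl fun t ht => by rw [e1 t ht]
    have s2 : ∑ t ∈ v.powerset, ∫ u in cube s,
          expansionTerm φ w dw T g (insert k A ∪ t) (B ∪ v \ t) u * ψ u =
        ∑ t ∈ v.powerset, ∫ u in cube s,
          expansionTerm φ w dw T g (A ∪ insert k t) (B ∪ insert k v \ insert k t) u * ψ u :=
      Finset.sum_congr rfl fun t ht => by rw [e2 t ht, e3 t ht]
    rw [s1, s2]
    ring

end SingleCoordinate

end

end BDIS

namespace BDIS

noncomputable section

open Filter Topology

/-! ### The damping function `η` -/

section Damping

variable {p : ℝ}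

/-- With `y = t^{-p}` and `a = r/p` the claim is `y^a e^{-y/2} ≤ (2a)^a`, which is `z ≤ e^z` at `z =
y/(2a)`, raised to the power `a`. -/
theorem rpow_neg_mul_exp_le (hp : 0 < p) {r : ℝ} (hr : 0 < r) {t : ℝ} (ht : 0 < t) :
    t ^ (-r) * Real.exp (-(t ^ (-p) / 2)) ≤ (2 * (r / p)) ^ (r / p) := by
  set a := r / p with ha
  have ha0 : 0 < a := div_pos hr hp
  set y := t ^ (-p) with hy
  have hy0 : 0 < y := Real.rpow_pos_of_pos ht _
  have h1 : t ^ (-r) = y ^ a := by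
    rw [hy, ← Real.rpow_mul ht.le, ha]
    congr 1
    field_simp
  have h2 : y ≤ 2 * a * Real.exp (y / (2 * a)) := by
    have := (Real.add_one_le_exp (y / (2 * a)))
    have h3 : y / (2 * a) ≤ Real.exp (y / (2 * a)) := by linarith
    calc y = 2 * a * (y / (2 * a)) := by field_simp
      _ ≤ _ := mul_le_mul_of_nonneg_left h3 (by positivity)
  have h4 : y ^ a ≤ (2 * a) ^ a * Real.exp (y / 2) := by
    refine (Real.rpow_le_rpow hy0.le h2 ha0.le).trans_eq ?_
    rw [Real.mul_rpow (by positivity) (Real.exp_pos _).le, ← Real.exp_mul]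
    congr 2
    field_simp
  rw [h1]
  calc y ^ a * Real.exp (-(y / 2)) ≤ (2 * a) ^ a * Real.exp (y / 2) * Real.exp (-(y / 2)) :=
        mul_le_mul_of_nonneg_right h4 (Real.exp_pos _).le
    _ = (2 * a) ^ a := by rw [mul_assoc, ← Real.exp_add, add_neg_cancel, Real.exp_zero, mul_one]

/-- The antiderivative `t ↦ 2^{-p-2} p⁻¹ exp(2^p - t^{-p})` of `η`. -/
def etaInt (p t : ℝ) : ℝ :=
  if 0 < t then (2 : ℝ) ^ (-p - 2) / p * Real.exp ((2 : ℝ) ^ p - t ^ (-p)) else 0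

/-- The derivative of `η`. -/
def etaDeriv (p t : ℝ) : ℝ :=
  if 0 < t then eta p t * (t⁻¹ * (p * t ^ (-p) - (p + 1))) else 0

theorem eta_of_pos {t : ℝ} (ht : 0 < t) : eta p t =
    (2 : ℝ) ^ (-p - 2) * t ^ (-p - 1) * Real.exp ((2 : ℝ) ^ p - t ^ (-p)) := if_pos ht

theorem eta_of_nonpos {t : ℝ} (ht : t ≤ 0) : eta p t = 0 := if_neg ht.not_gt

theorem eta_pos {t : ℝ} (ht : 0 < t) : 0 < eta p t := by
  rw [eta_of_pos ht]
  positivity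

theorem eta_nonneg (p t : ℝ) : 0 ≤ eta p t := by
  rcases lt_or_ge 0 t with ht | ht
  · exact (eta_pos ht).le
  · rw [eta_of_nonpos ht]

theorem etaInt_pos (hp : 0 < p) {t : ℝ} (ht : 0 < t) : 0 < etaInt p t := by
  rw [etaInt, if_pos ht]
  positivity

theorem eta_eq_mul_etaInt (hp : 0 < p) {t : ℝ} (ht : 0 < t) :
    eta p t = p * t ^ (-p - 1) * etaInt p t := by
  rw [eta_of_pos ht, etaInt, if_pos ht]
  field_simp

/-- Half of the exponential decay already beats any power of `t`. All later estimates spend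
`etaInt^{1/2}` in this way. -/
theorem rpow_neg_mul_etaInt_rpow_le (hp : 0 < p) {r : ℝ} (hr : 0 < r) :
    ∃ C : ℝ, 0 < C ∧ ∀ t, 0 < t → t ^ (-r) * etaInt p t ^ (1 / 2 : ℝ) ≤ C := by
  refine ⟨((2 : ℝ) ^ (-p - 2) / p * Real.exp ((2 : ℝ) ^ p)) ^ (1 / 2 : ℝ) *
    (2 * (r / p)) ^ (r / p), by positivity, fun t ht => ?_⟩
  have h := rpow_neg_mul_exp_le hp hr ht
  have e : etaInt p t ^ (1 / 2 : ℝ) =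
      ((2 : ℝ) ^ (-p - 2) / p * Real.exp ((2 : ℝ) ^ p)) ^ (1 / 2 : ℝ) *
        Real.exp (-(t ^ (-p) / 2)) := by
    rw [etaInt, if_pos ht, sub_eq_add_neg ((2 : ℝ) ^ p), Real.exp_add, ← mul_assoc,
      Real.mul_rpow (by positivity) (Real.exp_pos _).le, ← Real.exp_mul]
    congr 2
    ring
  rw [e, mul_left_comm]
  exact mul_le_mul_of_nonneg_left h (by positivity)

theorem etaInt_le_rpow (hp : 0 < p) {r : ℝ} (hr : 0 < r) :
    ∃ C : ℝ, 0 < C ∧ ∀ t, 0 < t → etaInt p t ≤ C * t ^ r := by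
  obtain ⟨C, hC, h⟩ := rpow_neg_mul_etaInt_rpow_le hp (half_pos hr)
  refine ⟨C ^ (2 : ℕ), by positivity, fun t ht => ?_⟩
  have h1 := pow_le_pow_left₀ (by have := etaInt_pos hp ht; positivity) (h t ht) 2
  have e : (t ^ (-(r / 2)) * etaInt p t ^ (1 / 2 : ℝ)) ^ 2 = t ^ (-r) * etaInt p t := by
    rw [mul_pow, ← Real.rpow_natCast, ← Real.rpow_natCast, ← Real.rpow_mul ht.le,
      ← Real.rpow_mul (etaInt_pos hp ht).le]
    norm_num
  rw [e, Real.rpow_neg ht.le, inv_mul_le_iff₀ (Real.rpow_pos_of_pos ht _)] at h1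
  linarith

theorem eta_le_rpow (hp : 0 < p) {r : ℝ} (hr : 0 < r) :
    ∃ C : ℝ, 0 < C ∧ ∀ t, 0 < t → eta p t ≤ C * t ^ r := by
  obtain ⟨C, hC, h⟩ := etaInt_le_rpow hp (r := r + p + 1) (by linarith)
  refine ⟨p * C, by positivity, fun t ht => ?_⟩
  rw [eta_eq_mul_etaInt hp ht]
  calc p * t ^ (-p - 1) * etaInt p t ≤ p * t ^ (-p - 1) * (C * t ^ (r + p + 1)) :=
        mul_le_mul_of_nonneg_left (h t ht) (by positivity)
    _ = p * C * (t ^ (-p - 1) * t ^ (r + p + 1)) := by ring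
    _ = p * C * t ^ r := by rw [← Real.rpow_add ht]; ring_nf

theorem hasDerivAt_zero_of_abs_le_sq {f : ℝ → ℝ} {C : ℝ} (h : ∀ t, |f t| ≤ C * t ^ 2) :
    HasDerivAt f 0 0 := by
  have h1 : f =O[𝓝 (0 : ℝ)] fun t => ‖t - 0‖ ^ 2 := by
    refine Asymptotics.IsBigO.of_bound C (Eventually.of_forall fun t => ?_)
    simpa using h t
  simpa using (h1.hasFDerivAt (by norm_num)).hasDerivAt

theorem hasDerivAt_eta (hp : 0 < p) (t : ℝ) : HasDerivAt (eta p) (etaDeriv p t) t := by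
  rcases lt_trichotomy t 0 with ht | rfl | ht
  · rw [etaDeriv, if_neg ht.not_gt]
    refine (hasDerivAt_const t (0 : ℝ)).congr_of_eventuallyEq ?_
    filter_upwards [Iio_mem_nhds ht] with y hy using eta_of_nonpos (le_of_lt hy)
  · rw [etaDeriv, if_neg (lt_irrefl _)]
    obtain ⟨C, hC, h⟩ := eta_le_rpow hp (r := 2) (by norm_num)
    refine hasDerivAt_zero_of_abs_le_sq (C := C) fun t => ?_
    rcases lt_or_ge 0 t with ht | ht
    · rw [abs_of_pos (eta_pos ht)]
      simpa using h t ht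
    · rw [eta_of_nonpos ht, abs_zero]; positivity
  · rw [etaDeriv, if_pos ht, eta_of_pos ht]
    have h1 := Real.hasDerivAt_rpow_const (x := t) (p := -p - 1) (Or.inl ht.ne')
    have h2 := Real.hasDerivAt_rpow_const (x := t) (p := -p) (Or.inl ht.ne')
    have h3 := (h1.const_mul ((2 : ℝ) ^ (-p - 2))).mul ((h2.const_sub ((2 : ℝ) ^ p)).exp)
    refine (h3.congr_deriv ?_).congr_of_eventuallyEq ?_
    · have e1 : t ^ (-p - 1 - 1) = t ^ (-p - 1) * t⁻¹ := by
        rw [Real.rpow_sub ht (-p - 1) 1, Real.rpow_one]; rfl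
      have e2 : t ^ (-p - 1) = t ^ (-p) * t⁻¹ := by
        rw [Real.rpow_sub ht (-p) 1, Real.rpow_one]; rfl
      rw [e1, e2]
      ring
    · filter_upwards [Ioi_mem_nhds ht] with y hy using eta_of_pos hy

theorem hasDerivAt_etaInt (hp : 0 < p) (t : ℝ) : HasDerivAt (etaInt p) (eta p t) t := by
  rcases lt_trichotomy t 0 with ht | rfl | ht
  · rw [eta_of_nonpos ht.le]
    refine (hasDerivAt_const t (0 : ℝ)).congr_of_eventuallyEq ?_
    filter_upwards [Iio_mem_nhds ht] with y hy using if_neg (not_lt_of_gt hy)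
  · rw [eta_of_nonpos le_rfl]
    obtain ⟨C, hC, h⟩ := etaInt_le_rpow hp (r := 2) (by norm_num)
    refine hasDerivAt_zero_of_abs_le_sq (C := C) fun t => ?_
    rcases lt_or_ge 0 t with ht | ht
    · rw [abs_of_pos (etaInt_pos hp ht)]
      simpa using h t ht
    · rw [etaInt, if_neg ht.not_gt, abs_zero]; positivity
  · have h2 := Real.hasDerivAt_rpow_const (x := t) (p := -p) (Or.inl ht.ne')
    have h3 := ((h2.const_sub ((2 : ℝ) ^ p)).exp).const_mul ((2 : ℝ) ^ (-p - 2) / p)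
    refine (h3.congr_deriv ?_).congr_of_eventuallyEq ?_
    · rw [eta_of_pos ht]
      field_simp
    · filter_upwards [Ioi_mem_nhds ht] with y hy using if_pos hy

theorem continuous_eta (hp : 0 < p) : Continuous (eta p) :=
  continuous_iff_continuousAt.2 fun t => (hasDerivAt_eta hp t).continuousAt

theorem abs_etaDeriv_le (hp : 0 < p) : ∃ C : ℝ, 0 < C ∧ ∀ t, |etaDeriv p t| ≤ C * |t| := by
  -- The exponents `p + 2` and `2` compensate `t^{-p-1}` and `t^{-1}` and leave one power of `t`.
  obtain ⟨C₁, hC₁, h₁⟩ := eta_le_rpow hp (r := p + 2) (by linarith)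
  obtain ⟨C₂, hC₂, h₂⟩ := eta_le_rpow hp (r := 2) (by norm_num)
  refine ⟨C₁ * p + C₂ * (p + 1), by positivity, fun t => ?_⟩
  rcases lt_or_ge 0 t with ht | ht
  · rw [etaDeriv, if_pos ht, abs_mul, abs_of_pos (eta_pos ht), abs_of_pos ht, abs_mul,
      abs_of_pos (inv_pos.2 ht)]
    have h3 : |p * t ^ (-p) - (p + 1)| ≤ p * t ^ (-p) + (p + 1) := by
      have : 0 < t ^ (-p) := Real.rpow_pos_of_pos ht _
      rw [abs_le]; constructor <;> nlinarith [mul_pos hp this]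
    calc eta p t * (t⁻¹ * |p * t ^ (-p) - (p + 1)|)
        ≤ eta p t * (t⁻¹ * (p * t ^ (-p) + (p + 1))) := by
          have := eta_nonneg p t
          gcongr
      _ = eta p t * (t⁻¹ * (p * t ^ (-p))) + eta p t * (t⁻¹ * (p + 1)) := by ring
      _ ≤ C₁ * t ^ (p + 2) * (t⁻¹ * (p * t ^ (-p))) + C₂ * t ^ (2 : ℝ) * (t⁻¹ * (p + 1)) := by
          have := h₁ t ht
          have := h₂ t ht
          gcongr
      _ = (C₁ * p + C₂ * (p + 1)) * t := by
          rw [Real.rpow_add ht, Real.rpow_neg ht.le, Real.rpow_two]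
          have := Real.rpow_pos_of_pos ht p
          field_simp
  · rw [etaDeriv, if_neg ht.not_gt, abs_zero]
    positivity

theorem continuous_etaDeriv (hp : 0 < p) : Continuous (etaDeriv p) := by
  refine continuous_iff_continuousAt.2 fun t => ?_
  rcases lt_trichotomy t 0 with ht | rfl | ht
  · refine (continuousAt_const (y := (0 : ℝ))).congr ?_
    filter_upwards [Iio_mem_nhds ht] with y hy using (if_neg (not_lt_of_gt hy)).symm
  · obtain ⟨C, hC, h⟩ := abs_etaDeriv_le hp
    have e : etaDeriv p 0 = 0 := if_neg (lt_irrefl _)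
    rw [ContinuousAt, e]
    refine squeeze_zero_norm h ?_
    have : Continuous fun t : ℝ => C * |t| := by fun_prop
    simpa using this.tendsto 0
  · have h1 : ContinuousAt (fun t => eta p t * (t⁻¹ * (p * t ^ (-p) - (p + 1)))) t := by
      refine (continuous_eta hp).continuousAt.mul ((continuousAt_inv₀ ht.ne').mul ?_)
      exact (continuousAt_const.mul (Real.continuousAt_rpow_const _ _ (Or.inl ht.ne'))).sub
        continuousAt_const
    refine h1.congr ?_
    filter_upwards [Ioi_mem_nhds ht] with y hy using (if_pos hy).symm

/-- The constants in `η` are chosen for this value: it makes `η` and `1 - η(1 - ·)` meet at `1/2`.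
-/
theorem eta_half (p : ℝ) : eta p (1 / 2) = 1 / 2 := by
  rw [eta_of_pos (by norm_num), one_div, Real.inv_rpow (by norm_num), Real.inv_rpow (by norm_num),
    ← Real.rpow_neg (by norm_num), ← Real.rpow_neg (by norm_num), neg_neg, sub_self, Real.exp_zero,
    mul_one, ← Real.rpow_add (by norm_num)]
  have : -p - 2 + -(-p - 1) = -1 := by ring
  rw [this, Real.rpow_neg_one]

/-- Here `t^{-p} ≥ 2` and `2p ≥ p + 1` both use `p ≥ 1`. The inequality fixes the sign of `η'`,
hence the monotonicity of `η` on `[0, 1/2]`. -/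
theorem add_one_le_mul_rpow_neg (hp : 1 ≤ p) {t : ℝ} (ht : 0 < t) (ht2 : t ≤ 1 / 2) :
    p + 1 ≤ p * t ^ (-p) := by
  have h1 : (2 : ℝ) ≤ t ^ (-p) := by
    rw [Real.rpow_neg ht.le, ← Real.inv_rpow ht.le]
    have h2 : (2 : ℝ) ≤ t⁻¹ := by
      rw [le_inv_comm₀ (by norm_num) ht]; linarith
    calc (2 : ℝ) ≤ t⁻¹ := h2
      _ = t⁻¹ ^ (1 : ℝ) := (Real.rpow_one _).symm
      _ ≤ t⁻¹ ^ p := Real.rpow_le_rpow_of_exponent_le (by linarith) hp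
  nlinarith

theorem etaDeriv_nonneg (hp : 1 ≤ p) {t : ℝ} (ht2 : t ≤ 1 / 2) : 0 ≤ etaDeriv p t := by
  unfold etaDeriv
  split_ifs with ht
  · have h1 := add_one_le_mul_rpow_neg hp ht ht2
    have h2 := eta_nonneg p t
    have : 0 ≤ p * t ^ (-p) - (p + 1) := by linarith
    positivity
  · exact le_rfl

theorem eta_le_half (hp : 1 ≤ p) {t : ℝ} (ht2 : t ≤ 1 / 2) : eta p t ≤ 1 / 2 := by
  have hp0 : 0 < p := by linarith
  have hmono : MonotoneOn (eta p) (Iic (1 / 2)) := by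
    refine monotoneOn_of_deriv_nonneg (convex_Iic _) (continuous_eta hp0).continuousOn
      (fun x _ => (hasDerivAt_eta hp0 x).differentiableAt.differentiableWithinAt) fun x hx => ?_
    rw [(hasDerivAt_eta hp0 x).deriv]
    rw [interior_Iic] at hx
    exact etaDeriv_nonneg hp (le_of_lt hx)
  exact (hmono ht2 (mem_Iic.2 le_rfl) ht2).trans_eq (eta_half p)

/-! ### The smooth step built from `η` -/

/-- The smooth step equal to `0` on `(-∞, 0]`, to `η` on `[0, 1/2]`, to `1 - η(1 - ·)` on
`[1/2, 1]` and to `1` on `[1, ∞)`. -/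
def smoothStep (p t : ℝ) : ℝ := if t ≤ 1 / 2 then eta p t else 1 - eta p (1 - t)

theorem smoothStep_of_le {t : ℝ} (ht : t ≤ 1 / 2) : smoothStep p t = eta p t := if_pos ht

theorem smoothStep_of_ge {t : ℝ} (ht : 1 / 2 ≤ t) : smoothStep p t = 1 - eta p (1 - t) := by
  rcases ht.eq_or_lt with rfl | ht
  · rw [smoothStep_of_le le_rfl]; norm_num [eta_half]
  · exact if_neg ht.not_ge

theorem smoothStep_add_smoothStep (p t : ℝ) : smoothStep p t + smoothStep p (1 - t) = 1 := by
  rcases le_total t (1 / 2) with ht | ht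
  · rw [smoothStep_of_le ht, smoothStep_of_ge (by linarith), sub_sub_cancel]; ring
  · rw [smoothStep_of_ge ht, smoothStep_of_le (by linarith)]; ring

theorem smoothStep_of_one_le {t : ℝ} (ht : 1 ≤ t) : smoothStep p t = 1 := by
  rw [smoothStep_of_ge (by linarith), eta_of_nonpos (by linarith), sub_zero]

theorem half_le_smoothStep (hp : 1 ≤ p) {t : ℝ} (ht : 1 / 2 ≤ t) : 1 / 2 ≤ smoothStep p t := by
  rw [smoothStep_of_ge ht]
  linarith [eta_le_half hp (t := 1 - t) (by linarith)]

theorem smoothStep_pos (hp : 1 ≤ p) {t : ℝ} (ht : 0 < t) : 0 < smoothStep p t := by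
  rcases le_total t (1 / 2) with h | h
  · rw [smoothStep_of_le h]; exact eta_pos ht
  · linarith [half_le_smoothStep hp h]

theorem smoothStep_nonneg (hp : 1 ≤ p) (t : ℝ) : 0 ≤ smoothStep p t := by
  rcases le_total t (1 / 2) with h | h
  · rw [smoothStep_of_le h]; exact eta_nonneg p t
  · linarith [half_le_smoothStep hp h]

theorem smoothStep_le_one (hp : 1 ≤ p) (t : ℝ) : smoothStep p t ≤ 1 := by
  linarith [smoothStep_add_smoothStep p t, smoothStep_nonneg hp (1 - t)]

/-- The derivative of the smooth step. -/
def smoothStepDeriv (p t : ℝ) : ℝ := etaDeriv p (min t (1 - t))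

theorem continuous_smoothStepDeriv (hp : 0 < p) : Continuous (smoothStepDeriv p) :=
  (continuous_etaDeriv hp).comp (by fun_prop)

theorem hasDerivAt_smoothStep (hp : 0 < p) (t : ℝ) :
    HasDerivAt (smoothStep p) (smoothStepDeriv p t) t := by
  have h1 : HasDerivWithinAt (eta p) (etaDeriv p t) (Iic (1 / 2)) t :=
    (hasDerivAt_eta hp t).hasDerivWithinAt
  have h2 : HasDerivAt (fun t => 1 - eta p (1 - t)) (etaDeriv p (1 - t)) t := by
    have := ((hasDerivAt_eta hp (1 - t)).comp_const_sub 1 t).const_sub 1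
    simpa using this
  rcases lt_trichotomy t (1 / 2) with ht | ht | ht
  · rw [smoothStepDeriv, min_eq_left (by linarith)]
    refine (hasDerivAt_eta hp t).congr_of_eventuallyEq ?_
    filter_upwards [Iio_mem_nhds ht] with y hy using smoothStep_of_le (le_of_lt hy)
  · have e : smoothStepDeriv p t = etaDeriv p t := by
      rw [smoothStepDeriv, min_eq_left (by linarith)]
    have e' : etaDeriv p (1 - t) = etaDeriv p t := by
      congr 1; linarith
    -- At the junction the one-sided derivatives are `η'(t)` and `η'(1 - t)`, which agree for `t =
    -- 1/2`.
    rw [e, ← hasDerivWithinAt_univ, ← Iic_union_Ici (a := (1 / 2 : ℝ))]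
    rw [e'] at h2
    exact (h1.congr (fun y hy => smoothStep_of_le hy) (smoothStep_of_le ht.le)).union
      (h2.hasDerivWithinAt.congr (fun y hy => smoothStep_of_ge hy) (smoothStep_of_ge ht.ge))
  · rw [smoothStepDeriv, min_eq_right (by linarith)]
    refine h2.congr_of_eventuallyEq ?_
    filter_upwards [Ioi_mem_nhds ht] with y hy using smoothStep_of_ge (le_of_lt hy)

theorem continuous_smoothStep (hp : 0 < p) : Continuous (smoothStep p) :=
  continuous_iff_continuousAt.2 fun t => (hasDerivAt_smoothStep hp t).continuousAt

theorem smoothStepDeriv_of_one_le {t : ℝ} (ht : 1 ≤ t) : smoothStepDeriv p t = 0 := by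
  rw [smoothStepDeriv, min_eq_right (by linarith), etaDeriv, if_neg (by linarith)]

theorem integral_smoothStep_eq_etaInt (hp : 0 < p) {t : ℝ} (ht : t ≤ 1 / 2) (ht0 : 0 ≤ t) :
    ∫ x in (0 : ℝ)..t, smoothStep p x = etaInt p t := by
  have h1 : ∫ x in (0 : ℝ)..t, smoothStep p x = ∫ x in (0 : ℝ)..t, eta p x := by
    refine intervalIntegral.integral_congr fun x hx => ?_
    rw [uIcc_of_le ht0] at hx
    exact smoothStep_of_le (hx.2.trans ht)
  rw [h1, intervalIntegral.integral_eq_sub_of_hasDerivAt (fun x _ => hasDerivAt_etaInt hp x)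
    ((continuous_eta hp).intervalIntegrable _ _)]
  simp [etaInt]

theorem integral_smoothStep_one (hp : 0 < p) : ∫ x in (0 : ℝ)..1, smoothStep p x = 1 / 2 := by
  have hi : ∀ a b : ℝ, IntervalIntegrable (smoothStep p) volume a b := fun a b =>
    (continuous_smoothStep hp).intervalIntegrable a b
  have h1 : ∫ x in (0 : ℝ)..1, smoothStep p (1 - x) = ∫ x in (0 : ℝ)..1, smoothStep p x := by
    rw [intervalIntegral.integral_comp_sub_left]; simp
  have h2 : ∫ x in (0 : ℝ)..1, smoothStep p x + smoothStep p (1 - x) = 1 := by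
    simp [smoothStep_add_smoothStep]
  have h3 : Continuous fun x => smoothStep p (1 - x) :=
    (continuous_smoothStep hp).comp (by fun_prop)
  rw [intervalIntegral.integral_add (hi _ _) (h3.intervalIntegrable _ _), h1] at h2
  linarith

theorem integral_smoothStep_of_one_le (hp : 0 < p) {t : ℝ} (ht : 1 ≤ t) :
    ∫ x in (0 : ℝ)..t, smoothStep p x = t - 1 / 2 := by
  have hi : ∀ a b : ℝ, IntervalIntegrable (smoothStep p) volume a b := fun a b =>
    (continuous_smoothStep hp).intervalIntegrable a b
  have h1 : ∫ x in (1 : ℝ)..t, smoothStep p x = ∫ x in (1 : ℝ)..t, (1 : ℝ) := by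
    refine intervalIntegral.integral_congr fun x hx => ?_
    rw [uIcc_of_le ht] at hx
    exact smoothStep_of_one_le hx.1
  rw [← intervalIntegral.integral_add_adjacent_intervals (hi 0 1) (hi 1 t), h1,
    integral_smoothStep_one hp]
  simp
  ring

end Damping

/-! ### The weight and its antiderivative -/

section Weight

variable {p θ : ℝ}

/-- As `θ ≤ 1/2`, on each half of the interval the step belonging to the far end equals `1`. The
product form replaces the case distinction: it is visibly `C¹` and symmetric under `u ↦ 1 - u`. -/
theorem weight_eq (hθ : 0 < θ) (hθ2 : θ ≤ 1 / 2) (u : ℝ) :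
    weight p θ u = (1 - θ)⁻¹ * (smoothStep p (u / θ) * smoothStep p ((1 - u) / θ)) := by
  have half : ∀ u, weightHalf p θ u = (1 - θ)⁻¹ * smoothStep p (u / θ) := by
    intro u
    unfold weightHalf
    split_ifs with h1 h2
    · rw [smoothStep_of_le]
      rw [div_le_iff₀ hθ]; linarith
    · rw [smoothStep_of_ge]
      rw [le_div_iff₀ hθ]; linarith
    · rw [smoothStep_of_one_le, mul_one]
      rw [le_div_iff₀ hθ]; linarith
  unfold weight
  split_ifs with h
  · rw [half, smoothStep_of_one_le (t := (1 - u) / θ), mul_one]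
    rw [le_div_iff₀ hθ]; linarith
  · rw [half, smoothStep_of_one_le (t := u / θ), one_mul]
    rw [le_div_iff₀ hθ]; linarith

theorem weight_of_le_half (hθ : 0 < θ) (hθ2 : θ ≤ 1 / 2) {u : ℝ} (hu : u ≤ 1 / 2) :
    weight p θ u = (1 - θ)⁻¹ * smoothStep p (u / θ) := by
  rw [weight_eq hθ hθ2, smoothStep_of_one_le (t := (1 - u) / θ), mul_one]
  rw [le_div_iff₀ hθ]; linarith

theorem weight_one_sub (hθ : 0 < θ) (hθ2 : θ ≤ 1 / 2) (u : ℝ) :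
    weight p θ (1 - u) = weight p θ u := by
  rw [weight_eq hθ hθ2, weight_eq hθ hθ2, sub_sub_cancel, mul_comm (smoothStep p ((1 - u) / θ))]

/-- The derivative of the weight. -/
def weightDeriv (p θ u : ℝ) : ℝ :=
  (1 - θ)⁻¹ * (smoothStepDeriv p (u / θ) * θ⁻¹ * smoothStep p ((1 - u) / θ) -
    smoothStep p (u / θ) * (smoothStepDeriv p ((1 - u) / θ) * θ⁻¹))

theorem weightDeriv_one_sub (p θ u : ℝ) : weightDeriv p θ (1 - u) = -weightDeriv p θ u := by
  unfold weightDeriv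
  rw [sub_sub_cancel]
  ring

theorem weightDeriv_of_le_half (hθ : 0 < θ) (hθ2 : θ ≤ 1 / 2) {u : ℝ} (hu : u ≤ 1 / 2) :
    weightDeriv p θ u = (1 - θ)⁻¹ * (smoothStepDeriv p (u / θ) * θ⁻¹) := by
  have h : 1 ≤ (1 - u) / θ := by rw [le_div_iff₀ hθ]; linarith
  rw [weightDeriv, smoothStep_of_one_le h, smoothStepDeriv_of_one_le h]
  ring

theorem hasDerivAt_weight (hp : 0 < p) (hθ : 0 < θ) (hθ2 : θ ≤ 1 / 2) (u : ℝ) :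
    HasDerivAt (weight p θ) (weightDeriv p θ u) u := by
  have h1 : HasDerivAt (fun u => smoothStep p (u / θ)) (smoothStepDeriv p (u / θ) * θ⁻¹) u := by
    have := (hasDerivAt_smoothStep hp (u / θ)).comp u ((hasDerivAt_id u).div_const θ)
    exact this.congr_deriv (by simp [div_eq_mul_inv])
  have h2 : HasDerivAt (fun u => smoothStep p ((1 - u) / θ))
      (-(smoothStepDeriv p ((1 - u) / θ) * θ⁻¹)) u := by
    have := (hasDerivAt_smoothStep hp ((1 - u) / θ)).comp u
      (((hasDerivAt_id u).const_sub 1).div_const θ)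
    refine this.congr_deriv ?_
    simp [div_eq_mul_inv]
  have h3 := (h1.mul h2).const_mul ((1 - θ)⁻¹)
  refine (h3.congr_deriv ?_).congr_of_eventuallyEq
    (Eventually.of_forall fun u => weight_eq hθ hθ2 u)
  unfold weightDeriv
  ring

theorem continuous_weight (hp : 0 < p) (hθ : 0 < θ) (hθ2 : θ ≤ 1 / 2) :
    Continuous (weight p θ) :=
  continuous_iff_continuousAt.2 fun u => (hasDerivAt_weight hp hθ hθ2 u).continuousAt

theorem continuous_weightDeriv (hp : 0 < p) : Continuous (weightDeriv p θ) := by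
  have h1 := continuous_smoothStepDeriv hp
  have h2 := continuous_smoothStep hp
  unfold weightDeriv
  fun_prop

theorem weight_pos (hp : 1 ≤ p) (hθ : 0 < θ) (hθ2 : θ ≤ 1 / 2) {u : ℝ} (hu : u ∈ Ioo (0 : ℝ) 1) :
    0 < weight p θ u := by
  rw [weight_eq hθ hθ2]
  have h1 := smoothStep_pos hp (div_pos hu.1 hθ)
  have h2 := smoothStep_pos hp (div_pos (sub_pos.2 hu.2) hθ)
  have : 0 < 1 - θ := by linarith
  positivity

theorem weight_nonneg (hp : 1 ≤ p) (hθ : 0 < θ) (hθ2 : θ ≤ 1 / 2) (u : ℝ) :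
    0 ≤ weight p θ u := by
  rw [weight_eq hθ hθ2]
  have h1 := smoothStep_nonneg hp (u / θ)
  have h2 := smoothStep_nonneg hp ((1 - u) / θ)
  have : 0 < 1 - θ := by linarith
  positivity

/-- The antiderivative `u ↦ ∫_0^u w_θ` of the weight. -/
def weightInt (p θ u : ℝ) : ℝ := ∫ t in (0 : ℝ)..u, weight p θ t

theorem hasDerivAt_weightInt (hp : 0 < p) (hθ : 0 < θ) (hθ2 : θ ≤ 1 / 2) (u : ℝ) :
    HasDerivAt (weightInt p θ) (weight p θ u) u :=
  (continuous_weight hp hθ hθ2).integral_hasStrictDerivAt 0 u |>.hasDerivAt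

theorem continuous_weightInt (hp : 0 < p) (hθ : 0 < θ) (hθ2 : θ ≤ 1 / 2) :
    Continuous (weightInt p θ) :=
  continuous_iff_continuousAt.2 fun u => (hasDerivAt_weightInt hp hθ hθ2 u).continuousAt

theorem weightInt_sub_weightInt (hp : 0 < p) (hθ : 0 < θ) (hθ2 : θ ≤ 1 / 2) (a b : ℝ) :
    weightInt p θ b - weightInt p θ a = ∫ t in a..b, weight p θ t :=
  intervalIntegral.integral_interval_sub_left
    ((continuous_weight hp hθ hθ2).intervalIntegrable _ _)
    ((continuous_weight hp hθ hθ2).intervalIntegrable _ _)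

theorem weightInt_zero (p θ : ℝ) : weightInt p θ 0 = 0 := intervalIntegral.integral_same

theorem weightInt_of_le_half (hθ : 0 < θ) (hθ2 : θ ≤ 1 / 2) {u : ℝ} (hu0 : 0 ≤ u)
    (hu : u ≤ 1 / 2) :
    weightInt p θ u = (1 - θ)⁻¹ * (θ * ∫ t in (0 : ℝ)..u / θ, smoothStep p t) := by
  have h1 : weightInt p θ u = ∫ t in (0 : ℝ)..u, (1 - θ)⁻¹ * smoothStep p (t / θ) := by
    refine intervalIntegral.integral_congr fun t ht => ?_
    rw [uIcc_of_le hu0] at ht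
    exact weight_of_le_half hθ hθ2 (ht.2.trans hu)
  rw [h1, intervalIntegral.integral_const_mul,
    intervalIntegral.integral_comp_div (fun t => smoothStep p t) hθ.ne', zero_div, smul_eq_mul]

/-- The prefactor is right because `θ (1/(2θ) - 1/2) = (1 - θ)/2`. By symmetry the total mass is
then `1`. -/
theorem weightInt_half (hp : 0 < p) (hθ : 0 < θ) (hθ2 : θ ≤ 1 / 2) :
    weightInt p θ (1 / 2) = 1 / 2 := by
  rw [weightInt_of_le_half hθ hθ2 (by norm_num) le_rfl, integral_smoothStep_of_one_le hp]
  · have : 1 - θ ≠ 0 := by linarith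
    field_simp
  · rw [le_div_iff₀ hθ]; linarith

theorem weightInt_one_sub (hp : 0 < p) (hθ : 0 < θ) (hθ2 : θ ≤ 1 / 2) (u : ℝ) :
    weightInt p θ (1 - u) = 1 - weightInt p θ u := by
  have h1 : ∫ t in (1 / 2 : ℝ)..u, weight p θ t = ∫ t in (1 - u)..(1 / 2 : ℝ), weight p θ t := by
    have h2 : ∫ t in (1 / 2 : ℝ)..u, weight p θ (1 - t) =
        ∫ t in (1 - u)..(1 - 1 / 2 : ℝ), weight p θ t :=
      intervalIntegral.integral_comp_sub_left (fun t => weight p θ t) 1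
    simp only [weight_one_sub hθ hθ2] at h2
    rw [h2]; norm_num
  rw [← weightInt_sub_weightInt hp hθ hθ2, ← weightInt_sub_weightInt hp hθ hθ2,
    weightInt_half hp hθ hθ2] at h1
  linarith

theorem weightInt_one (hp : 0 < p) (hθ : 0 < θ) (hθ2 : θ ≤ 1 / 2) : weightInt p θ 1 = 1 := by
  have := weightInt_one_sub hp hθ hθ2 0
  rwa [sub_zero, weightInt_zero, sub_zero] at this

theorem strictMonoOn_weightInt (hp : 1 ≤ p) (hθ : 0 < θ) (hθ2 : θ ≤ 1 / 2) :
    StrictMonoOn (weightInt p θ) (Icc 0 1) := by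
  have hp0 : 0 < p := by linarith
  refine strictMonoOn_of_deriv_pos (convex_Icc _ _)
    (continuous_weightInt hp0 hθ hθ2).continuousOn fun x hx => ?_
  rw [(hasDerivAt_weightInt hp0 hθ hθ2 x).deriv]
  rw [interior_Icc] at hx
  exact weight_pos hp hθ hθ2 hx

theorem weightInt_mem_Ioo (hp : 1 ≤ p) (hθ : 0 < θ) (hθ2 : θ ≤ 1 / 2) {u : ℝ}
    (hu : u ∈ Ioo (0 : ℝ) 1) : weightInt p θ u ∈ Ioo (0 : ℝ) 1 := by
  have hp0 : 0 < p := by linarith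
  have hm := strictMonoOn_weightInt hp hθ hθ2
  have h0 := hm ⟨le_rfl, zero_le_one⟩ ⟨hu.1.le, hu.2.le⟩ hu.1
  have h1 := hm ⟨hu.1.le, hu.2.le⟩ ⟨zero_le_one, le_rfl⟩ hu.2
  rw [weightInt_zero] at h0
  rw [weightInt_one hp0 hθ hθ2] at h1
  exact ⟨h0, h1⟩

end Weight

end

end BDIS

namespace BDIS

noncomputable section

open Filter Topology

/-! ### The distribution function -/

section Cdf

variable {φ : ℝ → ℝ}

theorem cdf_sub_cdf (hφ : IsLightTailedDensity φ) (a b : ℝ) :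
    cdf φ b - cdf φ a = ∫ x in a..b, φ x :=
  intervalIntegral.integral_Iic_sub_Iic hφ.integrable.integrableOn hφ.integrable.integrableOn

theorem strictMono_cdf (hφ : IsLightTailedDensity φ) : StrictMono (cdf φ) := by
  intro a b hab
  have := intervalIntegral.intervalIntegral_pos_of_pos
    (hφ.integrable.intervalIntegrable (a := a) (b := b)) hφ.pos hab
  rw [← cdf_sub_cdf hφ] at this
  linarith

theorem exists_abs_cdf_sub_le (hφ : IsLightTailedDensity φ) :
    ∃ M : ℝ, ∀ x y, |cdf φ y - cdf φ x| ≤ M * |x - y| := by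
  obtain ⟨M, hM⟩ := hφ.bounded
  refine ⟨M, fun x y => ?_⟩
  rw [cdf_sub_cdf hφ, abs_sub_comm]
  exact intervalIntegral.norm_integral_le_of_norm_le_const fun t _ => by
    rw [Real.norm_eq_abs, abs_of_pos (hφ.pos t)]; exact hM t

theorem continuous_cdf (hφ : IsLightTailedDensity φ) : Continuous (cdf φ) := by
  obtain ⟨M, hM⟩ := exists_abs_cdf_sub_le hφ
  refine (LipschitzWith.of_dist_le_mul (K := Real.nnabs M) fun x y => ?_).continuous
  rw [dist_comm, Real.dist_eq, Real.dist_eq, Real.coe_nnabs]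
  exact (hM x y).trans (mul_le_mul_of_nonneg_right (le_abs_self M) (abs_nonneg _))

theorem tendsto_cdf_atTop (hφ : IsLightTailedDensity φ) : Tendsto (cdf φ) atTop (𝓝 1) := by
  have := tendsto_setIntegral_of_monotone (μ := volume) (f := φ) (s := fun x : ℝ => Iic x)
    (fun _ => measurableSet_Iic) (fun _ _ h => Iic_subset_Iic.2 h) hφ.integrable.integrableOn
  rw [iUnion_Iic, setIntegral_univ, hφ.integral_eq_one] at this
  exact this

theorem cdf_neg (hφ : IsLightTailedDensity φ) (x : ℝ) : cdf φ (-x) = 1 - cdf φ x := by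
  have h1 : cdf φ (-x) = ∫ y in Ioi x, φ y := by
    unfold cdf
    rw [← integral_comp_neg_Ioi]
    exact integral_congr_ae (Eventually.of_forall fun y => (hφ.symm y).symm)
  have h2 := intervalIntegral.integral_Iic_add_Ioi (b := x) hφ.integrable.integrableOn
    hφ.integrable.integrableOn
  rw [hφ.integral_eq_one] at h2
  rw [h1]
  unfold cdf
  linarith

theorem tendsto_cdf_atBot (hφ : IsLightTailedDensity φ) : Tendsto (cdf φ) atBot (𝓝 0) := by
  have h1 := ((tendsto_cdf_atTop hφ).comp tendsto_neg_atBot_atTop).const_sub 1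
  rw [sub_self] at h1
  refine h1.congr fun x => ?_
  rw [Function.comp, cdf_neg hφ, sub_sub_cancel]

theorem cdf_mem_Ioo (hφ : IsLightTailedDensity φ) (x : ℝ) : cdf φ x ∈ Ioo (0 : ℝ) 1 := by
  have hm := strictMono_cdf hφ
  constructor
  · exact (hm.monotone.le_of_tendsto (tendsto_cdf_atBot hφ) (x - 1)).trans_lt
      (hm (sub_one_lt x))
  · exact (hm (lt_add_one x)).trans_le
      (hm.monotone.ge_of_tendsto (tendsto_cdf_atTop hφ) (x + 1))

theorem range_cdf (hφ : IsLightTailedDensity φ) : range (cdf φ) = Ioo 0 1 := by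
  refine Subset.antisymm (range_subset_iff.2 (cdf_mem_Ioo hφ)) fun y hy => ?_
  obtain ⟨a, ha⟩ := ((tendsto_cdf_atBot hφ).eventually (gt_mem_nhds hy.1)).exists
  obtain ⟨b, hb⟩ := ((tendsto_cdf_atTop hφ).eventually (lt_mem_nhds hy.2)).exists
  exact mem_range_of_exists_le_of_exists_ge (continuous_cdf hφ) ⟨a, ha.le⟩ ⟨b, hb.le⟩

theorem quantile_cdf (hφ : IsLightTailedDensity φ) (x : ℝ) : quantile φ (cdf φ x) = x := by
  have : {y : ℝ | cdf φ x ≤ cdf φ y} = Ici x := by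
    ext y
    exact (strictMono_cdf hφ).le_iff_le
  rw [quantile, this, csInf_Ici]

theorem ae_hasDerivAt_cdf (hφ : IsLightTailedDensity φ) :
    ∀ᵐ x, HasDerivAt (cdf φ) (φ x) x := by
  filter_upwards [LocallyIntegrable.ae_hasDerivAt_integral hφ.integrable.locallyIntegrable] with x hx
  refine ((hx 0).const_add (cdf φ 0)).congr_of_eventuallyEq (Eventually.of_forall fun y => ?_)
  simp only [← cdf_sub_cdf hφ]
  ring

/-- The tail condition, symmetrised. -/
theorem exists_mul_rpow_le_density (hφ : IsLightTailedDensity φ) {ε : ℝ} (hε : 0 < ε) :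
    ∃ c : ℝ, 0 < c ∧ ∀ x, c * (cdf φ x * (1 - cdf φ x)) ^ (1 + ε) ≤ φ x := by
  obtain ⟨c, hc, h⟩ := hφ.tail ε hε
  have key : ∀ x, x ≤ 0 → c * (cdf φ x * (1 - cdf φ x)) ^ (1 + ε) ≤ φ x := by
    intro x hx
    have hx1 := cdf_mem_Ioo hφ x
    refine le_trans ?_ (h x hx)
    have h1 : cdf φ x * (1 - cdf φ x) ≤ cdf φ x :=
      mul_le_of_le_one_right hx1.1.le (by linarith [hx1.1])
    have h0 : 0 ≤ cdf φ x * (1 - cdf φ x) := mul_nonneg hx1.1.le (by linarith [hx1.2])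
    gcongr
  refine ⟨c, hc, fun x => ?_⟩
  rcases le_total x 0 with hx | hx
  · exact key x hx
  · have := key (-x) (by linarith)
    rw [cdf_neg hφ, sub_sub_cancel, mul_comm (1 - cdf φ x), ← hφ.symm] at this
    exact this

end Cdf

/-! ### The inverse of the transport map -/

section CoordInv

variable {φ : ℝ → ℝ} {p θ : ℝ}

/-- The inverse of the transport map `T_θ`. -/
def transportInv (φ : ℝ → ℝ) (p θ x : ℝ) : ℝ :=
  Function.invFunOn (weightInt p θ) (Ioo 0 1) (cdf φ x)

theorem exists_weightInt_eq (hφ : IsLightTailedDensity φ) (hp : 0 < p) (hθ : 0 < θ)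
    (hθ2 : θ ≤ 1 / 2) (x : ℝ) : ∃ u ∈ Ioo (0 : ℝ) 1, weightInt p θ u = cdf φ x := by
  have h := intermediate_value_Ioo (zero_le_one (α := ℝ))
    (continuous_weightInt hp hθ hθ2).continuousOn
  rw [weightInt_zero, weightInt_one hp hθ hθ2] at h
  exact h (cdf_mem_Ioo hφ x)

theorem transportInv_mem (hφ : IsLightTailedDensity φ) (hp : 0 < p) (hθ : 0 < θ)
    (hθ2 : θ ≤ 1 / 2) (x : ℝ) : transportInv φ p θ x ∈ Ioo (0 : ℝ) 1 :=
  Function.invFunOn_mem (exists_weightInt_eq hφ hp hθ hθ2 x)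

theorem weightInt_transportInv (hφ : IsLightTailedDensity φ) (hp : 0 < p) (hθ : 0 < θ)
    (hθ2 : θ ≤ 1 / 2) (x : ℝ) : weightInt p θ (transportInv φ p θ x) = cdf φ x :=
  Function.invFunOn_eq (exists_weightInt_eq hφ hp hθ hθ2 x)

theorem transport_transportInv (hφ : IsLightTailedDensity φ) (hp : 0 < p) (hθ : 0 < θ)
    (hθ2 : θ ≤ 1 / 2) (x : ℝ) : transport φ p θ (transportInv φ p θ x) = x := by
  have h : transport φ p θ (transportInv φ p θ x) =
      quantile φ (weightInt p θ (transportInv φ p θ x)) := rfl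
  rw [h, weightInt_transportInv hφ hp hθ hθ2, quantile_cdf hφ]

theorem strictMono_transportInv (hφ : IsLightTailedDensity φ) (hp : 1 ≤ p) (hθ : 0 < θ)
    (hθ2 : θ ≤ 1 / 2) : StrictMono (transportInv φ p θ) := by
  have hp0 : 0 < p := by linarith
  intro x y hxy
  have h := strictMono_cdf hφ hxy
  rw [← weightInt_transportInv hφ hp0 hθ hθ2, ← weightInt_transportInv hφ hp0 hθ hθ2] at h
  exact ((strictMonoOn_weightInt hp hθ hθ2).lt_iff_lt
    (Ioo_subset_Icc_self (transportInv_mem hφ hp0 hθ hθ2 x))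
    (Ioo_subset_Icc_self (transportInv_mem hφ hp0 hθ hθ2 y))).1 h

theorem range_transportInv (hφ : IsLightTailedDensity φ) (hp : 1 ≤ p) (hθ : 0 < θ)
    (hθ2 : θ ≤ 1 / 2) : range (transportInv φ p θ) = Ioo 0 1 := by
  have hp0 : 0 < p := by linarith
  refine Subset.antisymm (range_subset_iff.2 (transportInv_mem hφ hp0 hθ hθ2)) fun u hu => ?_
  have h := weightInt_mem_Ioo hp hθ hθ2 hu
  rw [← range_cdf hφ] at h
  obtain ⟨x, hx⟩ := h
  refine ⟨x, ?_⟩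
  rw [← weightInt_transportInv hφ hp0 hθ hθ2] at hx
  exact (strictMonoOn_weightInt hp hθ hθ2).injOn
    (Ioo_subset_Icc_self (transportInv_mem hφ hp0 hθ hθ2 x)) (Ioo_subset_Icc_self hu) hx

theorem continuous_transportInv (hφ : IsLightTailedDensity φ) (hp : 1 ≤ p) (hθ : 0 < θ)
    (hθ2 : θ ≤ 1 / 2) : Continuous (transportInv φ p θ) := by
  refine continuous_iff_continuousAt.2 fun x => ?_
  refine continuousAt_of_monotoneOn_of_image_mem_nhds
    ((strictMono_transportInv hφ hp hθ hθ2).monotone.monotoneOn univ) univ_mem ?_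
  rw [image_univ, range_transportInv hφ hp hθ hθ2]
  exact Ioo_mem_nhds (transportInv_mem hφ (by linarith) hθ hθ2 x).1
    (transportInv_mem hφ (by linarith) hθ hθ2 x).2

/-- From `W ∘ S = Φ`, the slopes of `S` are those of `Φ` divided by those of `W` along `S`. Only
differentiability of `Φ` at the single point `x` is used, as `Φ` is differentiable merely almost
everywhere. -/
theorem hasDerivAt_transportInv (hφ : IsLightTailedDensity φ) (hp : 1 ≤ p) (hθ : 0 < θ)
    (hθ2 : θ ≤ 1 / 2) {x : ℝ} (hx : HasDerivAt (cdf φ) (φ x) x) :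
    HasDerivAt (transportInv φ p θ) (φ x / weight p θ (transportInv φ p θ x)) x := by
  have hp0 : 0 < p := by linarith
  have hmono := strictMono_transportInv hφ hp hθ hθ2
  have hw := (weight_pos hp hθ hθ2 (transportInv_mem hφ hp0 hθ hθ2 x)).ne'
  have h1 := hasDerivAt_iff_tendsto_slope.1
    (hasDerivAt_weightInt hp0 hθ hθ2 (transportInv φ p θ x))
  have h2 := hasDerivAt_iff_tendsto_slope.1 hx
  have h3 : Tendsto (transportInv φ p θ) (𝓝[≠] x) (𝓝[≠] (transportInv φ p θ x)) := by
    refine tendsto_nhdsWithin_iff.2 ⟨?_, ?_⟩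
    · exact ((continuous_transportInv hφ hp hθ hθ2).tendsto x).mono_left nhdsWithin_le_nhds
    · exact eventually_nhdsWithin_of_forall fun y hy => hmono.injective.ne hy
  refine hasDerivAt_iff_tendsto_slope.2 ((h2.div (h1.comp h3) hw).congr' ?_)
  refine eventually_nhdsWithin_of_forall fun y hy => ?_
  have hy1 : y - x ≠ 0 := sub_ne_zero.2 hy
  have hy2 : transportInv φ p θ y - transportInv φ p θ x ≠ 0 :=
    sub_ne_zero.2 (hmono.injective.ne hy)
  have hy3 : cdf φ y - cdf φ x ≠ 0 := sub_ne_zero.2 ((strictMono_cdf hφ).injective.ne hy)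
  simp only [Pi.div_apply, Function.comp_apply, slope_def_field, weightInt_transportInv hφ hp0 hθ hθ2]
  field_simp

theorem withDensity_weight_Iic (hp : 1 ≤ p) (hθ : 0 < θ) (hθ2 : θ ≤ 1 / 2) {a : ℝ}
    (ha : a ∈ Icc (0 : ℝ) 1) :
    ((volume.restrict (Ioo 0 1)).withDensity fun u => ENNReal.ofReal (weight p θ u)) (Iic a) =
      ENNReal.ofReal (weightInt p θ a) := by
  have hp0 : 0 < p := by linarith
  have hc := continuous_weight hp0 hθ hθ2
  rw [withDensity_apply _ measurableSet_Iic, Measure.restrict_restrict measurableSet_Iic]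
  have e : (Iic a ∩ Ioo (0 : ℝ) 1 : Set ℝ) =ᵐ[volume] Ioc 0 a := by
    have e1 : (Iic a ∩ Ioo (0 : ℝ) 1 : Set ℝ) =ᵐ[volume] (Iic a ∩ Ioc (0 : ℝ) 1 : Set ℝ) :=
      (ae_eq_refl _).inter Ioo_ae_eq_Ioc
    have e2 : (Iic a ∩ Ioc (0 : ℝ) 1 : Set ℝ) = Ioc 0 a := by
      ext x
      simp only [mem_inter_iff, mem_Iic, mem_Ioc]
      constructor
      · rintro ⟨h1, h2, _⟩; exact ⟨h2, h1⟩
      · rintro ⟨h1, h2⟩; exact ⟨h2, h1, h2.trans ha.2⟩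
    rwa [e2] at e1
  rw [setLIntegral_congr e, weightInt, intervalIntegral.integral_of_le ha.1,
    ofReal_integral_eq_lintegral_ofReal (hc.integrableOn_Ioc)
      (Eventually.of_forall fun u => weight_nonneg hp hθ hθ2 u)]

/-- The two finite measures are compared on half-lines: for `a = S(x)` both masses are `Φ(x) =
W(S(x))`, and the remaining `a` give mass `0` or `1`. -/
theorem measurePreserving_transportInv (hφ : IsLightTailedDensity φ) (hp : 1 ≤ p) (hθ : 0 < θ)
    (hθ2 : θ ≤ 1 / 2) : MeasurePreserving (transportInv φ p θ)
      (volume.withDensity fun x => ENNReal.ofReal (φ x))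
      ((volume.restrict (Ioo 0 1)).withDensity fun u => ENNReal.ofReal (weight p θ u)) := by
  have hp0 : 0 < p := by linarith
  have hmeas : Measurable (transportInv φ p θ) :=
    (continuous_transportInv hφ hp hθ hθ2).measurable
  have hmem := transportInv_mem hφ hp0 hθ hθ2
  have hfin : ∀ s : Set ℝ, MeasurableSet s →
      (volume.withDensity fun x => ENNReal.ofReal (φ x)) s = ENNReal.ofReal (∫ x in s, φ x) := by
    intro s hs
    rw [withDensity_apply _ hs, ofReal_integral_eq_lintegral_ofReal hφ.integrable.integrableOn
      (Eventually.of_forall fun x => (hφ.pos x).le)]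
  have : IsFiniteMeasure (volume.withDensity fun x => ENNReal.ofReal (φ x)) :=
    ⟨by rw [hfin _ MeasurableSet.univ]; exact ENNReal.ofReal_lt_top⟩
  refine ⟨hmeas, Measure.ext_of_Iic _ _ fun a => ?_⟩
  rw [Measure.map_apply hmeas measurableSet_Iic]
  rcases le_or_gt a 0 with ha0 | ha0
  · have e1 : transportInv φ p θ ⁻¹' Iic a = ∅ :=
      eq_empty_of_forall_notMem fun x hx => absurd ((hmem x).1.trans_le hx) ha0.not_gt
    have e2 : (Iic a ∩ Ioo (0 : ℝ) 1) = ∅ :=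
      eq_empty_of_forall_notMem fun x hx => absurd (hx.2.1.trans_le hx.1) ha0.not_gt
    rw [e1, measure_empty, withDensity_apply _ measurableSet_Iic,
      Measure.restrict_restrict measurableSet_Iic, e2]
    simp
  rcases le_or_gt 1 a with ha1 | ha1
  · have e1 : transportInv φ p θ ⁻¹' Iic a = univ :=
      eq_univ_of_forall fun x => (hmem x).2.le.trans ha1
    have e2 : (Iic a ∩ Ioo (0 : ℝ) 1) = Iic 1 ∩ Ioo (0 : ℝ) 1 := by
      rw [inter_eq_right.2 fun x hx => hx.2.le.trans ha1, inter_eq_right.2 fun x hx => hx.2.le]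
    have e3 := withDensity_weight_Iic hp hθ hθ2 (a := 1) ⟨zero_le_one, le_rfl⟩
    rw [withDensity_apply _ measurableSet_Iic, Measure.restrict_restrict measurableSet_Iic,
      weightInt_one hp0 hθ hθ2] at e3
    rw [e1, hfin _ MeasurableSet.univ, setIntegral_univ, hφ.integral_eq_one,
      withDensity_apply _ measurableSet_Iic, Measure.restrict_restrict measurableSet_Iic, e2, e3]
  · have ha : a ∈ Ioo (0 : ℝ) 1 := ⟨ha0, ha1⟩
    rw [← range_transportInv hφ hp hθ hθ2] at ha
    obtain ⟨x, rfl⟩ := ha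
    have e1 : transportInv φ p θ ⁻¹' Iic (transportInv φ p θ x) = Iic x := by
      ext y
      exact (strictMono_transportInv hφ hp hθ hθ2).le_iff_le
    rw [e1, hfin _ measurableSet_Iic, withDensity_weight_Iic hp hθ hθ2 ⟨ha0.le, ha1.le⟩,
      weightInt_transportInv hφ hp0 hθ hθ2]
    rfl

theorem isTransport_transport (hφ : IsLightTailedDensity φ) (hp : 1 ≤ p) (hθ : 0 < θ)
    (hθ2 : θ ≤ 1 / 2) :
    IsTransport φ (weight p θ) (weightDeriv p θ) (transportInv φ p θ) (transport φ p θ) where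
  hasDerivAt_weight := hasDerivAt_weight (by linarith) hθ hθ2
  continuous_deriv := continuous_weightDeriv (by linarith)
  weight_pos := fun _ hu => weight_pos hp hθ hθ2 hu
  strictMono := strictMono_transportInv hφ hp hθ hθ2
  continuous := continuous_transportInv hφ hp hθ hθ2
  range_eq := range_transportInv hφ hp hθ hθ2
  left_inv := transport_transportInv hφ (by linarith) hθ hθ2
  measurePreserving := measurePreserving_transportInv hφ hp hθ hθ2
  lipschitz := by
    obtain ⟨M, hM⟩ := exists_abs_cdf_sub_le hφ
    refine ⟨M, fun x y => ?_⟩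
    have hp0 : 0 < p := by linarith
    rw [← weightInt_sub_weightInt hp0 hθ hθ2, weightInt_transportInv hφ hp0 hθ hθ2,
      weightInt_transportInv hφ hp0 hθ hθ2]
    exact hM x y
  hasDerivAt := by
    filter_upwards [ae_hasDerivAt_cdf hφ] with x hx
    exact hasDerivAt_transportInv hφ hp hθ hθ2 hx

end CoordInv

end

end BDIS

namespace BDIS

noncomputable section

open Filter Topology
open scoped ENNReal

/-! ### Pointwise bounds for the weight -/

section Pointwise

variable {p θ : ℝ}

theorem inv_one_sub_mem (hθ : 0 < θ) (hθ2 : θ ≤ 1 / 2) : (1 - θ)⁻¹ ∈ Icc (1 : ℝ) 2 := by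
  have h : 0 < 1 - θ := by linarith
  constructor
  · rw [le_inv_comm₀ one_pos h]; linarith
  · rw [inv_le_comm₀ h two_pos]; linarith

theorem weight_le_two (hp : 1 ≤ p) (hθ : 0 < θ) (hθ2 : θ ≤ 1 / 2) (u : ℝ) :
    weight p θ u ≤ 2 := by
  rw [weight_eq hθ hθ2]
  have h := inv_one_sub_mem hθ hθ2
  have h1 := smoothStep_le_one hp (u / θ)
  have h2 := smoothStep_le_one hp ((1 - u) / θ)
  have h3 := smoothStep_nonneg hp (u / θ)
  have h4 := smoothStep_nonneg hp ((1 - u) / θ)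
  nlinarith [mul_le_one₀ h1 h4 h2, mul_nonneg h3 h4, h.1, h.2]

theorem etaInt_half (p : ℝ) : etaInt p (1 / 2) = (2 : ℝ) ^ (-p - 2) / p := by
  have h : (1 / 2 : ℝ) ^ (-p) = 2 ^ p := by
    rw [one_div, Real.inv_rpow (by norm_num), ← Real.rpow_neg (by norm_num), neg_neg]
  rw [etaInt, if_pos (by norm_num), h, sub_self, Real.exp_zero, mul_one]

theorem etaInt_half_le (hp : 1 ≤ p) : etaInt p (1 / 2) ≤ 1 / 4 := by
  rw [etaInt_half]
  have h : (2 : ℝ) ^ (-p - 2) ≤ 2 ^ (-2 : ℝ) :=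
    Real.rpow_le_rpow_of_exponent_le (by norm_num) (by linarith)
  have h2 : (2 : ℝ) ^ (-2 : ℝ) = 1 / 4 := by
    rw [Real.rpow_neg (by norm_num)]; norm_num
  rw [h2] at h
  rw [div_le_iff₀ (by linarith)]
  linarith

theorem etaInt_le_etaInt_half (hp : 0 < p) {t : ℝ} (ht2 : t ≤ 1 / 2) :
    etaInt p t ≤ etaInt p (1 / 2) := by
  have hm : Monotone (etaInt p) := monotone_of_deriv_nonneg
    (fun x => (hasDerivAt_etaInt hp x).differentiableAt) fun x => by
      rw [(hasDerivAt_etaInt hp x).deriv]; exact eta_nonneg p x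
  exact hm ht2

/-- The line `2 h t`, with `h = etaInt p (1/2)`, agrees with the integral at `1/2` and has slope `2h
≤ 1/2`, while the integrand is at least `1/2` from there on. -/
theorem mul_le_integral_smoothStep (hp : 1 ≤ p) {t : ℝ} (ht : 1 / 2 ≤ t) :
    2 * etaInt p (1 / 2) * t ≤ ∫ x in (0 : ℝ)..t, smoothStep p x := by
  have hp0 : 0 < p := by linarith
  have hi : ∀ a b : ℝ, IntervalIntegrable (smoothStep p) volume a b := fun a b =>
    (continuous_smoothStep hp0).intervalIntegrable a b
  have h1 : ∫ x in (1 / 2 : ℝ)..t, (1 / 2 : ℝ) ≤ ∫ x in (1 / 2 : ℝ)..t, smoothStep p x :=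
    intervalIntegral.integral_mono_on ht (by simp) (hi _ _) fun x hx => half_le_smoothStep hp hx.1
  rw [← intervalIntegral.integral_add_adjacent_intervals (hi 0 (1 / 2)) (hi (1 / 2) t),
    integral_smoothStep_eq_etaInt hp0 le_rfl (by norm_num)]
  rw [intervalIntegral.integral_const, smul_eq_mul] at h1
  nlinarith [etaInt_half_le hp]

theorem weightInt_le_half (hp : 1 ≤ p) (hθ : 0 < θ) (hθ2 : θ ≤ 1 / 2) {u : ℝ}
    (hu : u ∈ Ioc (0 : ℝ) (1 / 2)) : weightInt p θ u ≤ 1 / 2 := by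
  rw [← weightInt_half (p := p) (by linarith) hθ hθ2]
  exact (strictMonoOn_weightInt hp hθ hθ2).monotoneOn
    ⟨hu.1.le, by linarith [hu.2]⟩ ⟨by norm_num, by norm_num⟩ hu.2

/-- With `y = t^{-p-1}`, `w ≤ 2 p y H` and `W ≥ θ H`, the left side is at most a constant times
`y^{1+b} H^{1-δb} θ^{-(1+δ)b}`. The condition `δ b ≤ 1/2` leaves `H^{1/2}`, which absorbs `y^{1+b}`.
-/
theorem mul_weightInt_rpow_bound_of_le (hp : 1 ≤ p) {b δ : ℝ} (hb : 1 < b)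
    (hδ : 0 < δ) (hδb : δ * b ≤ 1 / 2) :
    ∃ K : ℝ, 0 < K ∧ ∀ θ, 0 < θ → θ ≤ 1 / 2 → ∀ u ∈ Ioc (0 : ℝ) (θ / 2),
      weight p θ u * (weight p θ u * weightInt p θ u ^ (-(1 + δ))) ^ b ≤
        K * θ ^ (-((1 + δ) * b)) := by
  have hp0 : 0 < p := by linarith
  obtain ⟨C, hC, h⟩ := rpow_neg_mul_etaInt_rpow_le hp0 (r := (p + 1) * (1 + b)) (by positivity)
  refine ⟨(2 * p) ^ (1 + b) * C, by positivity, fun θ hθ hθ2 u hu => ?_⟩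
  have hu2 : u ≤ 1 / 2 := by linarith [hu.2]
  set t := u / θ with ht
  have ht0 : 0 < t := div_pos hu.1 hθ
  have ht2 : t ≤ 1 / 2 := by rw [ht, div_le_iff₀ hθ]; linarith [hu.2]
  set H := etaInt p t with hH
  have hH0 : 0 < H := etaInt_pos hp0 ht0
  have hH1 : H ≤ 1 := by linarith [etaInt_le_etaInt_half hp0 ht2, etaInt_half_le hp]
  have hinv := inv_one_sub_mem hθ hθ2
  set y := t ^ (-p - 1) with hy
  have hy0 : 0 < y := Real.rpow_pos_of_pos ht0 _
  have hw : weight p θ u ≤ 2 * p * y * H := by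
    rw [weight_of_le_half hθ hθ2 hu2, smoothStep_of_le ht2, eta_eq_mul_etaInt hp0 ht0]
    calc (1 - θ)⁻¹ * (p * y * H) ≤ 2 * (p * y * H) :=
          mul_le_mul_of_nonneg_right hinv.2 (by positivity)
      _ = _ := by ring
  have hW : θ * H ≤ weightInt p θ u := by
    rw [weightInt_of_le_half hθ hθ2 hu.1.le hu2, integral_smoothStep_eq_etaInt hp0 ht2 ht0.le]
    exact le_mul_of_one_le_left (by positivity) hinv.1
  have hw0 := weight_nonneg hp hθ hθ2 u
  have hW' : weightInt p θ u ^ (-(1 + δ)) ≤ (θ * H) ^ (-(1 + δ)) :=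
    Real.rpow_le_rpow_of_nonpos (by positivity) hW (by linarith)
  have hWpos : 0 < weightInt p θ u := lt_of_lt_of_le (by positivity) hW
  have e1 : y ^ (1 + b) = t ^ (-((p + 1) * (1 + b))) := by
    rw [hy, ← Real.rpow_mul ht0.le]; ring_nf
  have e2 : H * (H * H ^ (-(1 + δ))) ^ b = H ^ (1 - δ * b) := by
    have : H * H ^ (-(1 + δ)) = H ^ (-δ) := by
      nth_rewrite 1 [← Real.rpow_one H]
      rw [← Real.rpow_add hH0]; ring_nf
    rw [this, ← Real.rpow_mul hH0.le]
    nth_rewrite 1 [← Real.rpow_one H]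
    rw [← Real.rpow_add hH0]; ring_nf
  have e3 : H ^ (1 - δ * b) ≤ H ^ (1 / 2 : ℝ) :=
    Real.rpow_le_rpow_of_exponent_ge hH0 hH1 (by linarith)
  calc weight p θ u * (weight p θ u * weightInt p θ u ^ (-(1 + δ))) ^ b
      ≤ (2 * p * y * H) * ((2 * p * y * H) * (θ * H) ^ (-(1 + δ))) ^ b := by
        gcongr
    _ = (2 * p * y * H) * ((2 * p) * y * θ ^ (-(1 + δ)) * (H * H ^ (-(1 + δ)))) ^ b := by
        rw [Real.mul_rpow hθ.le hH0.le]; ring_nf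
    _ = (2 * p * y * H) * ((2 * p) ^ b * y ^ b * θ ^ (-((1 + δ) * b)) *
          (H * H ^ (-(1 + δ))) ^ b) := by
        rw [Real.mul_rpow (by positivity) (by positivity),
          Real.mul_rpow (by positivity) (by positivity),
          Real.mul_rpow (by positivity) (by positivity), ← Real.rpow_mul hθ.le]
        ring_nf
    _ = ((2 * p) * (2 * p) ^ b) * (y * y ^ b) * (H * (H * H ^ (-(1 + δ))) ^ b) *
          θ ^ (-((1 + δ) * b)) := by ring
    _ = (2 * p) ^ (1 + b) * (t ^ (-((p + 1) * (1 + b))) * H ^ (1 - δ * b)) *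
          θ ^ (-((1 + δ) * b)) := by
        rw [e2, ← e1, Real.rpow_add (by positivity), Real.rpow_one, Real.rpow_add hy0,
          Real.rpow_one]
        ring
    _ ≤ (2 * p) ^ (1 + b) * (t ^ (-((p + 1) * (1 + b))) * H ^ (1 / 2 : ℝ)) *
          θ ^ (-((1 + δ) * b)) := by gcongr
    _ ≤ (2 * p) ^ (1 + b) * C * θ ^ (-((1 + δ) * b)) := by
        have := h t ht0
        gcongr

theorem rpow_neg_le_max {r θ u : ℝ} (hr : 0 < r) (hθ : 0 < θ) (hu : θ / 2 < u) :
    u ^ (-r) ≤ 2 ^ r * max θ u ^ (-r) := by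
  have hm : 0 < max θ u := lt_max_of_lt_left hθ
  have h1 : max θ u / 2 ≤ u := by
    rcases max_cases θ u with ⟨h, _⟩ | ⟨h, _⟩ <;> rw [h] <;> linarith
  calc u ^ (-r) ≤ (max θ u / 2) ^ (-r) :=
        Real.rpow_le_rpow_of_nonpos (by positivity) h1 (by linarith)
    _ = 2 ^ r * max θ u ^ (-r) := by
        rw [Real.div_rpow hm.le (by norm_num), Real.rpow_neg (by norm_num : (0 : ℝ) ≤ 2),
          div_inv_eq_mul, mul_comm]

/-- Beyond `θ/2` no cancellation is needed: `w ≤ 2`, `W` is at least a multiple of `u`, and `u` is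
comparable to `max θ u`. -/
theorem mul_weightInt_rpow_bound (hp : 1 ≤ p) {b δ : ℝ} (hb : 1 < b)
    (hδ : 0 < δ) (hδb : δ * b ≤ 1 / 2) :
    ∃ K : ℝ, 0 < K ∧ ∀ θ, 0 < θ → θ ≤ 1 / 2 → ∀ u ∈ Ioc (0 : ℝ) (1 / 2),
      weight p θ u * (weight p θ u * weightInt p θ u ^ (-(1 + δ))) ^ b ≤
        K * max θ u ^ (-((1 + δ) * b)) := by
  have hp0 : 0 < p := by linarith
  obtain ⟨K₁, hK₁, h₁⟩ := mul_weightInt_rpow_bound_of_le hp hb hδ hδb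
  set h₀ := etaInt p (1 / 2) with hh₀
  have hh0 : 0 < h₀ := etaInt_pos hp0 (by norm_num)
  set K₂ : ℝ := 2 * (2 * (2 * h₀) ^ (-(1 + δ))) ^ b * 2 ^ ((1 + δ) * b) with hK₂
  have hK₂0 : 0 < K₂ := by positivity
  refine ⟨max K₁ K₂, lt_max_of_lt_left hK₁, fun θ hθ hθ2 u hu => ?_⟩
  have hm : 0 < max θ u := lt_max_of_lt_left hθ
  rcases le_or_gt u (θ / 2) with hle | hlt
  · refine (h₁ θ hθ hθ2 u ⟨hu.1, hle⟩).trans ?_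
    rw [max_eq_left (a := θ) (b := u) (by linarith)]
    gcongr
    exact le_max_left _ _
  · have hinv := inv_one_sub_mem hθ hθ2
    have hu0 := hu.1
    have hW : 2 * h₀ * u ≤ weightInt p θ u := by
      rw [weightInt_of_le_half hθ hθ2 hu.1.le hu.2]
      have h2 := mul_le_integral_smoothStep hp (t := u / θ) (by
        rw [le_div_iff₀ hθ]; linarith)
      have h3 : 2 * h₀ * u = θ * (2 * h₀ * (u / θ)) := by field_simp
      rw [h3]
      have h4 : θ * (2 * h₀ * (u / θ)) ≤ θ * ∫ t in (0 : ℝ)..u / θ, smoothStep p t :=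
        mul_le_mul_of_nonneg_left h2 hθ.le
      exact h4.trans (le_mul_of_one_le_left (le_trans (by positivity) h4) hinv.1)
    have hW' : weightInt p θ u ^ (-(1 + δ)) ≤ (2 * h₀ * u) ^ (-(1 + δ)) :=
      Real.rpow_le_rpow_of_nonpos (by positivity) hW (by linarith)
    have hWpos : 0 < weightInt p θ u := lt_of_lt_of_le (by positivity) hW
    have hw0 := weight_nonneg hp hθ hθ2 u
    have hw2 := weight_le_two hp hθ hθ2 u
    calc weight p θ u * (weight p θ u * weightInt p θ u ^ (-(1 + δ))) ^ b
        ≤ 2 * (2 * (2 * h₀ * u) ^ (-(1 + δ))) ^ b := by gcongr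
      _ = 2 * (2 * (2 * h₀) ^ (-(1 + δ))) ^ b * u ^ (-((1 + δ) * b)) := by
          rw [Real.mul_rpow (by positivity) hu0.le, ← mul_assoc,
            Real.mul_rpow (by positivity) (by positivity), ← Real.rpow_mul hu0.le, ← mul_assoc]
          ring_nf
      _ ≤ 2 * (2 * (2 * h₀) ^ (-(1 + δ))) ^ b * (2 ^ ((1 + δ) * b) *
            max θ u ^ (-((1 + δ) * b))) := by
          have := rpow_neg_le_max (r := (1 + δ) * b) (by positivity) hθ hlt
          gcongr
      _ = K₂ * max θ u ^ (-((1 + δ) * b)) := by rw [hK₂]; ring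
      _ ≤ _ := by
          gcongr
          exact le_max_right _ _

/-- The logarithmic derivative is `θ⁻¹` times that of the step at `t = u/θ`. It vanishes for `t ≥
1`, is bounded for `1/2 < t < 1`, and is at most `p t^{-p-1}` for `t ≤ 1/2`, where the decay of the
outer factor `w` absorbs it. -/
theorem weightDeriv_bound (hp : 1 ≤ p) {b δ : ℝ} (hb : 1 < b) (hδ : 0 < δ) :
    ∃ K : ℝ, 0 < K ∧ ∀ θ, 0 < θ → θ ≤ 1 / 2 → ∀ u ∈ Ioc (0 : ℝ) (1 / 2),
      weight p θ u * |weightDeriv p θ u / weight p θ u| ^ b ≤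
        K * max θ u ^ (-((1 + δ) * b)) := by
  have hp0 : 0 < p := by linarith
  obtain ⟨C, hC, h⟩ := rpow_neg_mul_etaInt_rpow_le hp0 (r := (p + 1) * (1 + b)) (by positivity)
  obtain ⟨D, hD, hDb⟩ := abs_etaDeriv_le hp0
  set K₁ : ℝ := 2 * p ^ (1 + b) * C with hK₁
  set K₂ : ℝ := 2 * (2 * D) ^ b with hK₂
  have hK₁0 : 0 < K₁ := by positivity
  have hK₂0 : 0 < K₂ := by positivity
  refine ⟨max K₁ K₂, lt_max_of_lt_left hK₁0, fun θ hθ hθ2 u hu => ?_⟩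
  have hm : 0 < max θ u := lt_max_of_lt_left hθ
  have hinv := inv_one_sub_mem hθ hθ2
  set t := u / θ with ht
  have ht0 : 0 < t := div_pos hu.1 hθ
  have hw := weight_of_le_half (p := p) hθ hθ2 hu.2
  have hdw := weightDeriv_of_le_half (p := p) hθ hθ2 hu.2
  rw [← ht] at hw hdw
  have hE := smoothStep_pos hp ht0
  have hratio : weightDeriv p θ u / weight p θ u =
      smoothStepDeriv p t / smoothStep p t * θ⁻¹ := by
    rw [hw, hdw]
    have : 1 - θ ≠ 0 := by linarith
    field_simp
  rcases le_or_gt 1 t with ht1 | ht1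
  · rw [hratio, smoothStepDeriv_of_one_le ht1, zero_div, zero_mul, abs_zero,
      Real.zero_rpow (by linarith), mul_zero]
    have : 0 < max K₁ K₂ := lt_max_of_lt_left hK₁0
    positivity
  have huθ : u ≤ θ := by
    rw [ht, div_lt_one hθ] at ht1; exact ht1.le
  -- The loss of `δ` is not forced here; it gives the bound the same form as for `w / φ`.
  have hθb : θ⁻¹ ^ b ≤ max θ u ^ (-((1 + δ) * b)) := by
    rw [max_eq_left huθ, Real.inv_rpow hθ.le, ← Real.rpow_neg hθ.le]
    exact Real.rpow_le_rpow_of_exponent_ge hθ (by linarith) (by nlinarith)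
  rw [hratio, abs_mul, abs_of_pos (inv_pos.2 hθ), Real.mul_rpow (abs_nonneg _) (by positivity)]
  have hmain : weight p θ u * |smoothStepDeriv p t / smoothStep p t| ^ b ≤ max K₁ K₂ := by
    rcases le_or_gt t (1 / 2) with ht2 | ht2
    · refine le_trans ?_ (le_max_left _ _)
      set H := etaInt p t with hH
      have hH0 : 0 < H := etaInt_pos hp0 ht0
      have hH1 : H ≤ 1 := by linarith [etaInt_le_etaInt_half hp0 ht2, etaInt_half_le hp]
      set y := t ^ (-p - 1) with hy
      have hy0 : 0 < y := Real.rpow_pos_of_pos ht0 _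
      have hw1 : weight p θ u ≤ 2 * (p * y * H) := by
        rw [hw, smoothStep_of_le ht2, eta_eq_mul_etaInt hp0 ht0]
        exact mul_le_mul_of_nonneg_right hinv.2 (by positivity)
      have hr1 : |smoothStepDeriv p t / smoothStep p t| ≤ p * y := by
        rw [smoothStepDeriv, min_eq_left (by linarith), smoothStep_of_le ht2, etaDeriv,
          if_pos ht0, mul_div_cancel_left₀ _ (eta_pos ht0).ne']
        have h1 := add_one_le_mul_rpow_neg hp ht0 ht2
        have h2 : y = t⁻¹ * t ^ (-p) := by
          rw [hy, Real.rpow_sub ht0, Real.rpow_one]; field_simp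
        have h3 : 0 < t⁻¹ := inv_pos.2 ht0
        rw [abs_of_nonneg (mul_nonneg h3.le (by linarith)), h2]
        nlinarith
      have e1 : y ^ (1 + b) = t ^ (-((p + 1) * (1 + b))) := by
        rw [hy, ← Real.rpow_mul ht0.le]; ring_nf
      have e3 : H ≤ H ^ (1 / 2 : ℝ) := by
        nth_rewrite 1 [← Real.rpow_one H]
        exact Real.rpow_le_rpow_of_exponent_ge hH0 hH1 (by norm_num)
      calc weight p θ u * |smoothStepDeriv p t / smoothStep p t| ^ b
          ≤ 2 * (p * y * H) * (p * y) ^ b := by gcongr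
        _ = 2 * p ^ (1 + b) * (y ^ (1 + b) * H) := by
            rw [Real.mul_rpow hp0.le hy0.le, Real.rpow_add hp0, Real.rpow_add hy0, Real.rpow_one,
              Real.rpow_one]
            ring
        _ ≤ 2 * p ^ (1 + b) * (t ^ (-((p + 1) * (1 + b))) * H ^ (1 / 2 : ℝ)) := by
            rw [e1]; gcongr
        _ ≤ 2 * p ^ (1 + b) * C := by
            have := h t ht0
            gcongr
    · refine le_trans ?_ (le_max_right _ _)
      have hr1 : |smoothStepDeriv p t / smoothStep p t| ≤ 2 * D := by
        rw [abs_div, abs_of_pos hE, div_le_iff₀ hE]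
        have h1 := hDb (min t (1 - t))
        have h2 : |min t (1 - t)| ≤ 1 := by
          rw [min_eq_right (by linarith), abs_le]; constructor <;> linarith
        have h3 := half_le_smoothStep hp ht2.le
        have h4 : |smoothStepDeriv p t| ≤ D :=
          h1.trans (mul_le_of_le_one_right hD.le h2)
        nlinarith
      have hw2 := weight_le_two hp hθ hθ2 u
      have hw0 := weight_nonneg hp hθ hθ2 u
      rw [hK₂]
      gcongr
  calc weight p θ u * (|smoothStepDeriv p t / smoothStep p t| ^ b * θ⁻¹ ^ b)
      = weight p θ u * |smoothStepDeriv p t / smoothStep p t| ^ b * θ⁻¹ ^ b := by ring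
    _ ≤ max K₁ K₂ * max θ u ^ (-((1 + δ) * b)) := by
        have : 0 < max K₁ K₂ := lt_max_of_lt_left hK₁0
        gcongr

end Pointwise

end

end BDIS

namespace BDIS

noncomputable section

open Filter Topology
open scoped ENNReal

/-! ### One-dimensional integral bounds -/

section OneDim

variable {φ : ℝ → ℝ} {p : ℝ}

theorem continuous_max_rpow {θ : ℝ} (hθ : 0 < θ) (r : ℝ) :
    Continuous fun u : ℝ => max θ u ^ (-r) :=
  (continuous_const.max continuous_id).rpow_const fun u =>
    Or.inl (lt_max_of_lt_left (b := θ) (c := u) hθ).ne'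

theorem integral_max_rpow_le {θ r : ℝ} (hθ : 0 < θ) (hθ2 : θ ≤ 1 / 2) (hr : 1 < r) :
    ∫ u in (0 : ℝ)..1, max θ u ^ (-r) ≤ (1 + 1 / (r - 1)) * θ ^ (1 - r) := by
  have hi : ∀ a b : ℝ, IntervalIntegrable (fun u : ℝ => max θ u ^ (-r)) volume a b := fun a b =>
    (continuous_max_rpow hθ r).intervalIntegrable a b
  have hr1 : 0 < r - 1 := by linarith
  have h1 : ∫ u in (0 : ℝ)..θ, max θ u ^ (-r) = θ ^ (1 - r) := by
    have : ∫ u in (0 : ℝ)..θ, max θ u ^ (-r) = ∫ u in (0 : ℝ)..θ, θ ^ (-r) := by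
      refine intervalIntegral.integral_congr fun u hu => ?_
      rw [uIcc_of_le hθ.le] at hu
      simp only [max_eq_left hu.2]
    rw [this, intervalIntegral.integral_const, sub_zero, smul_eq_mul, sub_eq_add_neg,
      Real.rpow_add hθ, Real.rpow_one]
  have h2 : ∫ u in θ..1, max θ u ^ (-r) ≤ 1 / (r - 1) * θ ^ (1 - r) := by
    have : ∫ u in θ..1, max θ u ^ (-r) = ∫ u in θ..1, u ^ (-r) := by
      refine intervalIntegral.integral_congr fun u hu => ?_
      rw [uIcc_of_le (by linarith)] at hu
      simp only [max_eq_right hu.1]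
    rw [this, integral_rpow]
    · rw [Real.one_rpow]
      have e : -r + 1 = -(r - 1) := by ring
      have e' : 1 - r = -(r - 1) := by ring
      rw [e, e', div_neg, ← neg_div, neg_sub, sub_div, one_div, div_eq_inv_mul]
      have : 0 < (r - 1)⁻¹ := inv_pos.2 hr1
      linarith
    · right
      refine ⟨by linarith, fun h => ?_⟩
      rw [uIcc_of_le (by linarith)] at h
      linarith [h.1]
  rw [← intervalIntegral.integral_add_adjacent_intervals (hi 0 θ) (hi θ 1), h1]
  linarith

theorem lintegral_max_rpow_le {θ r K : ℝ} (hθ : 0 < θ) (hθ2 : θ ≤ 1 / 2) (hr : 1 < r)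
    (hK : 0 ≤ K) :
    ∫⁻ u in Ioo (0 : ℝ) 1, ENNReal.ofReal (K * (max θ u ^ (-r) + max θ (1 - u) ^ (-r))) ≤
      ENNReal.ofReal (K * (2 * (1 + 1 / (r - 1))) * θ ^ (1 - r)) := by
  have hc := continuous_max_rpow hθ r
  have hc' : Continuous fun u : ℝ => max θ (1 - u) ^ (-r) := hc.comp (by fun_prop)
  have hcc : Continuous fun u : ℝ => K * (max θ u ^ (-r) + max θ (1 - u) ^ (-r)) :=
    continuous_const.mul (hc.add hc')
  have hnn : ∀ u : ℝ, 0 ≤ K * (max θ u ^ (-r) + max θ (1 - u) ^ (-r)) := fun u => by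
    have h1 : 0 < max θ u := lt_max_of_lt_left hθ
    have h2 : 0 < max θ (1 - u) := lt_max_of_lt_left hθ
    positivity
  rw [setLIntegral_congr Ioo_ae_eq_Ioc, ← ofReal_integral_eq_lintegral_ofReal
    hcc.integrableOn_Ioc (Eventually.of_forall hnn)]
  refine ENNReal.ofReal_le_ofReal ?_
  rw [← intervalIntegral.integral_of_le zero_le_one, intervalIntegral.integral_const_mul,
    intervalIntegral.integral_add (hc.intervalIntegrable _ _) (hc'.intervalIntegrable _ _),
    intervalIntegral.integral_comp_sub_left (fun u => max θ u ^ (-r)), sub_self, sub_zero, mul_assoc]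
  have := integral_max_rpow_le hθ hθ2 hr
  refine mul_le_mul_of_nonneg_left ?_ hK
  linarith

/-- Adding the mirrored majorant covers both halves at once, so the integral need not be split at
`1/2`. -/
theorem le_add_of_symm_bound {G : ℝ → ℝ} (hG : ∀ u, G (1 - u) = G u) {θ r K : ℝ} (hθ : 0 < θ)
    (hK : 0 ≤ K) (h : ∀ u ∈ Ioc (0 : ℝ) (1 / 2), G u ≤ K * max θ u ^ (-r)) {u : ℝ}
    (hu : u ∈ Ioo (0 : ℝ) 1) : G u ≤ K * (max θ u ^ (-r) + max θ (1 - u) ^ (-r)) := by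
  have h1 : 0 < max θ u := lt_max_of_lt_left hθ
  have h2 : 0 < max θ (1 - u) := lt_max_of_lt_left hθ
  rw [mul_add]
  rcases le_or_gt u (1 / 2) with hle | hlt
  · have := h u ⟨hu.1, hle⟩
    have : 0 ≤ K * max θ (1 - u) ^ (-r) := by positivity
    linarith
  · have := h (1 - u) ⟨by linarith [hu.2], by linarith⟩
    rw [hG] at this
    have : 0 ≤ K * max θ u ^ (-r) := by positivity
    linarith

theorem lintegral_transportInv (hφ : IsLightTailedDensity φ) (hp : 1 ≤ p) {θ : ℝ} (hθ : 0 < θ)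
    (hθ2 : θ ≤ 1 / 2) (F : ℝ → ℝ≥0∞) :
    ∫⁻ x, F (transportInv φ p θ x) ∂(volume.withDensity fun x => ENNReal.ofReal (φ x)) =
      ∫⁻ u in Ioo (0 : ℝ) 1, ENNReal.ofReal (weight p θ u) * F u := by
  have hemb : MeasurableEmbedding (transportInv φ p θ) :=
    (continuous_transportInv hφ hp hθ hθ2).measurableEmbedding
      (strictMono_transportInv hφ hp hθ hθ2).injective
  rw [(measurePreserving_transportInv hφ hp hθ hθ2).lintegral_comp_emb hemb,
    lintegral_withDensity_eq_lintegral_mul_non_measurable]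
  · rfl
  · exact (continuous_weight (by linarith) hθ hθ2).measurable.ennreal_ofReal
  · exact Eventually.of_forall fun u => ENNReal.ofReal_lt_top

theorem cdf_transport (hφ : IsLightTailedDensity φ) (hp : 1 ≤ p) {θ : ℝ} (hθ : 0 < θ)
    (hθ2 : θ ≤ 1 / 2) {u : ℝ} (hu : u ∈ Ioo (0 : ℝ) 1) :
    cdf φ (transport φ p θ u) = weightInt p θ u := by
  have hp0 : 0 < p := by linarith
  rw [← range_transportInv hφ hp hθ hθ2] at hu
  obtain ⟨x, rfl⟩ := hu
  rw [transport_transportInv hφ hp0 hθ hθ2, weightInt_transportInv hφ hp0 hθ hθ2]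

theorem ofReal_mul_enorm_rpow {a c b : ℝ} (ha : 0 ≤ a) (hb : 0 ≤ b) :
    ENNReal.ofReal a * ‖c‖ₑ ^ b = ENNReal.ofReal (a * |c| ^ b) := by
  rw [ENNReal.ofReal_mul ha, Real.enorm_eq_ofReal_abs,
    ENNReal.ofReal_rpow_of_nonneg (abs_nonneg c) hb]

/-- On `(0,1)` the integrand is `w (w / φ(T))^b`. Since `Φ(T) = W`, the symmetrised tail condition
replaces `φ(T)` by a power of `W (1 - W)`, and the pointwise bound for the weight applies. -/
theorem exists_lintegral_weight_div_density_le (hφ : IsLightTailedDensity φ) (hp : 1 ≤ p)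
    {b δ : ℝ} (hb : 1 < b) (hδ : 0 < δ) (hδb : δ * b ≤ 1 / 2) :
    ∃ K : ℝ, 0 < K ∧ ∀ θ, 0 < θ → θ ≤ 1 / 2 →
      ∫⁻ x, ‖weight p θ (transportInv φ p θ x) / φ x‖ₑ ^ b
          ∂(volume.withDensity fun x => ENNReal.ofReal (φ x)) ≤
        ENNReal.ofReal (K * θ ^ (1 - (1 + δ) * b)) := by
  have hp0 : 0 < p := by linarith
  obtain ⟨c, hc, htail⟩ := exists_mul_rpow_le_density hφ hδ
  obtain ⟨K, hK, h⟩ := mul_weightInt_rpow_bound hp hb hδ hδb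
  have hr : 1 < (1 + δ) * b := by nlinarith
  have hr1 : 0 < (1 + δ) * b - 1 := by linarith
  set K' : ℝ := (c⁻¹ * 2 ^ (1 + δ)) ^ b * K with hK'
  have hK'0 : 0 < K' := by positivity
  refine ⟨K' * (2 * (1 + 1 / ((1 + δ) * b - 1))), by positivity, fun θ hθ hθ2 => ?_⟩
  refine le_trans ?_ (lintegral_max_rpow_le hθ hθ2 hr hK'0.le)
  have e1 : ∫⁻ x, ‖weight p θ (transportInv φ p θ x) / φ x‖ₑ ^ b
          ∂(volume.withDensity fun x => ENNReal.ofReal (φ x)) =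
      ∫⁻ u in Ioo (0 : ℝ) 1, ENNReal.ofReal (weight p θ u) *
        ‖weight p θ u / φ (transport φ p θ u)‖ₑ ^ b := by
    rw [← lintegral_transportInv hφ hp hθ hθ2
      fun u => ‖weight p θ u / φ (transport φ p θ u)‖ₑ ^ b]
    simp only [transport_transportInv hφ hp0 hθ hθ2]
  rw [e1]
  refine setLIntegral_mono' measurableSet_Ioo fun u hu => ?_
  have hw0 := weight_nonneg hp hθ hθ2 u
  rw [ofReal_mul_enorm_rpow hw0 (by linarith)]
  refine ENNReal.ofReal_le_ofReal ?_
  set V : ℝ → ℝ := fun u => weightInt p θ u * (1 - weightInt p θ u) with hV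
  -- This majorant is exactly symmetric, so it only has to be estimated on the left half, where `1 -
  -- W ≥ 1/2`.
  set G : ℝ → ℝ := fun u => weight p θ u * (c⁻¹ * (weight p θ u * V u ^ (-(1 + δ)))) ^ b with hG
  have hGsymm : ∀ u, G (1 - u) = G u := fun u => by
    simp only [hG, hV, weight_one_sub hθ hθ2, weightInt_one_sub hp0 hθ hθ2, sub_sub_cancel]
    rw [mul_comm (1 - weightInt p θ u)]
  have hVpos : ∀ u ∈ Ioo (0 : ℝ) 1, 0 < V u := fun u hu => by
    have := weightInt_mem_Ioo hp hθ hθ2 hu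
    exact mul_pos this.1 (by linarith [this.2])
  have hGle : ∀ u ∈ Ioc (0 : ℝ) (1 / 2), G u ≤ K' * max θ u ^ (-((1 + δ) * b)) := by
    intro u hu
    have hu' : u ∈ Ioo (0 : ℝ) 1 := ⟨hu.1, by linarith [hu.2]⟩
    have hW := weightInt_mem_Ioo hp hθ hθ2 hu'
    have hW2 := weightInt_le_half hp hθ hθ2 hu
    have hw0 := weight_nonneg hp hθ hθ2 u
    have hW0 := hW.1
    have hVle : V u ^ (-(1 + δ)) ≤ 2 ^ (1 + δ) * weightInt p θ u ^ (-(1 + δ)) := by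
      calc V u ^ (-(1 + δ)) ≤ (weightInt p θ u / 2) ^ (-(1 + δ)) := by
            refine Real.rpow_le_rpow_of_nonpos (by positivity) ?_ (by linarith)
            simp only [hV]
            nlinarith
        _ = _ := by
            rw [Real.div_rpow hW0.le (by norm_num), Real.rpow_neg (by norm_num : (0 : ℝ) ≤ 2),
              div_inv_eq_mul, mul_comm]
    have hV0 := hVpos u hu'
    calc G u ≤ weight p θ u *
          (c⁻¹ * (weight p θ u * (2 ^ (1 + δ) * weightInt p θ u ^ (-(1 + δ))))) ^ b := by
          simp only [hG]
          gcongr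
      _ = weight p θ u * ((c⁻¹ * 2 ^ (1 + δ)) *
            (weight p θ u * weightInt p θ u ^ (-(1 + δ)))) ^ b := by ring_nf
      _ = (c⁻¹ * 2 ^ (1 + δ)) ^ b *
            (weight p θ u * (weight p θ u * weightInt p θ u ^ (-(1 + δ))) ^ b) := by
          rw [Real.mul_rpow (by positivity) (by positivity)]; ring
      _ ≤ (c⁻¹ * 2 ^ (1 + δ)) ^ b * (K * max θ u ^ (-((1 + δ) * b))) := by
          have := h θ hθ hθ2 u hu
          gcongr
      _ = _ := by rw [hK']; ring
  refine le_trans ?_ (le_add_of_symm_bound hGsymm hθ hK'0.le hGle hu)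
  have hφpos := hφ.pos (transport φ p θ u)
  have hV0 := hVpos u hu
  have hdens : c * V u ^ (1 + δ) ≤ φ (transport φ p θ u) := by
    have := htail (transport φ p θ u)
    rwa [cdf_transport hφ hp hθ hθ2 hu] at this
  have hratio : |weight p θ u / φ (transport φ p θ u)| ≤
      c⁻¹ * (weight p θ u * V u ^ (-(1 + δ))) := by
    rw [abs_of_nonneg (by positivity), Real.rpow_neg hV0.le, div_eq_mul_inv, mul_left_comm,
      ← mul_inv]
    gcongr
  simp only [hG]
  gcongr

theorem exists_lintegral_weightDeriv_div_le (hφ : IsLightTailedDensity φ) (hp : 1 ≤ p)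
    {b δ : ℝ} (hb : 1 < b) (hδ : 0 < δ) :
    ∃ K : ℝ, 0 < K ∧ ∀ θ, 0 < θ → θ ≤ 1 / 2 →
      ∫⁻ x, ‖weightDeriv p θ (transportInv φ p θ x) / weight p θ (transportInv φ p θ x)‖ₑ ^ b
          ∂(volume.withDensity fun x => ENNReal.ofReal (φ x)) ≤
        ENNReal.ofReal (K * θ ^ (1 - (1 + δ) * b)) := by
  obtain ⟨K, hK, h⟩ := weightDeriv_bound hp hb hδ
  have hr : 1 < (1 + δ) * b := by nlinarith
  have hr1 : 0 < (1 + δ) * b - 1 := by linarith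
  refine ⟨K * (2 * (1 + 1 / ((1 + δ) * b - 1))), by positivity, fun θ hθ hθ2 => ?_⟩
  refine le_trans ?_ (lintegral_max_rpow_le hθ hθ2 hr hK.le)
  rw [lintegral_transportInv hφ hp hθ hθ2
      fun u => ‖weightDeriv p θ u / weight p θ u‖ₑ ^ b]
  refine setLIntegral_mono' measurableSet_Ioo fun u hu => ?_
  rw [ofReal_mul_enorm_rpow (weight_nonneg hp hθ hθ2 u) (by linarith)]
  refine ENNReal.ofReal_le_ofReal (le_add_of_symm_bound
    (G := fun u => weight p θ u * |weightDeriv p θ u / weight p θ u| ^ b)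
    (fun u => ?_) hθ hK.le (h θ hθ hθ2) hu)
  simp only [weight_one_sub hθ hθ2, weightDeriv_one_sub, neg_div, abs_neg]

theorem withDensity_density_univ (hφ : IsLightTailedDensity φ) :
    (volume.withDensity fun x => ENNReal.ofReal (φ x)) univ = 1 := by
  rw [withDensity_apply _ MeasurableSet.univ, Measure.restrict_univ,
    ← ofReal_integral_eq_lintegral_ofReal hφ.integrable
      (Eventually.of_forall fun x => (hφ.pos x).le), hφ.integral_eq_one, ENNReal.ofReal_one]

/-- The `L^b(φ)` norms of the three possible coordinate factors are `O(θ^{-(1-1/b)-ε})`. -/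
theorem exists_lintegral_factor_le (hφ : IsLightTailedDensity φ) (hp : 1 ≤ p)
    {q b ε : ℝ} (hqb : q.HolderConjugate b) (hε : 0 < ε) :
    ∃ K : ℝ, 0 < K ∧ ∀ θ, 0 < θ → θ ≤ 1 / 2 → ∀ ρ : ℝ → ℝ,
      (ρ = (fun x => weight p θ (transportInv φ p θ x) / φ x) ∨
        ρ = (fun x => weightDeriv p θ (transportInv φ p θ x) / weight p θ (transportInv φ p θ x)) ∨
        ρ = fun _ => 1) →
      (∫⁻ x, ‖ρ x‖ₑ ^ b ∂(volume.withDensity fun x => ENNReal.ofReal (φ x))) ^ (1 / b) ≤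
        ENNReal.ofReal (K * θ ^ (-1 / q - ε)) := by
  have hb : 1 < b := hqb.symm.lt
  have hb0 : 0 < b := by linarith
  -- `δ ≤ ε` yields the final exponent; `δ ≤ 1/(2b)` keeps half of the decay of `H`.
  set δ := min ε (1 / (2 * b)) with hδdef
  have hδ : 0 < δ := lt_min hε (by positivity)
  have hδb : δ * b ≤ 1 / 2 := by
    have : δ ≤ 1 / (2 * b) := min_le_right _ _
    calc δ * b ≤ 1 / (2 * b) * b := mul_le_mul_of_nonneg_right this hb0.le
      _ = 1 / 2 := by field_simp
  obtain ⟨K₁, hK₁, h₁⟩ := exists_lintegral_weight_div_density_le hφ hp hb hδ hδb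
  obtain ⟨K₂, hK₂, h₂⟩ := exists_lintegral_weightDeriv_div_le hφ hp hb hδ
  set K := max (max K₁ K₂) 1 with hK
  have hK1 : 1 ≤ K := le_max_right _ _
  have hK0 : 0 < K := by linarith
  refine ⟨K ^ (1 / b), by positivity, fun θ hθ hθ2 ρ hρ => ?_⟩
  have hr : 1 < (1 + δ) * b := by nlinarith
  have hmain : ∫⁻ x, ‖ρ x‖ₑ ^ b ∂(volume.withDensity fun x => ENNReal.ofReal (φ x)) ≤
      ENNReal.ofReal (K * θ ^ (1 - (1 + δ) * b)) := by
    rcases hρ with rfl | rfl | rfl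
    · refine (h₁ θ hθ hθ2).trans (ENNReal.ofReal_le_ofReal ?_)
      gcongr
      exact (le_max_left _ _).trans (le_max_left _ _)
    · refine (h₂ θ hθ hθ2).trans (ENNReal.ofReal_le_ofReal ?_)
      gcongr
      exact (le_max_right _ _).trans (le_max_left _ _)
    · simp only [enorm_one, ENNReal.one_rpow, lintegral_one, withDensity_density_univ hφ]
      rw [← ENNReal.ofReal_one]
      refine ENNReal.ofReal_le_ofReal ?_
      have : 1 ≤ θ ^ (1 - (1 + δ) * b) :=
        Real.one_le_rpow_of_pos_of_le_one_of_nonpos hθ (by linarith) (by linarith)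
      nlinarith
  refine (ENNReal.rpow_le_rpow hmain (by positivity)).trans ?_
  rw [ENNReal.ofReal_rpow_of_nonneg (by positivity) (by positivity)]
  refine ENNReal.ofReal_le_ofReal ?_
  rw [Real.mul_rpow hK0.le (by positivity), ← Real.rpow_mul hθ.le]
  refine mul_le_mul_of_nonneg_left ?_ (by positivity)
  refine Real.rpow_le_rpow_of_exponent_ge hθ (by linarith) ?_
  -- By conjugacy this exponent is `-1/q - δ`, and `θ ≤ 1` allows `δ` to be enlarged to `ε`.
  have h1 : (1 - (1 + δ) * b) * (1 / b) = b⁻¹ - 1 - δ := by field_simp; ring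
  have h2 : q⁻¹ + b⁻¹ = 1 := hqb.inv_add_inv_eq_one
  have h3 : δ ≤ ε := min_le_left _ _
  have h4 : -1 / q = -q⁻¹ := by rw [neg_div, one_div]
  rw [h1, h4]
  linarith

end OneDim

end

end BDIS

namespace BDIS

noncomputable section

open Filter Topology
open scoped ENNReal

/-! ### Integrability of the expansion terms -/

section Hoelder

variable {s : ℕ} {φ : ℝ → ℝ} {w dw S T : Fin s → ℝ → ℝ}

theorem measurable_expansionFactor_comp (hm : Measurable φ)
    (h : ∀ j, IsTransport φ (w j) (dw j) (S j) (T j)) (A B : Finset (Fin s)) (j : Fin s) :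
    Measurable fun x => expansionFactor φ w dw T A B j (S j x) := by
  have h1 : Measurable fun x => w j (S j x) :=
    (h j).continuous_weight.measurable.comp (h j).continuous.measurable
  have h2 : Measurable fun x => dw j (S j x) :=
    (h j).continuous_deriv.measurable.comp (h j).continuous.measurable
  simp only [expansionFactor, (h j).left_inv]
  split_ifs
  · exact h1.mul (h1.div hm)
  · exact h2
  · exact h1

theorem densityMeasure_absolutelyContinuous (s : ℕ) (φ : ℝ → ℝ) :
    densityMeasure s φ ≪ volume :=
  withDensity_absolutelyContinuous _ _

/-- Measurability is checked after composition with `S`, where `T` disappears, and transferred back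
through the embedding. Positivity of the weights on the cube then allows passing from the weighted
measure to Lebesgue measure. -/
theorem aestronglyMeasurable_expansionTerm (hφ : ∀ x, 0 < φ x) (hm : Measurable φ)
    (h : ∀ j, IsTransport φ (w j) (dw j) (S j) (T j))
    {g : Finset (Fin s) → (Fin s → ℝ) → ℝ} {A : Finset (Fin s)} (B : Finset (Fin s))
    (hg : AEStronglyMeasurable (g A)) :
    AEStronglyMeasurable (expansionTerm φ w dw T g A B) (volume.restrict (cube s)) := by
  have h1 : AEStronglyMeasurable (fun x : Fin s → ℝ =>
      (∏ j, expansionFactor φ w dw T A B j (S j (x j))) * g A x) (densityMeasure s φ) := by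
    refine AEStronglyMeasurable.mul ?_
      (hg.mono_ac (densityMeasure_absolutelyContinuous s φ))
    exact (Finset.measurable_prod _ fun j _ =>
      (measurable_expansionFactor_comp hm h A B j).comp
        (measurable_pi_apply j)).aestronglyMeasurable
  have e : (fun x : Fin s → ℝ => (∏ j, expansionFactor φ w dw T A B j (S j (x j))) * g A x) =
      expansionTerm φ w dw T g A B ∘ coordMap S := by
    ext x
    simp only [Function.comp, expansionTerm, coordMap, (h _).left_inv]
  have hmp := measurePreserving_coordMap hφ hm h
  rw [e, ← (measurableEmbedding_coordMap h).aestronglyMeasurable_map_iff, hmp.map_eq] at h1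
  refine h1.mono_ac (withDensity_absolutelyContinuous' ?_ ?_)
  · exact (Finset.measurable_prod _ fun j _ => ((h j).continuous_weight.measurable.comp
      (measurable_pi_apply j)).ennreal_ofReal).aemeasurable
  · refine (ae_restrict_iff' (measurableSet_cube s)).2 (Eventually.of_forall fun u hu => ?_)
    refine Finset.prod_ne_zero_iff.2 fun j _ => ?_
    exact (ENNReal.ofReal_pos.2 ((h j).weight_pos _ (hu j trivial))).ne'

/-- Hölder's inequality for an expansion term. -/
theorem lintegral_expansionTerm_le (hφ : ∀ x, 0 < φ x) (hm : Measurable φ)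
    (h : ∀ j, IsTransport φ (w j) (dw j) (S j) (T j)) {q b : ℝ} (hqb : q.HolderConjugate b)
    {g : Finset (Fin s) → (Fin s → ℝ) → ℝ} {A : Finset (Fin s)} (B : Finset (Fin s))
    (hg : AEStronglyMeasurable (g A)) :
    ∫⁻ u in cube s, ‖expansionTerm φ w dw T g A B u‖ₑ ≤
      (∫⁻ x, ‖g A x‖ₑ ^ q ∂densityMeasure s φ) ^ (1 / q) *
        ∏ j, (∫⁻ x, ‖expansionFactor φ w dw T A B j (S j x) / w j (S j x)‖ₑ ^ b
          ∂(volume.withDensity fun x => ENNReal.ofReal (φ x))) ^ (1 / b) := by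
  have hb0 : 0 < b := hqb.symm.pos
  set ρ : Fin s → ℝ → ℝ := fun j x => expansionFactor φ w dw T A B j (S j x) / w j (S j x) with hρ
  have hρm : ∀ j, Measurable (ρ j) := fun j =>
    (measurable_expansionFactor_comp hm h A B j).div
      ((h j).continuous_weight.measurable.comp (h j).continuous.measurable)
  have e1 : ∀ u ∈ cube s, ‖expansionTerm φ w dw T g A B u‖ₑ =
      (∏ j, ENNReal.ofReal (w j (u j))) *
        ‖(∏ j, expansionFactor φ w dw T A B j (u j) / w j (u j)) *
          g A (fun j => T j (u j))‖ₑ := by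
    intro u hu
    have hpos : ∀ j, 0 < w j (u j) := fun j => (h j).weight_pos _ (hu j trivial)
    have e : ∏ j, ENNReal.ofReal (w j (u j)) = ‖∏ j, w j (u j)‖ₑ := by
      rw [← ENNReal.ofReal_prod_of_nonneg fun j _ => (hpos j).le, Real.enorm_eq_ofReal_abs,
        abs_of_nonneg (Finset.prod_nonneg fun j _ => (hpos j).le)]
    rw [e, ← enorm_mul, Finset.prod_div_distrib, expansionTerm]
    have : ∏ j, w j (u j) ≠ 0 := Finset.prod_ne_zero_iff.2 fun j _ => (hpos j).ne'
    congr 1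
    field_simp
  rw [setLIntegral_congr_fun (measurableSet_cube s) e1, lintegral_cube_eq hφ hm h]
  have e2 : ∀ x : Fin s → ℝ, ‖(∏ j, expansionFactor φ w dw T A B j (coordMap S x j) /
      w j (coordMap S x j)) * g A (fun j => T j (coordMap S x j))‖ₑ =
      ((fun x => ‖g A x‖ₑ) * fun x : Fin s → ℝ => ‖∏ j, ρ j (x j)‖ₑ) x := by
    intro x
    simp only [coordMap, (h _).left_inv, Pi.mul_apply, hρ]
    rw [enorm_mul, mul_comm]
  simp only [e2]
  have hPm : Measurable fun x : Fin s → ℝ => ∏ j, ρ j (x j) :=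
    Finset.measurable_prod _ fun j _ => (hρm j).comp (measurable_pi_apply j)
  refine (ENNReal.lintegral_mul_le_Lp_mul_Lq _ hqb
    (hg.mono_ac (densityMeasure_absolutelyContinuous s φ)).enorm hPm.enorm.aemeasurable).trans ?_
  refine mul_le_mul_right (le_of_eq ?_) _
  have e3 : ∀ x : Fin s → ℝ, ‖∏ j, ρ j (x j)‖ₑ ^ b = ∏ j, ‖ρ j (x j)‖ₑ ^ b := by
    intro x
    rw [ENNReal.prod_rpow_of_nonneg hb0.le]
    congr 1
    simp only [enorm_eq_nnnorm, nnnorm_prod, ENNReal.ofNNReal_finsetProd]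
  simp only [e3]
  rw [densityMeasure_eq_pi s hφ hm, lintegral_pi_prod _ (fun j x => ‖ρ j x‖ₑ ^ b)
    fun j => (hρm j).enorm.pow_const b, ENNReal.prod_rpow_of_nonneg (by positivity)]

end Hoelder

/-! ### Weak derivatives and norm of the transformed integrand -/

section Main

variable {s : ℕ} {φ : ℝ → ℝ} {p : ℝ} {θ : Fin s → ℝ}

theorem lintegral_enorm_rpow_eq_lqNorm {q : ℝ} (hq : 0 < q) {μ : Measure (Fin s → ℝ)}
    {g : (Fin s → ℝ) → ℝ} (hg : MemLp g (ENNReal.ofReal q) μ) :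
    (∫⁻ x, ‖g x‖ₑ ^ q ∂μ) ^ (1 / q) = ENNReal.ofReal (lqNorm q μ g) := by
  have hi : Integrable (fun x => |g x| ^ q) μ := by
    have := hg.integrable_norm_rpow (by simpa using hq) ENNReal.ofReal_ne_top
    simpa [ENNReal.toReal_ofReal hq.le] using this
  have hnn : ∀ x, 0 ≤ |g x| ^ q := fun x => by positivity
  rw [lqNorm, ← ENNReal.ofReal_rpow_of_nonneg (integral_nonneg hnn) (by positivity),
    ofReal_integral_eq_lintegral_ofReal hi (Eventually.of_forall hnn)]
  congr 2
  ext x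
  rw [Real.enorm_eq_ofReal_abs, ENNReal.ofReal_rpow_of_nonneg (abs_nonneg _) hq.le]

theorem lqNorm_le_wMixNorm {q : ℝ} (hq : 0 < q) (Ω : Set (Fin s → ℝ)) (μ : Measure (Fin s → ℝ))
    (f : (Fin s → ℝ) → ℝ) (v : Finset (Fin s)) :
    lqNorm q μ (weakMixedDeriv Ω v f) ≤ wMixNorm Ω q μ f := by
  have hnn : ∀ v, 0 ≤ lqNorm q μ (weakMixedDeriv Ω v f) := fun v =>
    Real.rpow_nonneg (integral_nonneg fun x => by positivity) _
  have h1 : lqNorm q μ (weakMixedDeriv Ω v f) ^ q ≤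
      ∑ v, lqNorm q μ (weakMixedDeriv Ω v f) ^ q :=
    Finset.single_le_sum (f := fun v => lqNorm q μ (weakMixedDeriv Ω v f) ^ q)
      (fun v _ => Real.rpow_nonneg (hnn v) _) (Finset.mem_univ v)
  calc lqNorm q μ (weakMixedDeriv Ω v f)
      = (lqNorm q μ (weakMixedDeriv Ω v f) ^ q) ^ (1 / q) := by
        rw [← Real.rpow_mul (hnn v), mul_one_div_cancel hq.ne', Real.rpow_one]
    _ ≤ _ := Real.rpow_le_rpow (Real.rpow_nonneg (hnn v) _) h1 (by positivity)

theorem isWeakMixedDeriv_weakMixedDeriv {Ω : Set (Fin s → ℝ)} {v : Finset (Fin s)}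
    {f : (Fin s → ℝ) → ℝ} (h : ∃ g, IsWeakMixedDeriv Ω v f g) :
    IsWeakMixedDeriv Ω v f (weakMixedDeriv Ω v f) := by
  rw [weakMixedDeriv, dif_pos h]
  exact h.choose_spec

theorem isWeakMixedDeriv_empty {Ω : Set (Fin s → ℝ)} {f : (Fin s → ℝ) → ℝ}
    (hf : LocallyIntegrableOn f Ω) : IsWeakMixedDeriv Ω ∅ f f :=
  ⟨hf, hf, fun ψ _ _ _ => by simp [mixedPartial_empty]⟩

/-- A family of weak mixed derivatives of `f` whose member for `∅` is `f` itself. -/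
def weakMixedDerivFamily (f : (Fin s → ℝ) → ℝ) (A : Finset (Fin s)) : (Fin s → ℝ) → ℝ :=
  if A = ∅ then f else weakMixedDeriv univ A f

theorem isWeakMixedDeriv_family {f : (Fin s → ℝ) → ℝ}
    (h : ∀ A, ∃ g, IsWeakMixedDeriv univ A f g) (A : Finset (Fin s)) :
    IsWeakMixedDeriv univ A f (weakMixedDerivFamily f A) := by
  unfold weakMixedDerivFamily
  split_ifs with hA
  · subst hA
    exact isWeakMixedDeriv_empty (h ∅).choose_spec.locallyIntegrableOn_fun
  · exact isWeakMixedDeriv_weakMixedDeriv (h A)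

theorem lintegral_family_eq {q : ℝ} (hq : 0 < q) {f : (Fin s → ℝ) → ℝ}
    (hf : MemWMixDensity q φ f) (A : Finset (Fin s)) :
    (∫⁻ x, ‖weakMixedDerivFamily f A x‖ₑ ^ q ∂densityMeasure s φ) ^ (1 / q) =
      ENNReal.ofReal (lqNorm q (densityMeasure s φ) (weakMixedDeriv univ A f)) := by
  rw [← lintegral_enorm_rpow_eq_lqNorm hq (hf A).2]
  congr 1
  have h1 := (isWeakMixedDeriv_family (fun A => (hf A).1) A).ae_eq isOpen_univ
    (isWeakMixedDeriv_weakMixedDeriv (hf A).1)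
  rw [Measure.restrict_univ] at h1
  refine lintegral_congr_ae ?_
  filter_upwards [(densityMeasure_absolutelyContinuous s φ).ae_le h1] with x hx
  rw [hx]

/-- The term of the expansion of `∂^v f^w` in which the derivatives in `A` fall on `f` and those
in `B` on the weights. -/
def transformedTerm (φ : ℝ → ℝ) (p : ℝ) (θ : Fin s → ℝ) (f : (Fin s → ℝ) → ℝ)
    (A B : Finset (Fin s)) : (Fin s → ℝ) → ℝ :=
  expansionTerm φ (fun j => weight p (θ j)) (fun j => weightDeriv p (θ j))
    (fun j => transport φ p (θ j)) (weakMixedDerivFamily f) A B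

/-- The equality is pointwise because the family takes the value `f` at `∅`; the chosen
representative of `∂^∅ f` agrees with `f` only almost everywhere. -/
theorem transformed_eq_transformedTerm (φ : ℝ → ℝ) (p : ℝ) (θ : Fin s → ℝ)
    (f : (Fin s → ℝ) → ℝ) : transformed φ p θ f = transformedTerm φ p θ f ∅ ∅ := by
  ext u
  simp [transformed, transformedTerm, expansionTerm, expansionFactor, weakMixedDerivFamily]

theorem isTransport_family (hφ : IsLightTailedDensity φ) (hp : 1 ≤ p)
    (hθ : ∀ j, 0 < θ j ∧ θ j ≤ 1 / 2) (j : Fin s) :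
    IsTransport φ (weight p (θ j)) (weightDeriv p (θ j)) (transportInv φ p (θ j))
      (transport φ p (θ j)) :=
  isTransport_transport hφ hp (hθ j).1 (hθ j).2

theorem aestronglyMeasurable_family {f : (Fin s → ℝ) → ℝ}
    (h : ∀ A, ∃ g, IsWeakMixedDeriv univ A f g) (A : Finset (Fin s)) :
    AEStronglyMeasurable (weakMixedDerivFamily f A) :=
  (locallyIntegrableOn_univ.1
    (isWeakMixedDeriv_family h A).locallyIntegrableOn_deriv).aestronglyMeasurable

/-- Hölder reduces the claim to coordinate factors, each of one of the three types bounded above.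
The constant per coordinate is fixed before `s`, `f` and `θ`. -/
theorem exists_lintegral_transformedTerm_le (hφ : IsLightTailedDensity φ) (hp : 1 ≤ p)
    {q ε : ℝ} (hq : 1 < q) (hε : 0 < ε) :
    ∃ K : ℝ, 0 < K ∧ ∀ (s : ℕ) (f : (Fin s → ℝ) → ℝ) (θ : Fin s → ℝ), MemWMixDensity q φ f →
      (∀ j, 0 < θ j ∧ θ j ≤ 1 / 2) → ∀ A B : Finset (Fin s),
      ∫⁻ u in cube s, ‖transformedTerm φ p θ f A B u‖ₑ ≤
        ENNReal.ofReal (wMixNormDensity q φ f * ∏ j, (K * θ j ^ (-1 / q - ε))) := by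
  have hqb := Real.HolderConjugate.conjExponent hq
  obtain ⟨K, hK, h⟩ := exists_lintegral_factor_le hφ hp hqb hε
  refine ⟨K, hK, fun s f θ hf hθ A B => ?_⟩
  have hq0 : 0 < q := by linarith
  have hfac0 : ∀ j, 0 ≤ K * θ j ^ (-1 / q - ε) := fun j => by
    have := (hθ j).1
    positivity
  refine (lintegral_expansionTerm_le hφ.pos hφ.measurable (isTransport_family hφ hp hθ) hqb B
    (aestronglyMeasurable_family (fun A => (hf A).1) A)).trans ?_
  rw [lintegral_family_eq hq0 hf, ENNReal.ofReal_mul' (Finset.prod_nonneg fun j _ => hfac0 j),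
    ENNReal.ofReal_prod_of_nonneg fun j _ => hfac0 j]
  refine mul_le_mul' (ENNReal.ofReal_le_ofReal (lqNorm_le_wMixNorm hq0 _ _ _ _)) ?_
  refine Finset.prod_le_prod' fun j _ => h (θ j) (hθ j).1 (hθ j).2 _ ?_
  have hw : ∀ x, weight p (θ j) (transportInv φ p (θ j) x) ≠ 0 := fun x =>
    (weight_pos hp (hθ j).1 (hθ j).2
      (transportInv_mem hφ (by linarith) (hθ j).1 (hθ j).2 x)).ne'
  have hT := transport_transportInv hφ (show 0 < p by linarith) (hθ j).1 (hθ j).2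
  by_cases hA : j ∈ A
  · left
    ext x
    simp only [expansionFactor, hA, if_true, hT]
    rw [mul_div_assoc, mul_comm, div_mul_cancel₀ _ (hw x)]
  by_cases hB : j ∈ B
  · right; left
    ext x
    simp only [expansionFactor, hA, hB, if_true, if_false]
  · right; right
    ext x
    simp only [expansionFactor, hA, hB, if_false]
    exact div_self (hw x)

theorem isWeakMixedDeriv_transformed (hφ : IsLightTailedDensity φ) (hp : 1 ≤ p)
    (hθ : ∀ j, 0 < θ j ∧ θ j ≤ 1 / 2) {f : (Fin s → ℝ) → ℝ}
    (hf : ∀ A, ∃ g, IsWeakMixedDeriv univ A f g)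
    (hint : ∀ A B, IntegrableOn (transformedTerm φ p θ f A B) (cube s))
    (v : Finset (Fin s)) :
    IsWeakMixedDeriv (cube s) v (transformed φ p θ f)
      (fun u => ∑ t ∈ v.powerset, transformedTerm φ p θ f t (v \ t) u) where
  locallyIntegrableOn_fun := by
    rw [transformed_eq_transformedTerm]
    exact (hint _ _).locallyIntegrableOn
  locallyIntegrableOn_deriv :=
    IntegrableOn.locallyIntegrableOn (integrable_finsetSum _ fun t _ => hint t (v \ t))
  integral_eq := by
    intro ψ hψ hc hs
    rw [transformed_eq_transformedTerm]
    have h := integral_expansionTerm_mul_mixedPartial hφ.pos hφ.measurable hφ.bounded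
      (isTransport_family hφ hp hθ) (isWeakMixedDeriv_family hf) hψ hc hs v ∅ ∅
      (Finset.disjoint_empty_right _) (Finset.disjoint_empty_right _)
    simp only [Finset.empty_union] at h
    refine h.trans ?_
    congr 1
    obtain ⟨C, hC⟩ := hc.exists_bound_of_continuous hψ.continuous
    simp only [Finset.sum_mul]
    rw [integral_finsetSum]
    · rfl
    · exact fun t _ => (hint t (v \ t)).mul_bdd hψ.continuous.aestronglyMeasurable
        (Eventually.of_forall hC)

end Main

end

end BDIS

/-! ### Summation over all terms -/

theorem mainTheorem5 (φ : ℝ → ℝ) (hφ : BDIS.IsLightTailedDensity φ)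
    (p : ℝ) (hp : 1 ≤ p) (q : ℝ) (hq : 1 < q) (ε : ℝ) (hε : 0 < ε) :
    ∃ C : ℝ, 0 < C ∧
      ∀ (s : ℕ) (f : (Fin s → ℝ) → ℝ) (θ : Fin s → ℝ),
        BDIS.MemWMixDensity q φ f →
        (∀ j, 0 < θ j ∧ θ j ≤ 1 / 2) →
        BDIS.MemWMixCube 1 (BDIS.transformed φ p θ f) ∧
          BDIS.wMixNormCube 1 (BDIS.transformed φ p θ f) ≤
            BDIS.wMixNormDensity q φ f * ∏ j, (C * θ j ^ (-1 / q - ε)) := by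
  obtain ⟨K, hK, h⟩ := BDIS.exists_lintegral_transformedTerm_le hφ hp hq hε
  -- One factor `2` per coordinate counts the sets `v`, another bounds the number of splittings of
  -- `v`.
  refine ⟨4 * K, by positivity, fun s f θ hf hθ => ?_⟩
  have hfex := fun A => (hf A).1
  set R : ℝ := BDIS.wMixNormDensity q φ f * ∏ j, (K * θ j ^ (-1 / q - ε)) with hR
  have hN : 0 ≤ BDIS.wMixNormDensity q φ f := by
    refine Real.rpow_nonneg (Finset.sum_nonneg fun v _ => Real.rpow_nonneg ?_ _) _
    exact Real.rpow_nonneg (integral_nonneg fun x => by positivity) _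
  have hR0 : 0 ≤ R := mul_nonneg hN (Finset.prod_nonneg fun j _ => by
    have := (hθ j).1
    positivity)
  have hint : ∀ A B, IntegrableOn (BDIS.transformedTerm φ p θ f A B) (BDIS.cube s) := fun A B =>
    ⟨BDIS.aestronglyMeasurable_expansionTerm hφ.pos hφ.measurable
      (BDIS.isTransport_family hφ hp hθ) B (BDIS.aestronglyMeasurable_family hfex A),
      (h s f θ hf hθ A B).trans_lt ENNReal.ofReal_lt_top⟩
  have hbound : ∀ A B, ∫ u in BDIS.cube s, |BDIS.transformedTerm φ p θ f A B u| ≤ R := by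
    intro A B
    refine (ENNReal.ofReal_le_ofReal_iff hR0).1 ?_
    exact (ofReal_integral_norm_eq_lintegral_enorm (hint A B)).trans_le (h s f θ hf hθ A B)
  have hweak := BDIS.isWeakMixedDeriv_transformed hφ hp hθ hfex hint
  -- The norm refers to a chosen representative; by uniqueness it may be replaced by the explicit
  -- expansion.
  have hae : ∀ v, BDIS.weakMixedDeriv (BDIS.cube s) v (BDIS.transformed φ p θ f)
      =ᵐ[volume.restrict (BDIS.cube s)]
        fun u => ∑ t ∈ v.powerset, BDIS.transformedTerm φ p θ f t (v \ t) u := fun v =>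
    (BDIS.isWeakMixedDeriv_weakMixedDeriv ⟨_, hweak v⟩).ae_eq (BDIS.isOpen_cube s) (hweak v)
  have hsum : ∀ v : Finset (Fin s), Integrable (fun u => ∑ t ∈ v.powerset,
      BDIS.transformedTerm φ p θ f t (v \ t) u) (volume.restrict (BDIS.cube s)) := fun v =>
    integrable_finsetSum _ fun t _ => hint t (v \ t)
  constructor
  · intro v
    refine ⟨⟨_, hweak v⟩, ?_⟩
    rw [ENNReal.ofReal_one, memLp_one_iff_integrable]
    exact (hsum v).congr (hae v).symm
  have hnorm : ∀ v, BDIS.lqNorm 1 (volume.restrict (BDIS.cube s))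
      (BDIS.weakMixedDeriv (BDIS.cube s) v (BDIS.transformed φ p θ f)) ≤ 2 ^ s * R := by
    intro v
    simp only [BDIS.lqNorm, Real.rpow_one, div_one]
    have e : ∫ u in BDIS.cube s,
        |BDIS.weakMixedDeriv (BDIS.cube s) v (BDIS.transformed φ p θ f) u| =
        ∫ u in BDIS.cube s, |∑ t ∈ v.powerset, BDIS.transformedTerm φ p θ f t (v \ t) u| := by
      refine integral_congr_ae ?_
      filter_upwards [hae v] with u hu
      rw [hu]
    rw [e]
    calc ∫ u in BDIS.cube s, |∑ t ∈ v.powerset, BDIS.transformedTerm φ p θ f t (v \ t) u|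
        ≤ ∫ u in BDIS.cube s, ∑ t ∈ v.powerset, |BDIS.transformedTerm φ p θ f t (v \ t) u| :=
          integral_mono (hsum v).abs (integrable_finsetSum _ fun t _ => (hint t (v \ t)).abs)
            fun u => Finset.abs_sum_le_sum_abs _ _
      _ = ∑ t ∈ v.powerset, ∫ u in BDIS.cube s, |BDIS.transformedTerm φ p θ f t (v \ t) u| :=
          integral_finsetSum _ fun t _ => (hint t (v \ t)).abs
      _ ≤ ∑ t ∈ v.powerset, R := Finset.sum_le_sum fun t _ => hbound t (v \ t)
      _ = 2 ^ v.card * R := by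
          rw [Finset.sum_const, Finset.card_powerset, nsmul_eq_mul]; push_cast; rfl
      _ ≤ 2 ^ s * R := by
          have : v.card ≤ s := (Finset.card_le_univ v).trans_eq (Fintype.card_fin s)
          gcongr
          norm_num
  have hprod : BDIS.wMixNormDensity q φ f * ∏ j, (4 * K * θ j ^ (-1 / q - ε)) = 4 ^ s * R := by
    simp only [mul_assoc (4 : ℝ), Finset.prod_mul_distrib, Finset.prod_const, Finset.card_univ,
      Fintype.card_fin, hR]
    ring
  rw [hprod, BDIS.wMixNormCube, BDIS.wMixNorm]
  simp only [Real.rpow_one, div_one]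
  calc ∑ v, BDIS.lqNorm 1 (volume.restrict (BDIS.cube s))
        (BDIS.weakMixedDeriv (BDIS.cube s) v (BDIS.transformed φ p θ f))
      ≤ ∑ _v : Finset (Fin s), 2 ^ s * R := Finset.sum_le_sum fun v _ => hnorm v
    _ = 4 ^ s * R := by
        rw [Finset.sum_const, Finset.card_univ, Fintype.card_finset, Fintype.card_fin, nsmul_eq_mul,
          ← mul_assoc]
        push_cast
        rw [← mul_pow]
        norm_num
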